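/- Let $M\in(0,+\infty]$ and let $\mathsf m\in C^0[0,M)$ be concave and strictly positive on $(0,M)$; if $M<\infty$ put $\mathsf m(M):=\lim_{r\uparrow M}\mathsf m(r)$, and if $M=\infty$ put $\mathsf m'(\infty):=\lim_{r\to\infty}\mathsf m(r)/r$. With $a/0=+\infty$ for $a>0$ and $0/0=0$, let $\phi_{\mathsf m}(\rho,w)=|w|^2/\mathsf m(\rho)$ for $\rho\in[0,M]$ (only $\rho<\infty$), and $+\infty$ otherwise. For a bounded open set $\Omega\subset\mathbb R^d$, a finite positive Borel measure $\mu=\rho\mathcal L^d+\mu^\perp$ and an $\mathbb R^d$-valued measure $\nu=w\mathcal L^d+\nu^\perp$ (Lebesgue decompositions), define $\Phi_{\mathsf m,\Omega}(\mu,\nu)\in[0,\infty]$ as follows. It is $+\infty$ if $\mu$ or $\nu$ is not supported in $\overline\Omega$. Otherwise: if $M<\infty$, it is $\int_\Omega\phi_{\mathsf m}(\rho,w)\,dx$ when $\mu^\perp=0$ and $\nu^\perp=0$; if $M=\infty$ and $\mathsf m'(\infty)=0$, it is $\int_\Omega\phi_{\mathsf m}(\rho,w)\,dx$ when $\nu^\perp=0$;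 if $M=\infty$ and $\mathsf m'(\infty)>0$, it is $\int_\Omega\phi_{\mathsf m}(\rho,w)\,dx+\int_{\overline\Omega}|w^\perp|^2/\mathsf m'(\infty)\,d\mu^\perp$ when $\nu^\perp=w^\perp\mu^\perp\ll\mu^\perp$; and it is $+\infty$ in all remaining cases. Let $\mathcal{CE}_\Omega(\mu_0\to\mu_1)$ be the set of pairs $(\mu,\nu)$ where $(\mu_s)_{s\in[0,1]}$ is a weakly* continuous curve of finite positive measures on $\overline\Omega$ from $\mu_0$ to $\mu_1$, $(\nu_s)_{s\in(0,1)}$ is a Borel family of $\mathbb R^d$-valued measures on $\overline\Omega$ with $\int_0^1|\nu_s|(\overline\Omega)\,ds<\infty$, and $\partial_s\mu_s+\nabla\cdot\nu_s=0$ in the sense of distributions in $(0,1)\times\mathbb R^d$. Let $k\in C^\infty_c(\mathbb R^d)$ be nonnegative with $\int k=1$ and $\operatorname{supp}k=\overline{B_1(0)}$, and let $k_\varepsilon(x)=\varepsilon^{-d}k(x/\varepsilon)$. **Lemma.** Let $\Omega\subset\mathbb R^d$ be nonempty, open, bounded and convex, and let $(\mu,\nu)\in\mathcal{CE}_\Omega(\mu_0\to\mu_1)$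 have mass $\mathfrak m=\mu_0(\mathbb R^d)$ and finite action $\int_0^1\Phi_{\mathsf m,\Omega}(\mu_s,\nu_s)\,ds<\infty$. Then there exist bounded convex open sets $\Omega^\varepsilon$ ($\varepsilon>0$) with $C^\infty$ boundary, with $\Omega^{\varepsilon}\subset\Omega^{\varepsilon'}$ for $\varepsilon\le\varepsilon'$ and $\bigcap_{\varepsilon>0}\Omega^\varepsilon=\overline\Omega$, and for all $\varepsilon>0$ and $\delta\in[0,1]$ curves $(\mu^{\varepsilon,\delta},\nu^{\varepsilon,\delta})\in\mathcal{CE}_{\Omega^\varepsilon}(\mu_0^{\varepsilon,\delta}\to\mu_1^{\varepsilon,\delta})$ such that: 1. $\mu_i^{\varepsilon,\delta}=(1-\delta)\,\mu_i*k_\varepsilon+\delta\lambda^\varepsilon$ for $i=0,1$, where $\lambda^\varepsilon=\frac{\mathfrak m}{\mathcal L^d(\Omega^\varepsilon)}\mathcal L^d|_{\Omega^\varepsilon}$, and $\mu_s^{\varepsilon,\delta}(\Omega^\varepsilon)=\mathfrak m$ for all $s\in[0,1]$. 2. $\mu_s^{\varepsilon,\delta}=\rho_s^{\varepsilon,\delta}\mathcal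 L^d|_{\Omega^\varepsilon}$ and $\nu_s^{\varepsilon,\delta}=w_s^{\varepsilon,\delta}\mathcal L^d|_{\Omega^\varepsilon}$ for all $s\in[0,1]$, with $\rho^{\varepsilon,\delta},w^{\varepsilon,\delta}\in C^\infty([0,1]\times\overline{\Omega^\varepsilon})$. 3. $\partial_s\rho^{\varepsilon,\delta}_s+\nabla\cdot w^{\varepsilon,\delta}_s=0$ pointwise in $(0,1)\times\Omega^\varepsilon$, and $\rho^{\varepsilon,\delta}\ge\delta\,\mathfrak m/\mathcal L^d(\Omega^\varepsilon)$ on $[0,1]\times\overline{\Omega^\varepsilon}$; this lower bound is positive if $\delta>0$ and $\mathfrak m>0$. 4. $\int_0^1\Phi_{\mathsf m,\Omega^\varepsilon}(\mu_s^{\varepsilon,\delta},\nu_s^{\varepsilon,\delta})\,ds\le(1+2\varepsilon)^2\int_0^1\Phi_{\mathsf m,\Omega}(\mu_s,\nu_s)\,ds$. Moreover $\displaystyle\lim_{\varepsilon\downarrow0,\ \delta\downarrow0}\int_0^1\Phi_{\mathsf m,\Omega^\varepsilon}(\mu_s^{\varepsilon,\delta},\nu_s^{\varepsilon,\delta})\,ds=\int_0^1\Phi_{\mathsf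 m,\Omega}(\mu_s,\nu_s)\,ds$ (joint limit, $\delta=0$ allowed). -/

import Mathlib

open Set Filter Topology MeasureTheory
open scoped ContDiff

/-- The Euclidean space `ℝ^d`. -/
abbrev Rd (d : ℕ) : Type := EuclideanSpace ℝ (Fin d)

/-- An open set `U` with `C^∞` boundary: near each boundary point, `U` is the strict sublevel set
of a smooth function with nonvanishing differential. -/
def HasSmoothBoundary {d : ℕ} (U : Set (Rd d)) : Prop :=
  ∀ x ∈ frontier U, ∃ (V : Set (Rd d)) (g : Rd d → ℝ),
    IsOpen V ∧ x ∈ V ∧ ContDiffOn ℝ ∞ g V ∧ fderiv ℝ g x ≠ 0 ∧ U ∩ V = {y | y ∈ V ∧ g y < 0}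

/-! ### The continuity equation -/

/-- `(μ, ν)` belongs to `CE_Ω(μ₀ → μ₁)`: a weakly* continuous curve of finite positive measures
`μ_s`, `s ∈ [0,1]`, on `closure Ω` from `μ₀` to `μ₁`, and a Borel family of `ℝ^d`-valued measures
`ν_s`, `s ∈ (0,1)`, on `closure Ω` with integrable total variation, such that
`∂_s μ_s + ∇ · ν_s = 0` in the sense of distributions in `(0,1) × ℝ^d`.
Values of `μ s` and `ν s` at other `s` play no role. -/
structure IsCE {d : ℕ} (Ω : Set (Rd d)) (μ₀ μ₁ : Measure (Rd d))
    (μ : ℝ → Measure (Rd d)) (ν : ℝ → VectorMeasure (Rd d) (Rd d)) : Prop where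
  finite : ∀ s ∈ Icc (0 : ℝ) 1, IsFiniteMeasure (μ s)
  concentrated_μ : ∀ s ∈ Icc (0 : ℝ) 1, μ s (closure Ω)ᶜ = 0
  concentrated_ν : ∀ s ∈ Ioo (0 : ℝ) 1, (ν s).variation (closure Ω)ᶜ = 0
  weakStar_continuous : ∀ f : Rd d → ℝ, Continuous f → HasCompactSupport f →
    ContinuousOn (fun s => ∫ x, f x ∂(μ s)) (Icc 0 1)
  initial : μ 0 = μ₀
  final : μ 1 = μ₁
  borel : ∀ B : Set (Rd d), MeasurableSet B → Measurable fun s : Ioo (0 : ℝ) 1 => ν s B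
  variation_integrable : ∫⁻ s in Ioo (0 : ℝ) 1, (ν s).variation (closure Ω) < ⊤
  continuity_equation : ∀ φ : ℝ × Rd d → ℝ, ContDiff ℝ ∞ φ → HasCompactSupport φ →
    tsupport φ ⊆ Ioo (0 : ℝ) 1 ×ˢ univ →
    ∫ s in Ioo (0 : ℝ) 1,
      ((∫ x, deriv (fun t => φ (t, x)) s ∂(μ s)) +
        (ν s).integral (fun x => gradient (fun y => φ (s, y)) x) (innerSL ℝ)) = 0

/-! ### Mobility and action -/

/-- A concave mobility `m ∈ C⁰[0,M)`, strictly positive in `(0,M)`, with `M ∈ (0,+∞]`.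
Values of `m` outside `[0,M)` play no role. -/
structure IsMobility (M : ENNReal) (m : ℝ → ℝ) : Prop where
  threshold_pos : 0 < M
  concave : ConcaveOn ℝ {r : ℝ | 0 ≤ r ∧ ENNReal.ofReal r < M} m
  continuous : ContinuousOn m {r : ℝ | 0 ≤ r ∧ ENNReal.ofReal r < M}
  pos : ∀ r : ℝ, 0 < r → ENNReal.ofReal r < M → 0 < m r

/-- The mobility on `[0,M]`: at a finite `M` it is the left limit of `m`. -/
noncomputable def mobilityExt (M : ENNReal) (m : ℝ → ℝ) (r : ℝ) : ℝ :=
  if ENNReal.ofReal r < M then m r else Function.leftLim m r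

/-- `m'(∞) = lim_{r → ∞} m(r) / r` (used only if `M = ∞`). -/
noncomputable def mobilitySlope (m : ℝ → ℝ) : ℝ :=
  limUnder atTop fun r : ℝ => m r / r

/-- The action density `φ_m(ρ, w) = |w|² / m(ρ)` if `ρ ∈ [0,M]`, and `+∞` otherwise. Division in
`[0,∞]` obeys `0 / 0 = 0` and `a / 0 = ∞` for `a > 0`. -/
noncomputable def actionDensity {d : ℕ} (M : ENNReal) (m : ℝ → ℝ) (ρ : ℝ) (w : Rd d) : ENNReal :=
  open Classical in
  if 0 ≤ ρ ∧ ENNReal.ofReal ρ ≤ M then ‖w‖ₑ ^ 2 / ENNReal.ofReal (mobilityExt M m ρ) else ⊤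

/-- The `i`-th component of an `ℝ^d`-valued measure. -/
noncomputable def vecComponent {d : ℕ} (ν : VectorMeasure (Rd d) (Rd d)) (i : Fin d) :
    SignedMeasure (Rd d) :=
  ν.mapRange ((EuclideanSpace.proj i : Rd d →L[ℝ] ℝ) : Rd d →ₗ[ℝ] ℝ).toAddMonoidHom
    (EuclideanSpace.proj i : Rd d →L[ℝ] ℝ).continuous

/-- The density with respect to `σ` of the absolutely continuous part of `ν`. -/
noncomputable def vecRnDeriv {d : ℕ} (ν : VectorMeasure (Rd d) (Rd d)) (σ : Measure (Rd d)) :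
    Rd d → Rd d :=
  fun x => WithLp.toLp 2 fun i => (vecComponent ν i).rnDeriv σ x

/-- The singular part `ν^⊥` of `ν` with respect to the Lebesgue measure. -/
noncomputable def vecSingularPart {d : ℕ} (ν : VectorMeasure (Rd d) (Rd d)) :
    VectorMeasure (Rd d) (Rd d) :=
  ν - (volume : Measure (Rd d)).withDensityᵥ (vecRnDeriv ν volume)

/-- The action functional `Φ_{m,Ω}(μ, ν)`. -/
noncomputable def actionFunctional {d : ℕ} (M : ENNReal) (m : ℝ → ℝ) (Ω : Set (Rd d))
    (μ : Measure (Rd d)) (ν : VectorMeasure (Rd d) (Rd d)) : ENNReal :=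
  open Classical in
  let acPart : ENNReal :=
    ∫⁻ x in Ω, actionDensity M m (μ.rnDeriv volume x).toReal (vecRnDeriv ν volume x)
  let μs : Measure (Rd d) := μ.singularPart volume
  let νs : VectorMeasure (Rd d) (Rd d) := vecSingularPart ν
  if ¬ (μ (closure Ω)ᶜ = 0 ∧ ν.variation (closure Ω)ᶜ = 0) then ⊤
  else if M < ⊤ then
    if μs = 0 ∧ νs = 0 then acPart else ⊤
  else if mobilitySlope m = 0 then
    if νs = 0 then acPart else ⊤
  else
    if νs ≪ᵥ μs.toENNRealVectorMeasure then
      acPart + ∫⁻ x in closure Ω, ‖vecRnDeriv νs μs x‖ₑ ^ 2 / ENNReal.ofReal (mobilitySlope m) ∂μs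
    else ⊤

/-- The action `∫₀¹ Φ_{m,Ω}(μ_s, ν_s) ds` of a curve. -/
noncomputable def curveAction {d : ℕ} (M : ENNReal) (m : ℝ → ℝ) (Ω : Set (Rd d))
    (μ : ℝ → Measure (Rd d)) (ν : ℝ → VectorMeasure (Rd d) (Rd d)) : ENNReal :=
  ∫⁻ s in Ioo (0 : ℝ) 1, actionFunctional M m Ω (μ s) (ν s)

/-! ### Mollification and the uniform measure -/

/-- A nonnegative smooth convolution kernel with integral `1` and support the closed unit ball. -/
structure IsKernel {d : ℕ} (k : Rd d → ℝ) : Prop where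
  smooth : ContDiff ℝ ∞ k
  nonneg : ∀ x, 0 ≤ k x
  integral_eq_one : ∫ x, k x = 1
  support_eq : tsupport k = Metric.closedBall 0 1

/-- `k_ε(x) = ε^{-d} k(x / ε)`. -/
noncomputable def rescaledKernel {d : ℕ} (k : Rd d → ℝ) (ε : ℝ) (x : Rd d) : ℝ :=
  (ε ^ d)⁻¹ * k (ε⁻¹ • x)

/-- The measure `μ * k_ε`, with Lebesgue density `x ↦ ∫ k_ε(x - y) dμ(y)`. -/
noncomputable def mollify {d : ℕ} (μ : Measure (Rd d)) (k : Rd d → ℝ) (ε : ℝ) : Measure (Rd d) :=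
  volume.withDensity fun x => ENNReal.ofReal (∫ y, rescaledKernel k ε (x - y) ∂μ)

/-- The uniform measure of mass `𝔪` on `U`: `(𝔪 / |U|)` times the Lebesgue measure on `U`. -/
noncomputable def uniformMeasure {d : ℕ} (U : Set (Rd d)) (𝔪 : NNReal) : Measure (Rd d) :=
  ((𝔪 : ENNReal) / volume U) • volume.restrict U

/-- The measure `(1 - δ) μ * k_ε + δ λ`, with `λ` the uniform measure of mass `𝔪` on `U`. -/
noncomputable def smoothedEndpoint {d : ℕ} (U : Set (Rd d)) (𝔪 : NNReal) (k : Rd d → ℝ)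
    (ε δ : ℝ) (μ : Measure (Rd d)) : Measure (Rd d) :=
  ENNReal.ofReal (1 - δ) • mollify μ k ε + ENNReal.ofReal δ • uniformMeasure U 𝔪

/-- The divergence of a vector field at a point. -/
noncomputable def divergenceAt {d : ℕ} (v : Rd d → Rd d) (x : Rd d) : ℝ :=
  ∑ i, (fderiv ℝ v x (EuclideanSpace.single i 1)) i

/-! The approximating curves are space-time mollifications. The measures are extended to all times
by their endpoint values and the momenta by zero, and the continuity equation survives on the whole
line (`IsCE.isGlobalCE`). Mollifying in time and space at scale `ε` preserves this linear equation
and makes it smooth. The time change `s ↦ (1 + 2ε)s - ε`, which multiplies the momentum by `1 + 2ε`,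
turns the endpoints into pure space mollifications of `μ₀` and `μ₁`. Mixing with the uniform state
at rest bounds the density from below. The domains are sublevel sets of the mollified distance to
`Ω`, a smooth convex function.

The action is handled through the reference measure `λ_μ = m(ρ)ℒ + m'(∞)μ^⊥` (`mobilityMeasure`).
Finite action forces `ν = u λ_μ`, and the action is then `∫ |u|² dλ_μ` (`IsMobility.exists_density`,
`IsMobility.actionFunctional_eq`), whatever case of the definition applies.

Upper bound. Concavity and `m(r + t) ≥ m(r) + m'(∞)t` give `k_η * λ_μ ≤ m(k_η * μ)`. Combined with
Cauchy–Schwarz, this shows that space mollification does not increase the action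
(`IsMobility.lintegral_actionDensity_moll_le`). Jensen in time, the mixing inequality and the time
change yield the factor `(1 + 2ε)²` (`IsGlobalCE.curveAction_approx_le`).

Lower bound. At a second, fixed scale `η`, the mollified approximations converge pointwise to the
mollified curve. Fatou's lemma, and once more the fact that mollification does not increase the
action, bound the action of the `η`-mollified curve by the limit inferior of the approximating
actions. Letting `η → 0` requires lower semicontinuity along mollifications
(`IsMobility.actionFunctional_le_liminf`). This is a duality argument: an upper bound `A` for the
mollified actions gives `(∫ b·dν)² ≤ A ∫ |b|² dλ_μ`, and the Riesz theorem returns a density `u`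
with `∫ |u|² dλ_μ ≤ A`.

For finite `M` the bound `μ_s ≤ Mℒ` is needed at every time. Finite action gives it for almost every
time, and weak* continuity for all (`IsCE.isAdmissible`). -/

/-! ### Mobilities -/

/-- The closed interval `[0,M]`, intersected with the reals. -/
def mobilityDomain (M : ENNReal) : Set ℝ := {r | 0 ≤ r ∧ ENNReal.ofReal r ≤ M}

/-- The weight of the singular part in the action: `m'(∞)` if `M = ∞`, and zero otherwise. -/
noncomputable def recessionSlope (M : ENNReal) (m : ℝ → ℝ) : ℝ :=
  open Classical in if M < ⊤ then 0 else mobilitySlope m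

lemma mobilityDomain_top : mobilityDomain ⊤ = Ici 0 := by
  ext r; simp [mobilityDomain]

lemma mobilityDomain_of_lt_top {M : ENNReal} (hM : M < ⊤) :
    mobilityDomain M = Icc 0 M.toReal := by
  ext r
  simp only [mobilityDomain, Set.mem_ofPred_eq, mem_Icc]
  rw [ENNReal.ofReal_le_iff_le_toReal hM.ne]

lemma isClosed_mobilityDomain (M : ENNReal) : IsClosed (mobilityDomain M) := by
  rcases eq_top_or_lt_top M with rfl | hM
  · rw [mobilityDomain_top]; exact isClosed_Ici
  · rw [mobilityDomain_of_lt_top hM]; exact isClosed_Icc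

lemma convex_mobilityDomain (M : ENNReal) : Convex ℝ (mobilityDomain M) := by
  rcases eq_top_or_lt_top M with rfl | hM
  · rw [mobilityDomain_top]; exact convex_Ici 0
  · rw [mobilityDomain_of_lt_top hM]; exact convex_Icc _ _

lemma zero_mem_mobilityDomain (M : ENNReal) : (0 : ℝ) ∈ mobilityDomain M := by
  simp [mobilityDomain]

namespace IsMobility

variable {M : ENNReal} {m : ℝ → ℝ} (hm : IsMobility M m)
include hm

lemma zero_mem : (0 : ℝ) ∈ {r : ℝ | 0 ≤ r ∧ ENNReal.ofReal r < M} := by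
  simpa using hm.threshold_pos

lemma toReal_pos (hM : M < ⊤) : 0 < M.toReal :=
  ENNReal.toReal_pos hm.threshold_pos.ne' hM.ne

lemma eventually_lt : ∀ᶠ r in 𝓝[>] (0 : ℝ), ENNReal.ofReal r < M := by
  have : Tendsto ENNReal.ofReal (𝓝[>] 0) (𝓝 (ENNReal.ofReal 0)) :=
    (ENNReal.continuous_ofReal.tendsto 0).mono_left nhdsWithin_le_nhds
  exact this.eventually_lt_const (by simpa using hm.threshold_pos)

lemma nonneg {r : ℝ} (hr : 0 ≤ r) (hrM : ENNReal.ofReal r < M) : 0 ≤ m r := by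
  rcases hr.eq_or_lt with rfl | hr
  · have h1 : Tendsto m (𝓝[>] 0) (𝓝 (m 0)) := by
      refine (hm.continuous 0 hm.zero_mem).mono_left ?_
      refine le_inf nhdsWithin_le_nhds (le_principal_iff.2 ?_)
      filter_upwards [hm.eventually_lt, self_mem_nhdsWithin] with r h1 h2
      exact ⟨le_of_lt h2, h1⟩
    refine ge_of_tendsto h1 ?_
    filter_upwards [hm.eventually_lt, self_mem_nhdsWithin] with r h1 h2
    exact (hm.pos r h2 h1).le
  · exact (hm.pos r hr hrM).le

/-- A concave function that is nonnegative at `0` lies above its chords from the origin, so its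
secant slopes decrease. Both `m'(∞)` and the left limit at a finite threshold owe their existence to
this monotonicity. -/
lemma div_anti {r s : ℝ} (hr : 0 < r) (hrs : r ≤ s) (hs : ENNReal.ofReal s < M) :
    m s / s ≤ m r / r := by
  have hs0 : 0 < s := hr.trans_le hrs
  have h1 : r / s ≤ 1 := (div_le_one hs0).2 hrs
  have := hm.concave.2 (show s ∈ _ from ⟨hs0.le, hs⟩) hm.zero_mem
    (show (0 : ℝ) ≤ r / s by positivity) (show (0 : ℝ) ≤ 1 - r / s by linarith) (by ring)
  have h0 := hm.nonneg le_rfl (by simpa using hm.threshold_pos)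
  simp only [smul_eq_mul, mul_zero, add_zero] at this
  rw [div_mul_cancel₀ _ hs0.ne'] at this
  have h3 : 0 ≤ (1 - r / s) * m 0 := mul_nonneg (by linarith) h0
  rw [div_le_div_iff₀ hs0 hr]
  have h4 : r / s * m s ≤ m r := by linarith
  calc m s * r = (r / s * m s) * s := by field_simp
    _ ≤ m r * s := by gcongr

lemma tendsto_mobilitySlope (hM : M = ⊤) :
    Tendsto (fun r => m r / r) atTop (𝓝 (mobilitySlope m)) := by
  -- Replacing `r` by `max r 1` keeps away from the singularity at `0` and makes the slope monotone
  -- on the whole line without changing its behaviour at infinity.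
  have hanti : Antitone fun r => m (max r 1) / (max r 1) := fun r s hrs =>
    hm.div_anti (by positivity) (max_le_max_right _ hrs) (by simp [hM])
  have hb : BddBelow (range fun r => m (max r 1) / (max r 1)) := by
    refine ⟨0, ?_⟩
    rintro _ ⟨r, rfl⟩
    exact div_nonneg (hm.nonneg (by positivity) (by simp [hM])) (by positivity)
  have h := tendsto_atTop_ciInf hanti hb
  have h' : Tendsto (fun r => m r / r) atTop (𝓝 (⨅ r : ℝ, m (max r 1) / (max r 1))) := by
    refine h.congr' ?_
    filter_upwards [eventually_ge_atTop 1] with r hr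
    rw [max_eq_left hr]
  exact tendsto_nhds_limUnder ⟨_, h'⟩

lemma mobilitySlope_nonneg (hM : M = ⊤) : 0 ≤ mobilitySlope m := by
  refine ge_of_tendsto (hm.tendsto_mobilitySlope hM) ?_
  filter_upwards [eventually_ge_atTop 0] with r hr
  exact div_nonneg (hm.nonneg hr (by simp [hM])) hr

lemma recessionSlope_nonneg : 0 ≤ recessionSlope M m := by
  unfold recessionSlope
  split_ifs with h
  · exact le_rfl
  · exact hm.mobilitySlope_nonneg (not_lt_top_iff.1 h)

/-- The factorisation `m r = r * (m r / r)` reduces the limit to that of a decreasing function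
bounded below. -/
lemma exists_tendsto (hM : M < ⊤) : ∃ l, Tendsto m (𝓝[<] M.toReal) (𝓝 l) := by
  have hT := hm.toReal_pos hM
  have hlt : ∀ {r : ℝ}, r < M.toReal → ENNReal.ofReal r < M := fun {r} hr => by
    rw [← ENNReal.ofReal_toReal hM.ne]; exact (ENNReal.ofReal_lt_ofReal_iff hT).2 hr
  have hanti : AntitoneOn (fun r => m r / r) (Ioo 0 M.toReal) := fun r hr s hs hrs =>
    hm.div_anti hr.1 hrs (hlt hs.2)
  have hb : BddBelow ((fun r => m r / r) '' Ioo 0 M.toReal) := by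
    refine ⟨0, ?_⟩
    rintro _ ⟨r, hr, rfl⟩
    exact div_nonneg (hm.nonneg hr.1.le (hlt hr.2)) hr.1.le
  have h := hanti.tendsto_nhdsWithin_Ioo_left (nonempty_Ioo.2 hT) hb
  have h2 : Tendsto (fun r : ℝ => r) (𝓝[<] M.toReal) (𝓝 M.toReal) :=
    tendsto_id.mono_left nhdsWithin_le_nhds
  refine ⟨_, (h2.mul h).congr' ?_⟩
  filter_upwards [Ioo_mem_nhdsLT hT] with r hr
  have := hr.1.ne'
  field_simp

omit hm in
lemma _root_.mobilityExt_of_lt {r : ℝ} (hr : ENNReal.ofReal r < M) : mobilityExt M m r = m r := by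
  simp [mobilityExt, hr]

lemma continuousOn_mobilityExt : ContinuousOn (mobilityExt M m) (mobilityDomain M) := by
  intro r hr
  rcases hr.2.lt_or_eq with hlt | heq
  · have hev : ∀ᶠ s in 𝓝[mobilityDomain M] r, s ∈ {r : ℝ | 0 ≤ r ∧ ENNReal.ofReal r < M} := by
      filter_upwards [self_mem_nhdsWithin, mem_nhdsWithin_of_mem_nhds
        ((ENNReal.continuous_ofReal.tendsto r).eventually_lt_const hlt)] with s h1 h2
      exact ⟨h1.1, h2⟩
    have h := (hm.continuous r ⟨hr.1, hlt⟩).mono_left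
      (le_inf nhdsWithin_le_nhds (le_principal_iff.2 hev))
    rw [ContinuousWithinAt, mobilityExt_of_lt hlt]
    refine Tendsto.congr' ?_ h
    filter_upwards [hev] with s hs
    rw [mobilityExt_of_lt hs.2]
  · have hM : M < ⊤ := heq ▸ ENNReal.ofReal_lt_top
    have hrT : r = M.toReal := by rw [← heq, ENNReal.toReal_ofReal hr.1]
    obtain ⟨l, hl⟩ := hm.exists_tendsto hM
    rw [← hrT] at hl
    have hl' : mobilityExt M m r = l := by
      rw [mobilityExt, if_neg heq.not_lt]
      exact leftLim_eq_of_tendsto hl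
    have h1 : Tendsto (mobilityExt M m) (𝓝[<] r) (𝓝 (mobilityExt M m r)) := by
      rw [hl']
      refine hl.congr' ?_
      have hr0 : 0 < r := hrT ▸ hm.toReal_pos hM
      filter_upwards [self_mem_nhdsWithin] with s hs
      rw [mobilityExt_of_lt]
      rw [← heq]; exact (ENNReal.ofReal_lt_ofReal_iff hr0).2 hs
    have h2 : ContinuousWithinAt (mobilityExt M m) (Iio r ∪ {r}) r :=
      ContinuousWithinAt.union h1 continuousWithinAt_singleton
    refine h2.mono ?_
    rw [mobilityDomain_of_lt_top hM, ← hrT]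
    intro s hs
    rcases hs.2.lt_or_eq with h | h
    · exact Or.inl h
    · exact Or.inr h

/-- Contraction towards `0` moves the closed domain, finite threshold included, into `[0,M)`.
Letting `c ↑ 1` then transfers concavity and nonnegativity from `m` to its extension. -/
lemma mul_mem {r c : ℝ} (hr : r ∈ mobilityDomain M) (hc : 0 ≤ c) (hc1 : c < 1) :
    c * r ∈ {r : ℝ | 0 ≤ r ∧ ENNReal.ofReal r < M} := by
  refine ⟨mul_nonneg hc hr.1, ?_⟩
  rcases hr.1.eq_or_lt with h | h
  · simpa [← h] using hm.threshold_pos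
  · exact ((ENNReal.ofReal_lt_ofReal_iff h).2 (by nlinarith)).trans_le hr.2

lemma tendsto_mul_left {r : ℝ} (hr : r ∈ mobilityDomain M) :
    Tendsto (fun c => m (c * r)) (𝓝[<] 1) (𝓝 (mobilityExt M m r)) := by
  have h0 : Tendsto (fun c : ℝ => c * r) (𝓝[<] 1) (𝓝[mobilityDomain M] r) := by
    refine tendsto_nhdsWithin_iff.2 ⟨?_, ?_⟩
    · have : Tendsto (fun c : ℝ => c * r) (𝓝 1) (𝓝 (1 * r)) := tendsto_id.mul_const r
      rw [one_mul] at this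
      exact this.mono_left nhdsWithin_le_nhds
    · filter_upwards [Ioo_mem_nhdsLT (zero_lt_one' ℝ)] with c hc
      have := hm.mul_mem hr hc.1.le hc.2
      exact ⟨this.1, this.2.le⟩
  refine ((hm.continuousOn_mobilityExt r hr).tendsto.comp h0).congr' ?_
  filter_upwards [Ioo_mem_nhdsLT (zero_lt_one' ℝ)] with c hc
  exact mobilityExt_of_lt (hm.mul_mem hr hc.1.le hc.2).2

lemma concaveOn_mobilityExt : ConcaveOn ℝ (mobilityDomain M) (mobilityExt M m) := by
  refine ⟨convex_mobilityDomain M, fun x hx y hy a b ha hb hab => ?_⟩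
  have hxy := convex_mobilityDomain M hx hy ha hb hab
  refine le_of_tendsto_of_tendsto
    (((hm.tendsto_mul_left hx).const_smul a).add ((hm.tendsto_mul_left hy).const_smul b))
    (hm.tendsto_mul_left hxy) ?_
  filter_upwards [Ioo_mem_nhdsLT (zero_lt_one' ℝ)] with c hc
  have := hm.concave.2 (hm.mul_mem hx hc.1.le hc.2) (hm.mul_mem hy hc.1.le hc.2) ha hb hab
  refine this.trans (le_of_eq ?_)
  congr 1
  simp only [smul_eq_mul]; ring

lemma mobilityExt_nonneg {r : ℝ} (hr : r ∈ mobilityDomain M) : 0 ≤ mobilityExt M m r := by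
  refine ge_of_tendsto (hm.tendsto_mul_left hr) ?_
  filter_upwards [Ioo_mem_nhdsLT (zero_lt_one' ℝ)] with c hc
  have := hm.mul_mem hr hc.1.le hc.2
  exact hm.nonneg this.1 this.2

/-- Sublinear growth beyond the recession slope. -/
lemma exists_le_add {κ : ℝ} (hκ : 0 < κ) : ∃ C, 0 ≤ C ∧ ∀ r ∈ mobilityDomain M,
    mobilityExt M m r ≤ (recessionSlope M m + κ) * r + C := by
  have key : ∃ R : ℝ, ∀ r ∈ mobilityDomain M, R ≤ r →
      mobilityExt M m r ≤ (recessionSlope M m + κ) * r := by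
    rcases eq_top_or_lt_top M with hM | hM
    · have h1 := (hm.tendsto_mobilitySlope hM).eventually_lt_const
        (lt_add_of_pos_right (mobilitySlope m) hκ)
      obtain ⟨R, hR⟩ := (h1.and (eventually_gt_atTop 0)).exists_forall_of_atTop
      refine ⟨R, fun r _ hRr => ?_⟩
      obtain ⟨h2, h3⟩ := hR r hRr
      rw [mobilityExt_of_lt (by simp [hM])]
      have : recessionSlope M m = mobilitySlope m := by simp [recessionSlope, hM]
      rw [this]
      exact ((div_lt_iff₀ h3).1 h2).le
    -- For a finite threshold the domain is bounded and the condition at large densities is void.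
    · refine ⟨M.toReal + 1, fun r hr hRr => ?_⟩
      rw [mobilityDomain_of_lt_top hM] at hr
      linarith [hr.2]
  obtain ⟨R, hR⟩ := key
  have hcomp : IsCompact (mobilityDomain M ∩ Icc 0 R) :=
    isCompact_Icc.inter_left (isClosed_mobilityDomain M)
  obtain ⟨C, hC⟩ := hcomp.bddAbove_image (hm.continuousOn_mobilityExt.mono inter_subset_left)
  refine ⟨max C 0, le_max_right _ _, fun r hr => ?_⟩
  have h0 : 0 ≤ (recessionSlope M m + κ) * r :=
    mul_nonneg (add_nonneg hm.recessionSlope_nonneg hκ.le) hr.1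
  rcases le_total R r with h | h
  · exact (hR r hr h).trans (le_add_of_nonneg_right (le_max_right _ _))
  · have := hC ⟨r, ⟨hr, hr.1, h⟩, rfl⟩
    exact (this.trans (le_max_left _ _)).trans (le_add_of_nonneg_left h0)

/-- Write `r + t` as a convex combination of `r` and a far point `R`, with weight `t / (R - r)` on
`R`. As `R → ∞`, the concavity inequality tends to the claim. It is used to absorb the singular part
of a measure into the mobility of its mollification. -/
lemma add_slope_mul_le (hM : M = ⊤) {r t : ℝ} (hr : 0 ≤ r) (ht : 0 ≤ t) :
    mobilityExt M m r + recessionSlope M m * t ≤ mobilityExt M m (r + t) := by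
  rw [mobilityExt_of_lt (by simp [hM]), mobilityExt_of_lt (by simp [hM])]
  have hs : recessionSlope M m = mobilitySlope m := by simp [recessionSlope, hM]
  rw [hs]
  have e1 : Tendsto (fun R : ℝ => (R - r)⁻¹) atTop (𝓝 0) :=
    tendsto_inv_atTop_zero.comp (tendsto_atTop_add_const_right _ (-r) tendsto_id)
  have l1 : Tendsto (fun R : ℝ => (1 - t * (R - r)⁻¹) * m r
      + (t * (1 + r * (R - r)⁻¹)) * (m R / R)) atTop
      (𝓝 ((1 - t * 0) * m r + (t * (1 + r * 0)) * mobilitySlope m)) :=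
    (((e1.const_mul t).const_sub 1).mul_const _).add
      ((((e1.const_mul r).const_add 1).const_mul t).mul (hm.tendsto_mobilitySlope hM))
  have l2 : (1 - t * 0) * m r + (t * (1 + r * 0)) * mobilitySlope m
      = m r + mobilitySlope m * t := by ring
  rw [l2] at l1
  refine le_of_tendsto l1 ?_
  filter_upwards [eventually_gt_atTop (r + t), eventually_gt_atTop 0] with R hR hR0
  rcases ht.eq_or_lt with rfl | ht
  · simp
  have hRr : 0 < R - r := by linarith
  have h1 : t * (R - r)⁻¹ ≤ 1 := by rw [← div_eq_mul_inv, div_le_one hRr]; linarith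
  have := hm.concave.2 (show r ∈ _ from ⟨hr, by simp [hM]⟩) (show R ∈ _ from ⟨hR0.le, by simp [hM]⟩)
    (show 0 ≤ 1 - t * (R - r)⁻¹ by linarith) (show 0 ≤ t * (R - r)⁻¹ by positivity) (by ring)
  simp only [smul_eq_mul] at this
  have e2 : (1 - t * (R - r)⁻¹) * r + t * (R - r)⁻¹ * R = r + t := by field_simp; ring
  rw [e2] at this
  refine le_trans (le_of_eq ?_) this
  field_simp
  ring

end IsMobility

/-! ### Mollification kernels -/

namespace IsKernel

variable {d : ℕ} {k : Rd d → ℝ} (hk : IsKernel k)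
include hk

lemma hasCompactSupport : HasCompactSupport k := by
  rw [HasCompactSupport, hk.support_eq]; exact isCompact_closedBall _ _

lemma continuous : Continuous k := hk.smooth.continuous

lemma integrable : Integrable k := hk.continuous.integrable_of_hasCompactSupport hk.hasCompactSupport

lemma eq_zero {x : Rd d} (hx : 1 < ‖x‖) : k x = 0 := by
  refine image_eq_zero_of_notMem_tsupport ?_
  rw [hk.support_eq]; simpa using hx

lemma exists_le : ∃ C, 0 ≤ C ∧ ∀ x, k x ≤ C := by
  obtain ⟨C, hC⟩ := hk.continuous.bounded_above_of_compact_support hk.hasCompactSupport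
  exact ⟨C, (norm_nonneg _).trans (hC 0), fun x => (le_abs_self _).trans (hC x)⟩

lemma rescaledKernel_smooth (ε : ℝ) : ContDiff ℝ ∞ (rescaledKernel k ε) :=
  contDiff_const.mul (hk.smooth.comp (contDiff_const_smul ε⁻¹))

lemma rescaledKernel_continuous (ε : ℝ) : Continuous (rescaledKernel k ε) :=
  (hk.rescaledKernel_smooth ε).continuous

lemma rescaledKernel_nonneg {ε : ℝ} (hε : 0 < ε) (x : Rd d) : 0 ≤ rescaledKernel k ε x :=
  mul_nonneg (by positivity) (hk.nonneg _)

lemma rescaledKernel_eq_zero {ε : ℝ} (hε : 0 < ε) {x : Rd d} (hx : ε < ‖x‖) :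
    rescaledKernel k ε x = 0 := by
  rw [rescaledKernel, hk.eq_zero, mul_zero]
  rw [norm_smul, norm_inv, Real.norm_of_nonneg hε.le]
  rwa [inv_mul_eq_div, one_lt_div hε]

lemma rescaledKernel_hasCompactSupport {ε : ℝ} (hε : 0 < ε) :
    HasCompactSupport (rescaledKernel k ε) :=
  HasCompactSupport.intro (isCompact_closedBall (0 : Rd d) ε) fun x hx =>
    hk.rescaledKernel_eq_zero hε (by simpa using hx)

lemma rescaledKernel_exists_le {ε : ℝ} (hε : 0 < ε) : ∃ C, 0 ≤ C ∧ ∀ x, rescaledKernel k ε x ≤ C := by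
  obtain ⟨C, h0, hC⟩ := hk.exists_le
  exact ⟨(ε ^ d)⁻¹ * C, by positivity, fun x => mul_le_mul_of_nonneg_left (hC _) (by positivity)⟩

omit hk in
/-- Change of variables in a mollification. -/
lemma _root_.integral_smul_rescaledKernel {E : Type*} [NormedAddCommGroup E] [NormedSpace ℝ E]
    {ε : ℝ} (hε : 0 < ε) (F : Rd d → E) (x : Rd d) :
    ∫ z, rescaledKernel k ε (x - z) • F z = ∫ y, k y • F (x - ε • y) := by
  have h1 : ∫ z, rescaledKernel k ε (x - z) • F z = ∫ z, rescaledKernel k ε z • F (x - z) := by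
    rw [← integral_sub_left_eq_self _ _ x]
    simp
  have h2 := Measure.integral_comp_smul (volume : Measure (Rd d))
    (fun z => rescaledKernel k ε z • F (x - z)) ε
  have hd : Module.finrank ℝ (Rd d) = d := by simp
  rw [hd, abs_of_pos (by positivity)] at h2
  rw [h1]
  calc ∫ z, rescaledKernel k ε z • F (x - z)
      = (ε ^ d) • ((ε ^ d)⁻¹ • ∫ z, rescaledKernel k ε z • F (x - z)) := by
        rw [smul_smul, mul_inv_cancel₀ (by positivity), one_smul]
    _ = ∫ y, k y • F (x - ε • y) := by
        rw [← h2, ← integral_smul]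
        congr 1 with y
        rw [smul_smul, rescaledKernel, ← mul_assoc, mul_inv_cancel₀ (by positivity), one_mul,
          smul_smul, inv_mul_cancel₀ hε.ne', one_smul]

lemma integral_rescaledKernel_sub {ε : ℝ} (hε : 0 < ε) (x : Rd d) :
    ∫ z, rescaledKernel k ε (x - z) = 1 := by
  have := integral_smul_rescaledKernel (k := k) hε (fun _ => (1 : ℝ)) x
  simpa [hk.integral_eq_one] using this

lemma rescaledKernel_integrable {ε : ℝ} (hε : 0 < ε) (x : Rd d) :
    Integrable fun z => rescaledKernel k ε (x - z) :=
  ((hk.rescaledKernel_continuous ε).integrable_of_hasCompactSupport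
    (hk.rescaledKernel_hasCompactSupport hε)).comp_sub_left x

lemma integral_rescaledKernel {ε : ℝ} (hε : 0 < ε) : ∫ z, rescaledKernel k ε z = 1 := by
  rw [← hk.integral_rescaledKernel_sub hε 0, ← integral_sub_left_eq_self _ _ (0 : Rd d)]

lemma integral_rescaledKernel_sub' {ε : ℝ} (hε : 0 < ε) (y : Rd d) :
    ∫ x, rescaledKernel k ε (x - y) = 1 := by
  rw [integral_sub_right_eq_self (rescaledKernel k ε) y, hk.integral_rescaledKernel hε]

lemma lintegral_rescaledKernel_sub {ε : ℝ} (hε : 0 < ε) (y : Rd d) :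
    ∫⁻ x, ENNReal.ofReal (rescaledKernel k ε (x - y)) = 1 := by
  rw [← ofReal_integral_eq_lintegral_ofReal, hk.integral_rescaledKernel_sub' hε, ENNReal.ofReal_one]
  · exact ((hk.rescaledKernel_continuous ε).integrable_of_hasCompactSupport
      (hk.rescaledKernel_hasCompactSupport hε)).comp_sub_right y
  · exact Eventually.of_forall fun x => hk.rescaledKernel_nonneg hε _

lemma lintegral_rescaledKernel_sub_left {ε : ℝ} (hε : 0 < ε) (x : Rd d) :
    ∫⁻ y, ENNReal.ofReal (rescaledKernel k ε (x - y)) = 1 := by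
  rw [← ofReal_integral_eq_lintegral_ofReal (hk.rescaledKernel_integrable hε x),
    hk.integral_rescaledKernel_sub hε, ENNReal.ofReal_one]
  exact Eventually.of_forall fun x => hk.rescaledKernel_nonneg hε _

end IsKernel

/-! ### Smooth convex neighbourhoods of a convex set -/

section Neighbourhoods

variable {d : ℕ}

/-- The mollified distance function to `Ω`. -/
noncomputable def smoothDist (k : Rd d → ℝ) (Ω : Set (Rd d)) (ε : ℝ) (x : Rd d) : ℝ :=
  ∫ y, k y * Metric.infDist (x - ε • y) Ω

/-- A smooth convex neighbourhood of `Ω`. -/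
noncomputable def smoothNhd (k : Rd d → ℝ) (Ω : Set (Rd d)) (ε : ℝ) : Set (Rd d) :=
  -- The mollified distance differs from the distance by at most `ε`, so the level `3ε` captures the
  -- closed `ε`-neighbourhood with room to spare. Its slope in `ε` exceeds the Lipschitz constant
  -- `1` of the mollified distance in `ε`, whence the sets increase with `ε`.
  {x | smoothDist k Ω ε x < 3 * ε}

lemma convexOn_infDist {Ω : Set (Rd d)} (hΩ : Convex ℝ Ω) (hn : Ω.Nonempty) :
    ConvexOn ℝ univ fun x => Metric.infDist x Ω := by
  refine ⟨convex_univ, fun x _ y _ a b ha hb hab => ?_⟩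
  refine le_of_forall_pos_le_add fun η hη => ?_
  obtain ⟨x', hx', hx⟩ := (Metric.infDist_lt_iff hn).1 (lt_add_of_pos_right (Metric.infDist x Ω) hη)
  obtain ⟨y', hy', hy⟩ := (Metric.infDist_lt_iff hn).1 (lt_add_of_pos_right (Metric.infDist y Ω) hη)
  have h1 := Metric.infDist_le_dist_of_mem (x := a • x + b • y) (hΩ hx' hy' ha hb hab)
  have h2 : dist (a • x + b • y) (a • x' + b • y') ≤ a * dist x x' + b * dist y y' := by
    refine (dist_add_add_le _ _ _ _).trans (le_of_eq ?_)
    rw [dist_smul₀, dist_smul₀, Real.norm_of_nonneg ha, Real.norm_of_nonneg hb]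
  have h3 : a * dist x x' + b * dist y y' ≤
      a * (Metric.infDist x Ω + η) + b * (Metric.infDist y Ω + η) := by gcongr
  simp only [smul_eq_mul]
  calc _ ≤ _ := h1.trans (h2.trans h3)
    _ = _ := by linear_combination η * hab

variable {k : Rd d → ℝ} (hk : IsKernel k) {Ω : Set (Rd d)}
include hk

lemma integrable_kernel_mul_infDist (ε : ℝ) (x : Rd d) :
    Integrable fun y => k y * Metric.infDist (x - ε • y) Ω := by
  refine Continuous.integrable_of_hasCompactSupport ?_ hk.hasCompactSupport.mul_right
  have := hk.continuous
  have := Metric.continuous_infDist_pt Ω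
  fun_prop

lemma smoothDist_contDiff {ε : ℝ} (hε : 0 < ε) : ContDiff ℝ ∞ (smoothDist k Ω ε) := by
  have h1 : smoothDist k Ω ε =
      convolution (fun z => Metric.infDist z Ω) (rescaledKernel k ε)
        (ContinuousLinearMap.mul ℝ ℝ) volume := by
    ext x
    have := integral_smul_rescaledKernel (k := k) hε (fun z => Metric.infDist z Ω) x
    simp only [smul_eq_mul] at this
    rw [smoothDist, ← this, convolution]
    simp [mul_comm]
  rw [h1]
  exact (hk.rescaledKernel_hasCompactSupport hε).contDiff_convolution_right _
    (Metric.continuous_infDist_pt Ω).locallyIntegrable (hk.rescaledKernel_smooth ε)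

lemma smoothDist_convexOn (hΩ : Convex ℝ Ω) (hn : Ω.Nonempty) (ε : ℝ) :
    ConvexOn ℝ univ (smoothDist k Ω ε) := by
  refine ⟨convex_univ, fun x _ y _ a b ha hb hab => ?_⟩
  have hx := integrable_kernel_mul_infDist (Ω := Ω) hk ε x
  have hy := integrable_kernel_mul_infDist (Ω := Ω) hk ε y
  simp only [smoothDist, smul_eq_mul]
  rw [← integral_const_mul, ← integral_const_mul, ← integral_add (hx.const_mul a) (hy.const_mul b)]
  refine integral_mono (integrable_kernel_mul_infDist hk ε _)
    ((hx.const_mul a).add (hy.const_mul b)) fun z => ?_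
  have h := (convexOn_infDist hΩ hn).2 (mem_univ (x - ε • z)) (mem_univ (y - ε • z)) ha hb hab
  have e : a • (x - ε • z) + b • (y - ε • z) = a • x + b • y - ε • z := by
    rw [smul_sub, smul_sub, sub_add_sub_comm, ← add_smul, hab, one_smul]
  rw [e] at h
  have := mul_le_mul_of_nonneg_left h (hk.nonneg z)
  simp only [smul_eq_mul] at this ⊢
  linarith

/-- The distance is `1`-Lipschitz and the kernel lives in the unit ball. Taking one scale to be `0`
compares with the true distance; taking `x = x'` gives monotonicity of the neighbourhoods. -/
lemma smoothDist_lipschitz (ε ε' : ℝ) (x x' : Rd d) :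
    smoothDist k Ω ε x ≤ smoothDist k Ω ε' x' + (dist x x' + |ε - ε'|) := by
  have hx := integrable_kernel_mul_infDist (Ω := Ω) hk ε x
  have hx' := integrable_kernel_mul_infDist (Ω := Ω) hk ε' x'
  have e : dist x x' + |ε - ε'| = ∫ y, k y * (dist x x' + |ε - ε'|) := by
    rw [integral_mul_const, hk.integral_eq_one, one_mul]
  rw [e, smoothDist, smoothDist, ← integral_add hx' (hk.integrable.mul_const _)]
  refine integral_mono hx (hx'.add (hk.integrable.mul_const _)) fun y => ?_
  simp only
  rw [← mul_add]
  rcases le_or_gt ‖y‖ 1 with hy | hy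
  · refine mul_le_mul_of_nonneg_left ?_ (hk.nonneg y)
    refine Metric.infDist_le_infDist_add_dist.trans (add_le_add le_rfl ?_)
    refine (dist_sub_sub_le _ _ _ _).trans (add_le_add le_rfl ?_)
    rw [dist_eq_norm, ← sub_smul, norm_smul, Real.norm_eq_abs]
    exact mul_le_of_le_one_right (abs_nonneg _) hy
  · simp [hk.eq_zero hy]

lemma smoothDist_zero (x : Rd d) : smoothDist k Ω 0 x = Metric.infDist x Ω := by
  simp [smoothDist, integral_mul_const, hk.integral_eq_one]

lemma smoothDist_le {ε : ℝ} (hε : 0 ≤ ε) (x : Rd d) :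
    smoothDist k Ω ε x ≤ Metric.infDist x Ω + ε := by
  have := smoothDist_lipschitz hk (Ω := Ω) ε 0 x x
  rwa [smoothDist_zero hk, dist_self, sub_zero, abs_of_nonneg hε, zero_add] at this

lemma le_smoothDist {ε : ℝ} (hε : 0 ≤ ε) (x : Rd d) :
    Metric.infDist x Ω ≤ smoothDist k Ω ε x + ε := by
  have := smoothDist_lipschitz hk (Ω := Ω) 0 ε x x
  rwa [smoothDist_zero hk, dist_self, zero_sub, abs_neg, abs_of_nonneg hε, zero_add] at this

lemma mem_smoothNhd {ε : ℝ} (hε : 0 < ε) {x : Rd d} (hx : Metric.infDist x Ω ≤ ε) :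
    x ∈ smoothNhd k Ω ε := by
  have := smoothDist_le hk (Ω := Ω) hε.le x
  show smoothDist k Ω ε x < 3 * ε
  linarith

lemma infDist_lt_of_mem_smoothNhd {ε : ℝ} (hε : 0 < ε) {x : Rd d} (hx : x ∈ smoothNhd k Ω ε) :
    Metric.infDist x Ω < 4 * ε := by
  have := le_smoothDist hk (Ω := Ω) hε.le x
  have h : smoothDist k Ω ε x < 3 * ε := hx
  linarith

lemma isOpen_smoothNhd {ε : ℝ} (hε : 0 < ε) : IsOpen (smoothNhd k Ω ε) :=
  isOpen_lt (smoothDist_contDiff hk hε).continuous continuous_const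

lemma convex_smoothNhd (hΩ : Convex ℝ Ω) (hn : Ω.Nonempty) (ε : ℝ) :
    Convex ℝ (smoothNhd k Ω ε) := by
  have := (smoothDist_convexOn hk hΩ hn ε).convex_lt (3 * ε)
  simpa [smoothNhd] using this

lemma isBounded_smoothNhd (hb : Bornology.IsBounded Ω) (hn : Ω.Nonempty) {ε : ℝ} (hε : 0 < ε) :
    Bornology.IsBounded (smoothNhd k Ω ε) := by
  refine (hb.thickening (δ := 4 * ε)).subset fun x hx => ?_
  exact (Metric.mem_thickening_iff_infDist_lt hn).2 (infDist_lt_of_mem_smoothNhd hk hε hx)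

lemma smoothNhd_mono {ε ε' : ℝ} (h : ε ≤ ε') : smoothNhd k Ω ε ⊆ smoothNhd k Ω ε' := by
  intro x hx
  have h1 : smoothDist k Ω ε x < 3 * ε := hx
  have h2 := smoothDist_lipschitz hk (Ω := Ω) ε' ε x x
  rw [dist_self, zero_add, abs_of_nonneg (by linarith)] at h2
  show smoothDist k Ω ε' x < 3 * ε'
  linarith

lemma closure_subset_smoothNhd {ε : ℝ} (hε : 0 < ε) : closure Ω ⊆ smoothNhd k Ω ε := by
  intro x hx
  rcases Ω.eq_empty_or_nonempty with rfl | hn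
  · simp at hx
  · exact mem_smoothNhd hk hε (by rw [(Metric.mem_closure_iff_infDist_zero hn).1 hx]; exact hε.le)

lemma iInter_smoothNhd (hn : Ω.Nonempty) :
    ⋂ ε ∈ Ioi (0 : ℝ), smoothNhd k Ω ε = closure Ω := by
  refine Subset.antisymm (fun x hx => ?_)
    (subset_iInter₂ fun ε hε => closure_subset_smoothNhd hk hε)
  rw [Metric.mem_closure_iff_infDist_zero hn]
  refine le_antisymm (le_of_forall_pos_le_add fun η hη => ?_) Metric.infDist_nonneg
  have h1 := mem_iInter₂.1 hx (η / 4) (by simp [hη])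
  have := infDist_lt_of_mem_smoothNhd hk (by positivity) h1
  linarith

/-- A critical point of a convex function is a global minimum. A boundary point has value at least
`3ε`, while the points of `Ω` have smaller value, so the differential cannot vanish: the difference
quotients from `x` towards `x₀ ∈ Ω` stay below a negative constant. -/
lemma hasSmoothBoundary_smoothNhd (hΩ : Convex ℝ Ω) (hn : Ω.Nonempty) {ε : ℝ} (hε : 0 < ε) :
    HasSmoothBoundary (smoothNhd k Ω ε) := by
  intro x hx
  have hC := smoothDist_contDiff hk (Ω := Ω) hε
  refine ⟨univ, fun y => smoothDist k Ω ε y - 3 * ε, isOpen_univ, mem_univ _,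
    (hC.sub contDiff_const).contDiffOn, ?_, ?_⟩
  · intro h0
    rw [fderiv_sub_const] at h0
    have hge : 3 * ε ≤ smoothDist k Ω ε x := by
      have := hx.2
      rw [(isOpen_smoothNhd hk hε).interior_eq] at this
      exact not_lt.1 this
    obtain ⟨x₀, hx₀⟩ := hn
    have hlt : smoothDist k Ω ε x₀ < 3 * ε :=
      closure_subset_smoothNhd hk hε (subset_closure hx₀)
    have hdiff : HasFDerivAt (smoothDist k Ω ε) (0 : Rd d →L[ℝ] ℝ) x :=
      h0 ▸ (hC.differentiable (by simp) x).hasFDerivAt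
    have hline : HasDerivAt (fun t : ℝ => smoothDist k Ω ε (x + t • (x₀ - x))) 0 0 := by
      have h1 : HasDerivAt (fun t : ℝ => x + t • (x₀ - x)) (x₀ - x) 0 := by
        simpa using ((hasDerivAt_id (0 : ℝ)).smul_const (x₀ - x)).const_add x
      have h2 := HasFDerivAt.comp_hasDerivAt (f := fun t : ℝ => x + t • (x₀ - x)) (0 : ℝ)
        (l := smoothDist k Ω ε) (l' := 0) (by simpa using hdiff) h1
      simpa [Function.comp_def] using h2
    have hslope := hline.tendsto_slope_zero_right
    have hneg : ∀ᶠ t : ℝ in 𝓝[>] 0, t⁻¹ • (smoothDist k Ω ε (x + (0 + t) • (x₀ - x))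
        - smoothDist k Ω ε (x + (0 : ℝ) • (x₀ - x))) ≤
          smoothDist k Ω ε x₀ - smoothDist k Ω ε x := by
      filter_upwards [Ioo_mem_nhdsGT (zero_lt_one' ℝ)] with t ht
      have h := (smoothDist_convexOn hk hΩ ⟨x₀, hx₀⟩ ε).2 (mem_univ x) (mem_univ x₀)
        (sub_nonneg.2 ht.2.le) ht.1.le (by ring)
      have e : (1 - t) • x + t • x₀ = x + (0 + t) • (x₀ - x) := by
        rw [zero_add, smul_sub, sub_smul, one_smul]; abel
      rw [e] at h
      simp only [smul_eq_mul, zero_smul, add_zero] at h ⊢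
      rw [inv_mul_le_iff₀ ht.1]
      linarith
    have := le_of_tendsto hslope hneg
    linarith
  · ext y; simp [smoothNhd]

end Neighbourhoods

/-! ### Vector measures -/

section VectorMeasures

variable {d : ℕ}

/-- The positive part of the `i`-th component of a vector measure. -/
noncomputable def posComp (ν : VectorMeasure (Rd d) (Rd d)) (i : Fin d) : Measure (Rd d) :=
  (vecComponent ν i).toJordanDecomposition.posPart

/-- The negative part of the `i`-th component of a vector measure. -/
noncomputable def negComp (ν : VectorMeasure (Rd d) (Rd d)) (i : Fin d) : Measure (Rd d) :=
  (vecComponent ν i).toJordanDecomposition.negPart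

instance (ν : VectorMeasure (Rd d) (Rd d)) (i : Fin d) : IsFiniteMeasure (posComp ν i) := by
  unfold posComp; infer_instance

instance (ν : VectorMeasure (Rd d) (Rd d)) (i : Fin d) : IsFiniteMeasure (negComp ν i) := by
  unfold negComp; infer_instance

/-- The integral of a scalar function with respect to a vector measure, computed by components. -/
noncomputable def vecIntegral (ν : VectorMeasure (Rd d) (Rd d)) (f : Rd d → ℝ) : Rd d :=
  WithLp.toLp 2 fun i => ∫ y, f y ∂posComp ν i - ∫ y, f y ∂negComp ν i

lemma vecComponent_apply (ν : VectorMeasure (Rd d) (Rd d)) (i : Fin d) (B : Set (Rd d)) :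
    vecComponent ν i B = (ν B) i :=
  VectorMeasure.mapRange_apply _ _

lemma ext_vecComponent {ν ν' : VectorMeasure (Rd d) (Rd d)}
    (h : ∀ i, vecComponent ν i = vecComponent ν' i) : ν = ν' := by
  ext B hB i
  rw [← vecComponent_apply, ← vecComponent_apply, h i]

lemma vecComponent_add (ν ν' : VectorMeasure (Rd d) (Rd d)) (i : Fin d) :
    vecComponent (ν + ν') i = vecComponent ν i + vecComponent ν' i := by
  ext B hB
  simp [vecComponent_apply]

lemma posComp_add_negComp_le_variation (ν : VectorMeasure (Rd d) (Rd d)) (i : Fin d) :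
    posComp ν i + negComp ν i ≤ ν.variation := by
  have h : posComp ν i + negComp ν i = (vecComponent ν i).variation := by
    rw [← SignedMeasure.totalVariation_eq_variation]; rfl
  rw [h]
  refine VectorMeasure.variation_le_of_forall_enorm_le fun E hE => ?_
  rw [vecComponent_apply]
  refine le_trans ?_ (VectorMeasure.enorm_measure_le_variation ν E)
  exact enorm_le_iff_norm_le.2 (PiLp.norm_apply_le (ν E) i)

lemma posComp_le_variation (ν : VectorMeasure (Rd d) (Rd d)) (i : Fin d) :
    posComp ν i ≤ ν.variation :=
  (Measure.le_add_right le_rfl).trans (posComp_add_negComp_le_variation ν i)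

lemma negComp_le_variation (ν : VectorMeasure (Rd d) (Rd d)) (i : Fin d) :
    negComp ν i ≤ ν.variation :=
  (Measure.le_add_left le_rfl).trans (posComp_add_negComp_le_variation ν i)

lemma enorm_le_sum_enorm (v : Rd d) : ‖v‖ₑ ≤ ∑ i, ‖v i‖ₑ := by
  have h : v = ∑ i, EuclideanSpace.single i (v i) := by
    ext j; simp [Finset.sum_apply, Pi.single_apply]
  calc ‖v‖ₑ = ‖∑ i, EuclideanSpace.single i (v i)‖ₑ := by rw [← h]
    _ ≤ ∑ i, ‖EuclideanSpace.single i (v i)‖ₑ := enorm_sum_le _ _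
    _ = ∑ i, ‖v i‖ₑ := by
      refine Finset.sum_congr rfl fun i _ => ?_
      simp [enorm_eq_nnnorm]

/-- Comparison with the Jordan parts of the coordinates, which are finite measures, makes the total
variation of every `ℝ^d`-valued measure finite. -/
lemma variation_le_sum (ν : VectorMeasure (Rd d) (Rd d)) :
    ν.variation ≤ ∑ i, (posComp ν i + negComp ν i) := by
  refine VectorMeasure.variation_le_of_forall_enorm_le fun E hE => ?_
  refine (enorm_le_sum_enorm _).trans ?_
  rw [Measure.finsetSum_apply]
  refine Finset.sum_le_sum fun i _ => ?_
  rw [← vecComponent_apply]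
  exact SignedMeasure.enorm_le_totalVariation _ _

instance isFiniteMeasure_variation (ν : VectorMeasure (Rd d) (Rd d)) :
    IsFiniteMeasure ν.variation :=
  isFiniteMeasure_of_le _ (variation_le_sum ν)

lemma vecComponent_withDensityᵥ {τ : Measure (Rd d)} {u : Rd d → Rd d} (hu : Integrable u τ)
    (i : Fin d) : vecComponent (τ.withDensityᵥ u) i = τ.withDensityᵥ fun x => u x i := by
  have hi : Integrable (fun x => u x i) τ :=
    (EuclideanSpace.proj i : Rd d →L[ℝ] ℝ).integrable_comp hu
  ext B hB
  rw [vecComponent_apply, withDensityᵥ_apply hu hB, withDensityᵥ_apply hi hB]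
  exact ((EuclideanSpace.proj i : Rd d →L[ℝ] ℝ).integral_comp_comm hu.integrableOn).symm

lemma integrable_toLp {τ : Measure (Rd d)} {f : Fin d → Rd d → ℝ} (hf : ∀ i, Integrable (f i) τ) :
    Integrable (fun x => (WithLp.toLp 2 fun i => f i x : Rd d)) τ := by
  have h : (fun x => (WithLp.toLp 2 fun i => f i x : Rd d)) =
      fun x => ∑ i, f i x • (EuclideanSpace.single i 1 : Rd d) := by
    ext x j
    simp [Finset.sum_apply, Pi.single_apply]
  rw [h]
  exact integrable_finsetSum _ fun i _ => (hf i).smul_const _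

lemma integrable_vecRnDeriv (ν : VectorMeasure (Rd d) (Rd d)) (τ : Measure (Rd d)) :
    Integrable (vecRnDeriv ν τ) τ :=
  integrable_toLp fun _ => SignedMeasure.integrable_rnDeriv _ _

lemma measurable_vecRnDeriv (ν : VectorMeasure (Rd d) (Rd d)) (τ : Measure (Rd d)) :
    Measurable (vecRnDeriv ν τ) := by
  refine (WithLp.measurable_toLp 2 _).comp (measurable_pi_lambda _ fun i => ?_)
  exact SignedMeasure.measurable_rnDeriv _ _

lemma withDensityᵥ_vecRnDeriv {ν : VectorMeasure (Rd d) (Rd d)} {τ : Measure (Rd d)}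
    [SigmaFinite τ] (h : ∀ B, MeasurableSet B → τ B = 0 → ν B = 0) :
    τ.withDensityᵥ (vecRnDeriv ν τ) = ν := by
  refine ext_vecComponent fun i => ?_
  rw [vecComponent_withDensityᵥ (integrable_vecRnDeriv ν τ)]
  refine SignedMeasure.withDensityᵥ_rnDeriv_eq _ _ (VectorMeasure.AbsolutelyContinuous.mk ?_)
  intro B hB h0
  rw [Measure.toENNRealVectorMeasure_apply_measurable hB] at h0
  rw [vecComponent_apply, h B hB h0]; rfl

/-- Integrals against the Jordan decomposition of a signed measure with a density. -/
lemma integral_posPart_sub_negPart {τ : Measure (Rd d)} {h f : Rd d → ℝ} (hh : Integrable h τ)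
    (hf : Measurable f) {C : ℝ} (hC : ∀ x, |f x| ≤ C) :
    ∫ x, f x ∂(SignedMeasure.toJordanDecomposition (τ.withDensityᵥ h)).posPart
      - ∫ x, f x ∂(SignedMeasure.toJordanDecomposition (τ.withDensityᵥ h)).negPart = ∫ x, f x * h x ∂τ := by
  -- For a measurable representative the Jordan decomposition is explicit: its parts have densities
  -- `h'⁺` and `h'⁻`.
  set h' := hh.1.mk h with hh'
  have hm : Measurable h' := hh.1.measurable_mk
  have hae : h =ᵐ[τ] h' := hh.1.ae_eq_mk
  have hi : Integrable h' τ := hh.congr hae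
  rw [WithDensityᵥEq.congr_ae hae]
  have e := SignedMeasure.toJordanDecomposition_eq_of_eq_add_withDensity
    (s := τ.withDensityᵥ h') (t := 0) hm hi (VectorMeasure.MutuallySingular.zero_left)
    (by rw [zero_add])
  rw [e]
  simp only [SignedMeasure.toJordanDecomposition_zero, JordanDecomposition.zero_posPart,
    JordanDecomposition.zero_negPart, zero_add]
  rw [integral_withDensity_eq_integral_toReal_smul₀ hm.ennreal_ofReal.aemeasurable
      (Eventually.of_forall fun _ => ENNReal.ofReal_lt_top),
    integral_withDensity_eq_integral_toReal_smul₀ (f := fun x => ENNReal.ofReal (-h' x))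
      hm.neg.ennreal_ofReal.aemeasurable (Eventually.of_forall fun _ => ENNReal.ofReal_lt_top), ← integral_sub]
  · refine integral_congr_ae ?_
    filter_upwards [hae] with x hx
    rw [hx]
    simp only [ENNReal.toReal_ofReal', smul_eq_mul]
    rw [← sub_mul, mul_comm, max_zero_sub_eq_self]
  all_goals
    simp only [ENNReal.toReal_ofReal', smul_eq_mul]
    have h1 : Integrable (fun x => max (h' x) 0) τ := hi.pos_part
    have h2 : Integrable (fun x => max (-h' x) 0) τ := hi.neg_part
    first
    | exact h1.mul_bdd (c := C) hf.aestronglyMeasurable (Eventually.of_forall hC)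
    | exact h2.mul_bdd (c := C) hf.aestronglyMeasurable (Eventually.of_forall hC)

lemma vecIntegral_withDensityᵥ {τ : Measure (Rd d)} {u : Rd d → Rd d} (hu : Integrable u τ)
    {f : Rd d → ℝ} (hf : Measurable f) {C : ℝ} (hC : ∀ x, |f x| ≤ C) :
    vecIntegral (τ.withDensityᵥ u) f = ∫ x, f x • u x ∂τ := by
  ext i
  have hi : Integrable (fun x => u x i) τ :=
    (EuclideanSpace.proj i : Rd d →L[ℝ] ℝ).integrable_comp hu
  have hfu : Integrable (fun x => f x • u x) τ :=
    hu.bdd_smul C hf.aestronglyMeasurable (Eventually.of_forall hC)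
  have h1 : (∫ x, f x • u x ∂τ) i = ∫ x, (f x • u x) i ∂τ :=
    ((EuclideanSpace.proj i : Rd d →L[ℝ] ℝ).integral_comp_comm hfu).symm
  rw [h1]
  simp only [vecIntegral, posComp, negComp, vecComponent_withDensityᵥ hu]
  rw [integral_posPart_sub_negPart hi hf hC]
  rfl

/-- The pairing of a vector field with a vector measure having a density. -/
lemma integral_innerSL_withDensityᵥ {τ : Measure (Rd d)} {u : Rd d → Rd d} (hu : Integrable u τ)
    {f : Rd d → Rd d} (hf : Integrable f (τ.withDensityᵥ u).variation) :
    (τ.withDensityᵥ u).integral f (innerSL ℝ) = ∫ x, inner ℝ (f x) (u x) ∂τ := by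
  have hvar : (τ.withDensityᵥ u).variation = τ.withDensity fun x => ‖u x‖ₑ :=
    Measure.variation_withDensityᵥ hu
  have hint : ∀ g : Rd d → Rd d, Integrable g (τ.withDensityᵥ u).variation →
      Integrable (fun x => inner ℝ (g x) (u x)) τ ∧
      ∫⁻ x, ‖(inner ℝ (g x) (u x) : ℝ)‖ₑ ∂τ ≤ ∫⁻ x, ‖g x‖ₑ ∂(τ.withDensityᵥ u).variation := by
    intro g hg
    have hle : ∫⁻ x, ‖(inner ℝ (g x) (u x) : ℝ)‖ₑ ∂τ ≤
        ∫⁻ x, ‖g x‖ₑ ∂(τ.withDensityᵥ u).variation := by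
      rw [hvar, lintegral_withDensity_eq_lintegral_mul₀' hu.1.enorm]
      · refine lintegral_mono fun x => ?_
        simp only [Pi.mul_apply, enorm_eq_nnnorm]
        rw [mul_comm]
        exact_mod_cast nnnorm_inner_le_nnnorm (𝕜 := ℝ) (g x) (u x)
      · rw [← hvar]; exact hg.1.enorm
    refine ⟨⟨?_, lt_of_le_of_lt hle hg.2⟩, hle⟩
    obtain ⟨g', hg', hgg'⟩ : ∃ g', Measurable g' ∧ g =ᵐ[(τ.withDensityᵥ u).variation] g' :=
      ⟨hg.1.mk g, hg.1.measurable_mk, hg.1.ae_eq_mk⟩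
    have h1 : AEStronglyMeasurable (fun x => (inner ℝ (g' x) (u x) : ℝ)) τ :=
      hg'.aestronglyMeasurable.inner hu.1
    refine h1.congr ?_
    rw [hvar, EventuallyEq, ae_withDensity_iff' hu.1.enorm] at hgg'
    filter_upwards [hgg'] with x hx
    -- The variation is `|u| τ`, which does not see the points where `u` vanishes; there the inner
    -- product is zero anyway.
    by_cases h0 : u x = 0
    · simp [h0]
    · rw [hx (by simpa using h0)]
  -- Both sides are continuous and linear in `f` for the `L¹` norm of the variation, so indicators
  -- of sets times constants suffice.
  refine Integrable.induction (μ := (τ.withDensityᵥ u).variation)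
    (fun f => (τ.withDensityᵥ u).integral f (innerSL ℝ) = ∫ x, inner ℝ (f x) (u x) ∂τ)
    ?_ ?_ ?_ ?_ hf
  · intro c B hB _
    rw [VectorMeasure.integral_indicator_const _ hB, withDensityᵥ_apply hu hB]
    have h2 : ∀ x, (inner ℝ (B.indicator (fun _ => c) x) (u x) : ℝ) =
        B.indicator (fun x => inner ℝ c (u x)) x := by
      intro x
      by_cases hx : x ∈ B <;> simp [hx]
    simp_rw [h2]
    rw [integral_indicator hB]
    exact (integral_inner hu.integrableOn c).symm
  · intro f g _ hf hg h1 h2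
    rw [VectorMeasure.integral_add hf hg, h1, h2, ← integral_add (hint f hf).1 (hint g hg).1]
    simp [inner_add_left]
  · refine isClosed_eq VectorMeasure.continuous_integral ?_
    refine LipschitzWith.continuous (K := 1) fun f g => ?_
    rw [ENNReal.coe_one, one_mul, Lp.edist_def, eLpNorm_one_eq_lintegral_enorm,
      edist_eq_enorm_sub, ← integral_sub (hint f (L1.integrable_coeFn f)).1
        (hint g (L1.integrable_coeFn g)).1]
    refine (enorm_integral_le_lintegral_enorm _).trans ?_
    simp_rw [← inner_sub_left]
    exact (hint _ ((L1.integrable_coeFn f).sub (L1.integrable_coeFn g))).2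
  · intro f g hfg _ h
    rw [← VectorMeasure.integral_congr_ae hfg, h]
    refine integral_congr_ae ?_
    rw [hvar, EventuallyEq, ae_withDensity_iff' hu.1.enorm] at hfg
    filter_upwards [hfg] with x hx
    by_cases h0 : u x = 0
    · simp [h0]
    · rw [hx (by simpa using h0)]

lemma withDensityᵥ_vecRnDeriv_variation (ν : VectorMeasure (Rd d) (Rd d)) :
    ν.variation.withDensityᵥ (vecRnDeriv ν ν.variation) = ν :=
  withDensityᵥ_vecRnDeriv fun B _ h0 => by
    have := VectorMeasure.enorm_measure_le_variation ν B
    rw [h0] at this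
    simpa using this

/-- The pairing of a bounded vector field with a vector measure, by components. -/
lemma integral_innerSL_eq_sum (ν : VectorMeasure (Rd d) (Rd d)) {f : Rd d → Rd d}
    (hf : Measurable f) {C : ℝ} (hC : ∀ x, ‖f x‖ ≤ C) :
    ν.integral f (innerSL ℝ) =
      ∑ i, (∫ x, f x i ∂posComp ν i - ∫ x, f x i ∂negComp ν i) := by
  -- A vector measure always has a density with respect to its own variation, which reduces the
  -- claim to the case of measures with density.
  set τ := ν.variation
  set u := vecRnDeriv ν τ
  have hu : Integrable u τ := integrable_vecRnDeriv ν τ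
  have hν : τ.withDensityᵥ u = ν := withDensityᵥ_vecRnDeriv_variation ν
  have hfi : Integrable f (τ.withDensityᵥ u).variation :=
    Integrable.of_bound hf.aestronglyMeasurable C (Eventually.of_forall hC)
  have h1 := integral_innerSL_withDensityᵥ hu hfi
  rw [hν] at h1
  have hfm : ∀ i, Measurable fun x => f x i := fun i =>
    ((EuclideanSpace.proj i : Rd d →L[ℝ] ℝ).measurable).comp hf
  have hfC : ∀ i x, |f x i| ≤ C := fun i x => (PiLp.norm_apply_le (f x) i).trans (hC x)
  have hui : ∀ i, Integrable (fun x => u x i) τ := fun i =>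
    (EuclideanSpace.proj i : Rd d →L[ℝ] ℝ).integrable_comp hu
  rw [h1]
  have h2 : ∀ x, (inner ℝ (f x) (u x) : ℝ) = ∑ i, f x i * u x i := by
    intro x
    rw [PiLp.inner_apply]
    refine Finset.sum_congr rfl fun i _ => ?_
    simp [mul_comm]
  simp_rw [h2]
  rw [integral_finsetSum]
  · refine Finset.sum_congr rfl fun i _ => ?_
    rw [← integral_posPart_sub_negPart (hui i) (hfm i) (hfC i), ← vecComponent_withDensityᵥ hu, hν]
    rfl
  · intro i _
    exact (hui i).bdd_mul (c := C) (hfm i).aestronglyMeasurable (Eventually.of_forall (hfC i))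

end VectorMeasures

/-! ### The action density -/

section ActionDensity

variable {d : ℕ} {M : ENNReal} {m : ℝ → ℝ}

/-- The mobility, extended by zero outside of `[0,M]`. -/
noncomputable def clippedMobility (M : ENNReal) (m : ℝ → ℝ) : ℝ → ℝ :=
  (mobilityDomain M).indicator (mobilityExt M m)

lemma clippedMobility_of_mem {r : ℝ} (hr : r ∈ mobilityDomain M) :
    clippedMobility M m r = mobilityExt M m r := indicator_of_mem hr _

lemma IsMobility.measurable_clippedMobility (hm : IsMobility M m) :
    Measurable (clippedMobility M m) := by
  have h := hm.continuousOn_mobilityExt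
  refine measurable_of_restrict_of_restrict_compl (isClosed_mobilityDomain M).measurableSet ?_ ?_
  · have : (mobilityDomain M).domRestrict (clippedMobility M m) =
        (mobilityDomain M).domRestrict (mobilityExt M m) := by
      ext r; exact indicator_of_mem r.2 _
    rw [this]
    exact (continuousOn_iff_continuous_domRestrict.1 h).measurable
  · have : (mobilityDomain M)ᶜ.domRestrict (clippedMobility M m) = fun _ => 0 := by
      ext r; exact indicator_of_notMem r.2 _
    rw [this]
    exact measurable_const

lemma IsMobility.clippedMobility_nonneg (hm : IsMobility M m) (r : ℝ) :
    0 ≤ clippedMobility M m r :=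
  indicator_nonneg (fun _ hr => hm.mobilityExt_nonneg hr) _

lemma actionDensity_of_mem {ρ : ℝ} (hρ : ρ ∈ mobilityDomain M) (w : Rd d) :
    actionDensity M m ρ w = ‖w‖ₑ ^ 2 / ENNReal.ofReal (clippedMobility M m ρ) := by
  rw [clippedMobility_of_mem hρ, actionDensity]
  exact if_pos hρ

lemma actionDensity_of_notMem {ρ : ℝ} (hρ : ρ ∉ mobilityDomain M) (w : Rd d) :
    actionDensity M m ρ w = ⊤ := by
  rw [actionDensity]
  exact if_neg hρ

lemma actionDensity_zero_right {ρ : ℝ} (hρ : ρ ∈ mobilityDomain M) :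
    actionDensity M m ρ (0 : Rd d) = 0 := by
  simp [actionDensity_of_mem hρ]

lemma actionDensity_smul {ρ : ℝ} (hρ : ρ ∈ mobilityDomain M) {c : ℝ} (hc : 0 ≤ c) (w : Rd d) :
    actionDensity M m ρ (c • w) = ENNReal.ofReal (c ^ 2) * actionDensity M m ρ w := by
  rw [actionDensity_of_mem hρ, actionDensity_of_mem hρ, enorm_smul, mul_pow,
    Real.enorm_of_nonneg hc, ENNReal.ofReal_pow hc, mul_div_assoc]

lemma IsMobility.measurable_actionDensity (hm : IsMobility M m) :
    Measurable fun p : ℝ × Rd d => actionDensity M m p.1 p.2 := by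
  classical
  have h : (fun p : ℝ × Rd d => actionDensity M m p.1 p.2) =
      ({p : ℝ × Rd d | p.1 ∈ mobilityDomain M}).piecewise
        (fun p => ‖p.2‖ₑ ^ 2 / ENNReal.ofReal (clippedMobility M m p.1)) (fun _ => ⊤) := by
    ext p
    by_cases hp : p.1 ∈ mobilityDomain M
    · rw [piecewise_eq_of_mem _ _ _ (by exact hp), actionDensity_of_mem hp]
    · rw [piecewise_eq_of_notMem _ _ _ (by exact hp), actionDensity_of_notMem hp]
  rw [h]
  refine Measurable.piecewise (measurable_fst (isClosed_mobilityDomain M).measurableSet) ?_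
    measurable_const
  exact (measurable_snd.enorm.pow_const 2).div
    (hm.measurable_clippedMobility.comp measurable_fst).ennreal_ofReal

/-- If `w₀ ≠ 0`, the numerator has a positive limit and the quotient is continuous in `[0,∞]`, even
where the mobility vanishes. If `w₀ = 0`, the left side is zero. The indeterminate quotient `0 / 0`
thus never enters a limit. -/
lemma IsMobility.actionDensity_le_liminf (hm : IsMobility M m) {ρ : ℕ → ℝ} {w : ℕ → Rd d}
    {ρ₀ : ℝ} {w₀ : Rd d} (hρ : Tendsto ρ atTop (𝓝 ρ₀)) (hw : Tendsto w atTop (𝓝 w₀))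
    (hS : ∀ n, ρ n ∈ mobilityDomain M) :
    actionDensity M m ρ₀ w₀ ≤ liminf (fun n => actionDensity M m (ρ n) (w n)) atTop := by
  have h0 : ρ₀ ∈ mobilityDomain M :=
    (isClosed_mobilityDomain M).mem_of_tendsto hρ (Eventually.of_forall hS)
  by_cases hw0 : w₀ = 0
  · rw [hw0, actionDensity_zero_right h0]; exact zero_le
  · refine (Tendsto.liminf_eq ?_).ge
    have hmob : Tendsto (fun n => mobilityExt M m (ρ n)) atTop (𝓝 (mobilityExt M m ρ₀)) :=
      (hm.continuousOn_mobilityExt ρ₀ h0).tendsto.comp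
        (tendsto_nhdsWithin_iff.2 ⟨hρ, Eventually.of_forall hS⟩)
    have e : ∀ n, actionDensity M m (ρ n) (w n) =
        ‖w n‖ₑ ^ 2 / ENNReal.ofReal (mobilityExt M m (ρ n)) := fun n => by
      rw [actionDensity_of_mem (hS n), clippedMobility_of_mem (hS n)]
    simp_rw [e]
    rw [actionDensity_of_mem h0, clippedMobility_of_mem h0]
    refine ENNReal.Tendsto.div ?_ (Or.inl ?_) (ENNReal.tendsto_ofReal hmob) (Or.inl ?_)
    · exact ((ENNReal.continuous_pow 2).tendsto _).comp hw.enorm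
    · simpa using hw0
    · simp

/-- Weighted Cauchy–Schwarz inequality. -/
lemma sq_lintegral_le {α : Type*} [MeasurableSpace α] {τ : Measure α} {f g : α → ENNReal}
    (hf : AEMeasurable f τ) (hg : AEMeasurable g τ) (hgt : ∀ x, g x ≠ ⊤)
    (h : ∫⁻ x, f x ^ 2 / g x ∂τ ≠ ⊤) :
    (∫⁻ x, f x ∂τ) ^ 2 ≤ (∫⁻ x, f x ^ 2 / g x ∂τ) * ∫⁻ x, g x ∂τ := by
  have hq : AEMeasurable (fun x => f x ^ 2 / g x) τ := (hf.pow_const 2).div hg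
  have h1 : ∫⁻ x, f x ∂τ ≤ ∫⁻ x, (f x ^ 2 / g x) ^ (1 / 2 : ℝ) * g x ^ (1 / 2 : ℝ) ∂τ := by
    refine lintegral_mono_ae ?_
    filter_upwards [ae_lt_top' hq h] with x hx
    rw [← ENNReal.mul_rpow_of_nonneg _ _ (by norm_num)]
    -- Finiteness of the quotient integral excludes `g = 0` with `f ≠ 0` at almost every point, so
    -- `f` is bounded by `(f² / g)^{1/2} g^{1/2}` and Hölder applies.
    have h2 : f x ^ 2 ≤ f x ^ 2 / g x * g x := by
      by_cases h0 : g x = 0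
      · rw [h0] at hx
        by_cases h3 : f x ^ 2 = 0
        · rw [h3]; exact zero_le
        · rw [ENNReal.div_zero h3] at hx
          exact absurd hx (lt_irrefl _)
      · rw [ENNReal.div_mul_cancel h0 (hgt x)]
    calc f x = (f x ^ 2) ^ (1 / 2 : ℝ) := by
          rw [← ENNReal.rpow_natCast, ← ENNReal.rpow_mul]; norm_num
      _ ≤ _ := ENNReal.rpow_le_rpow h2 (by norm_num)
  have h2 := ENNReal.lintegral_mul_le_Lp_mul_Lq τ Real.HolderConjugate.two_two
    (hq.pow_const (1 / 2 : ℝ)) (hg.pow_const (1 / 2 : ℝ))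
  have e : ∀ a : ENNReal, (a ^ (1 / 2 : ℝ)) ^ (2 : ℝ) = a := fun a => by
    rw [← ENNReal.rpow_mul]; norm_num
  simp only [Pi.mul_apply, e] at h2
  calc (∫⁻ x, f x ∂τ) ^ 2
      ≤ ((∫⁻ x, f x ^ 2 / g x ∂τ) ^ (1 / 2 : ℝ) * (∫⁻ x, g x ∂τ) ^ (1 / 2 : ℝ)) ^ 2 := by
        gcongr
        exact h1.trans h2
    _ = _ := by
        rw [mul_pow, ← ENNReal.rpow_natCast, ← ENNReal.rpow_natCast]
        simp only [Nat.cast_ofNat, e]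

/-- An affine bound for the mobility. -/
lemma IsMobility.exists_clippedMobility_le (hm : IsMobility M m) {κ : ℝ} (hκ : 0 < κ) :
    ∃ C, 0 ≤ C ∧ ∀ r, 0 ≤ r → clippedMobility M m r ≤ (recessionSlope M m + κ) * r + C := by
  obtain ⟨C, h0, hC⟩ := hm.exists_le_add hκ
  refine ⟨C, h0, fun r hr => ?_⟩
  by_cases h : r ∈ mobilityDomain M
  · rw [clippedMobility_of_mem h]; exact hC r h
  · rw [clippedMobility, indicator_of_notMem h]
    have := hm.recessionSlope_nonneg
    positivity

lemma IsMobility.integrable_clippedMobility (hm : IsMobility M m) {α : Type*} [MeasurableSpace α]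
    {τ : Measure α} [IsFiniteMeasure τ] {R : α → ℝ} (hR : Integrable R τ) (h0 : ∀ᵐ x ∂τ, 0 ≤ R x) :
    Integrable (fun x => clippedMobility M m (R x)) τ := by
  obtain ⟨C, _, hC⟩ := hm.exists_clippedMobility_le one_pos
  refine Integrable.mono' ((hR.const_mul (recessionSlope M m + 1)).add (integrable_const C))
    (hm.measurable_clippedMobility.comp_aemeasurable hR.1.aemeasurable).aestronglyMeasurable ?_
  filter_upwards [h0] with x hx
  rw [Real.norm_of_nonneg (hm.clippedMobility_nonneg _)]
  exact hC _ hx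

lemma IsMobility.integral_clippedMobility_le (hm : IsMobility M m) {α : Type*} [MeasurableSpace α]
    {τ : Measure α} [IsProbabilityMeasure τ] {R : α → ℝ} (hR : Integrable R τ)
    (hS : ∀ᵐ x ∂τ, R x ∈ mobilityDomain M) :
    ∫ x, R x ∂τ ∈ mobilityDomain M ∧
    ∫ x, clippedMobility M m (R x) ∂τ ≤ clippedMobility M m (∫ x, R x ∂τ) := by
  have hmem : ∫ x, R x ∂τ ∈ mobilityDomain M :=
    (convex_mobilityDomain M).integral_mem (isClosed_mobilityDomain M) hS hR
  refine ⟨hmem, ?_⟩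
  have hint := hm.integrable_clippedMobility hR (hS.mono fun x hx => hx.1)
  have hae : (fun x => clippedMobility M m (R x)) =ᵐ[τ] fun x => mobilityExt M m (R x) :=
    hS.mono fun x hx => clippedMobility_of_mem hx
  rw [clippedMobility_of_mem hmem, integral_congr_ae hae]
  exact hm.concaveOn_mobilityExt.le_map_integral hm.continuousOn_mobilityExt
    (isClosed_mobilityDomain M) hS hR (hint.congr hae)

/-- Jensen's inequality for the action density. -/
lemma IsMobility.actionDensity_integral_le (hm : IsMobility M m) {α : Type*} [MeasurableSpace α]
    {τ : Measure α} [IsProbabilityMeasure τ] {R : α → ℝ} {W : α → Rd d} (hR : Integrable R τ)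
    (hW : Integrable W τ) (hS : ∀ᵐ x ∂τ, R x ∈ mobilityDomain M) :
    actionDensity M m (∫ x, R x ∂τ) (∫ x, W x ∂τ) ≤ ∫⁻ x, actionDensity M m (R x) (W x) ∂τ := by
  obtain ⟨hmem, hle⟩ := hm.integral_clippedMobility_le hR hS
  have e : ∫⁻ x, actionDensity M m (R x) (W x) ∂τ =
      ∫⁻ x, ‖W x‖ₑ ^ 2 / ENNReal.ofReal (clippedMobility M m (R x)) ∂τ :=
    lintegral_congr_ae (hS.mono fun x hx => actionDensity_of_mem hx _)
  rw [e, actionDensity_of_mem hmem]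
  by_cases htop : ∫⁻ x, ‖W x‖ₑ ^ 2 / ENNReal.ofReal (clippedMobility M m (R x)) ∂τ = ⊤
  · rw [htop]; exact le_top
  have hint := hm.integrable_clippedMobility hR (hS.mono fun x hx => hx.1)
  have hg : ∫⁻ x, ENNReal.ofReal (clippedMobility M m (R x)) ∂τ ≤
      ENNReal.ofReal (clippedMobility M m (∫ x, R x ∂τ)) := by
    rw [← ofReal_integral_eq_lintegral_ofReal hint
      (Eventually.of_forall fun x => hm.clippedMobility_nonneg _)]
    exact ENNReal.ofReal_le_ofReal hle
  -- The joint convexity of `|w|² / m(ρ)` enters as Cauchy–Schwarz with weight `m(R)` followed by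
  -- Jensen for the concave mobility.
  refine ENNReal.div_le_of_le_mul ?_
  calc ‖∫ x, W x ∂τ‖ₑ ^ 2 ≤ (∫⁻ x, ‖W x‖ₑ ∂τ) ^ 2 := by
        gcongr; exact enorm_integral_le_lintegral_enorm _
    _ ≤ _ := sq_lintegral_le hW.1.enorm hint.1.aemeasurable.ennreal_ofReal
        (fun _ => ENNReal.ofReal_ne_top) htop
    _ ≤ _ := by gcongr

end ActionDensity

/-! ### The action as the energy of a density -/

section ActionReference

variable {d : ℕ} {M : ENNReal} {m : ℝ → ℝ}

/-- The image of `μ` under the mobility: `m(ρ) ℒ^d + m'(∞) μ^⊥`. -/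
noncomputable def mobilityMeasure (M : ENNReal) (m : ℝ → ℝ) (μ : Measure (Rd d)) :
    Measure (Rd d) :=
  volume.withDensity
      (fun x => ENNReal.ofReal (clippedMobility M m (μ.rnDeriv volume x).toReal)) +
    ENNReal.ofReal (recessionSlope M m) • μ.singularPart volume

/-- The bound on the density that a finite threshold imposes. -/
def IsAdmissible (M : ENNReal) (μ : Measure (Rd d)) : Prop := M < ⊤ → μ ≤ M • volume

lemma IsAdmissible.singularPart_eq_zero {μ : Measure (Rd d)}
    (h : IsAdmissible M μ) (hM : M < ⊤) : μ.singularPart volume = 0 :=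
  Measure.singularPart_eq_zero_of_ac ((h hM).absolutelyContinuous.trans
    (Measure.smul_absolutelyContinuous))

lemma IsAdmissible.ae_mem {μ : Measure (Rd d)} [IsFiniteMeasure μ] (h : IsAdmissible M μ) :
    ∀ᵐ x, (μ.rnDeriv volume x).toReal ∈ mobilityDomain M := by
  rcases eq_top_or_lt_top M with rfl | hM
  · exact Eventually.of_forall fun x => ⟨ENNReal.toReal_nonneg, le_top⟩
  · have h1 : ∀ᵐ x, μ.rnDeriv volume x ≤ M := by
      refine ae_le_of_forall_setLIntegral_le_of_sigmaFinite (Measure.measurable_rnDeriv _ _)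
        fun s hs _ => ?_
      calc ∫⁻ x in s, μ.rnDeriv volume x ≤ μ s := Measure.setLIntegral_rnDeriv_le s
        _ ≤ M * volume s := h hM s
        _ = ∫⁻ x in s, M := by simp
    filter_upwards [h1] with x hx
    refine ⟨ENNReal.toReal_nonneg, ?_⟩
    rw [ENNReal.ofReal_toReal (ne_top_of_le_ne_top hM.ne hx)]
    exact hx

lemma IsMobility.measurable_clippedMobility_rnDeriv (hm : IsMobility M m) (μ : Measure (Rd d)) :
    Measurable fun x => clippedMobility M m (μ.rnDeriv volume x).toReal :=
  hm.measurable_clippedMobility.comp (Measure.measurable_rnDeriv _ _).ennreal_toReal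

lemma isFiniteMeasure_smul_singularPart (μ : Measure (Rd d)) [IsFiniteMeasure μ] :
    IsFiniteMeasure (ENNReal.ofReal (recessionSlope M m) • μ.singularPart volume) :=
  Measure.smul_finite _ ENNReal.ofReal_ne_top

lemma IsMobility.isLocallyFiniteMeasure_mobilityMeasure (hm : IsMobility M m) (μ : Measure (Rd d))
    [IsFiniteMeasure μ] : IsLocallyFiniteMeasure (mobilityMeasure M m μ) := by
  refine ⟨fun x => ⟨Metric.ball x 1, Metric.ball_mem_nhds x one_pos, ?_⟩⟩
  have := isFiniteMeasure_smul_singularPart (M := M) (m := m) μ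
  rw [mobilityMeasure, Measure.add_apply]
  refine ENNReal.add_lt_top.2 ⟨?_, measure_lt_top _ _⟩
  have : IsFiniteMeasure (volume.restrict (Metric.ball x 1)) :=
    ⟨by simpa using measure_ball_lt_top⟩
  have hi := hm.integrable_clippedMobility (τ := volume.restrict (Metric.ball x 1))
    (R := fun x => (μ.rnDeriv volume x).toReal)
    (Measure.integrable_toReal_rnDeriv.integrableOn)
    (Eventually.of_forall fun x => ENNReal.toReal_nonneg)
  rw [withDensity_apply _ measurableSet_ball]
  exact hi.lintegral_lt_top

lemma IsMobility.sigmaFinite_mobilityMeasure (hm : IsMobility M m) (μ : Measure (Rd d))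
    [IsFiniteMeasure μ] : SigmaFinite (mobilityMeasure M m μ) := by
  have := hm.isLocallyFiniteMeasure_mobilityMeasure μ
  infer_instance

lemma IsMobility.lintegral_mobilityMeasure (hm : IsMobility M m) (μ : Measure (Rd d))
    {f : Rd d → ENNReal} (hf : Measurable f) :
    ∫⁻ x, f x ∂mobilityMeasure M m μ =
      (∫⁻ x, ENNReal.ofReal (clippedMobility M m (μ.rnDeriv volume x).toReal) * f x)
      + ENNReal.ofReal (recessionSlope M m) * ∫⁻ x, f x ∂μ.singularPart volume := by
  rw [mobilityMeasure, lintegral_add_measure, lintegral_smul_measure,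
    lintegral_withDensity_eq_lintegral_mul _
      (hm.measurable_clippedMobility_rnDeriv μ).ennreal_ofReal hf]
  rfl

lemma IsMobility.setLIntegral_mobilityMeasure (hm : IsMobility M m) (μ : Measure (Rd d))
    {f : Rd d → ENNReal} (hf : Measurable f) {B : Set (Rd d)} (hB : MeasurableSet B) :
    ∫⁻ x in B, f x ∂mobilityMeasure M m μ =
      (∫⁻ x in B, ENNReal.ofReal (clippedMobility M m (μ.rnDeriv volume x).toReal) * f x)
      + ENNReal.ofReal (recessionSlope M m) * ∫⁻ x in B, f x ∂μ.singularPart volume := by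
  rw [mobilityMeasure, Measure.restrict_add, lintegral_add_measure, Measure.restrict_smul,
    lintegral_smul_measure, setLIntegral_withDensity_eq_setLIntegral_mul _
      (hm.measurable_clippedMobility_rnDeriv μ).ennreal_ofReal hf hB]
  rfl

lemma enorm_smul_sq_div {c : ℝ} (hc : 0 ≤ c) (v : Rd d) :
    ‖c • v‖ₑ ^ 2 / ENNReal.ofReal c = ENNReal.ofReal c * ‖v‖ₑ ^ 2 := by
  rcases hc.eq_or_lt with rfl | hc
  · simp
  · have h0 : ENNReal.ofReal c ≠ 0 := by simpa using hc
    rw [enorm_smul, Real.enorm_of_nonneg hc.le, mul_pow, pow_two (ENNReal.ofReal c), mul_assoc,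
      mul_div_assoc, ENNReal.mul_div_cancel h0 ENNReal.ofReal_ne_top]

/-- The two parts of a measure with density with respect to `mobilityMeasure`. -/
lemma IsMobility.integrable_mobilityMeasure_iff (hm : IsMobility M m) (μ : Measure (Rd d))
    {u : Rd d → Rd d} (hu : Measurable u) :
    Integrable u (mobilityMeasure M m μ) ↔
      Integrable (fun x => clippedMobility M m (μ.rnDeriv volume x).toReal • u x) ∧
      Integrable (fun x => recessionSlope M m • u x) (μ.singularPart volume) := by
  have hr := hm.recessionSlope_nonneg
  have e1 : AEStronglyMeasurable
      (fun x => clippedMobility M m (μ.rnDeriv volume x).toReal • u x) volume :=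
    ((hm.measurable_clippedMobility_rnDeriv μ).smul hu).aestronglyMeasurable
  have e2 : AEStronglyMeasurable (fun x => recessionSlope M m • u x) (μ.singularPart volume) :=
    (hu.const_smul (recessionSlope M m)).aestronglyMeasurable
  simp only [Integrable, hu.aestronglyMeasurable, true_and, e1, e2, HasFiniteIntegral]
  rw [hm.lintegral_mobilityMeasure μ hu.enorm, ENNReal.add_lt_top]
  simp_rw [enorm_smul, Real.enorm_of_nonneg (hm.clippedMobility_nonneg _),
    Real.enorm_of_nonneg hr]
  rw [lintegral_const_mul _ hu.enorm]

lemma IsMobility.withDensityᵥ_mobilityMeasure (hm : IsMobility M m) (μ : Measure (Rd d))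
    {u : Rd d → Rd d} (hu : Measurable u) (hi : Integrable u (mobilityMeasure M m μ)) :
    (mobilityMeasure M m μ).withDensityᵥ u =
      volume.withDensityᵥ (fun x => clippedMobility M m (μ.rnDeriv volume x).toReal • u x) +
      (μ.singularPart volume).withDensityᵥ (fun x => recessionSlope M m • u x) := by
  obtain ⟨h1, h2⟩ := (hm.integrable_mobilityMeasure_iff μ hu).1 hi
  have hr := hm.recessionSlope_nonneg
  ext1 B hB
  rw [withDensityᵥ_apply hi hB, _root_.add_apply, withDensityᵥ_apply h1 hB,
    withDensityᵥ_apply h2 hB]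
  have hiB := hi.restrict (s := B)
  rw [mobilityMeasure, Measure.restrict_add, integrable_add_measure] at hiB
  rw [mobilityMeasure, Measure.restrict_add, integral_add_measure hiB.1 hiB.2,
    Measure.restrict_smul, integral_smul_measure, ENNReal.toReal_ofReal hr, integral_smul,
    setIntegral_withDensity_eq_setIntegral_toReal_smul
      (hm.measurable_clippedMobility_rnDeriv μ).ennreal_ofReal
      (Eventually.of_forall fun _ => ENNReal.ofReal_lt_top) _ hB]
  congr 1
  refine integral_congr_ae (Eventually.of_forall fun x => ?_)
  simp only [ENNReal.toReal_ofReal (hm.clippedMobility_nonneg _)]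

lemma mutuallySingular_withDensityᵥ {σ : Measure (Rd d)} (h : σ ⟂ₘ (volume : Measure (Rd d)))
    (f : Rd d → ℝ) :
    (σ.withDensityᵥ f) ⟂ᵥ (volume : Measure (Rd d)).toENNRealVectorMeasure := by
  obtain ⟨N, hN, h1, h2⟩ := h
  refine VectorMeasure.MutuallySingular.mk N hN (fun t ht hmt => ?_) (fun t ht hmt => ?_)
  · by_cases hf : Integrable f σ
    · rw [withDensityᵥ_apply hf hmt, Measure.restrict_eq_zero.2 (measure_mono_null ht h1),
        integral_zero_measure]
    · simp [Measure.withDensityᵥ, hf]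
  · rw [Measure.toENNRealVectorMeasure_apply_measurable hmt]
    exact measure_mono_null ht h2

/-- Uniqueness of the Lebesgue decomposition of a vector measure. -/
lemma vecRnDeriv_ae_eq {ν : VectorMeasure (Rd d) (Rd d)} {σ : Measure (Rd d)}
    (hσ : σ ⟂ₘ (volume : Measure (Rd d))) {w w' : Rd d → Rd d} (hw : Integrable w)
    (hw' : Integrable w' σ) (h : ν = volume.withDensityᵥ w + σ.withDensityᵥ w') :
    vecRnDeriv ν volume =ᵐ[volume] w ∧ vecSingularPart ν = σ.withDensityᵥ w' := by
  have h1 : vecRnDeriv ν volume =ᵐ[volume] w := by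
    have : ∀ i, (fun x => w x i) =ᵐ[volume] (vecComponent ν i).rnDeriv volume := by
      intro i
      refine SignedMeasure.eq_rnDeriv (t := vecComponent (σ.withDensityᵥ w') i) _
        ((EuclideanSpace.proj i : Rd d →L[ℝ] ℝ).integrable_comp hw) ?_ ?_
      · rw [vecComponent_withDensityᵥ hw']
        exact mutuallySingular_withDensityᵥ hσ _
      · rw [h, vecComponent_add, vecComponent_withDensityᵥ hw, add_comm]
    filter_upwards [ae_all_iff.2 this] with x hx
    ext i
    exact (hx i).symm
  refine ⟨h1, ?_⟩
  rw [vecSingularPart, WithDensityᵥEq.congr_ae h1, h, add_sub_cancel_left]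

/-- The action of a pair with a density with respect to `mobilityMeasure`. -/
lemma IsMobility.actionFunctional_eq (hm : IsMobility M m) {Ω : Set (Rd d)}
    (hfr : volume (frontier Ω) = 0) (hΩ : IsOpen Ω) {μ : Measure (Rd d)} [IsFiniteMeasure μ]
    {ν : VectorMeasure (Rd d) (Rd d)} (hμΩ : μ (closure Ω)ᶜ = 0)
    (hνΩ : ν.variation (closure Ω)ᶜ = 0) (hadm : IsAdmissible M μ) {u : Rd d → Rd d}
    (hu : Measurable u) (hi : Integrable u (mobilityMeasure M m μ))
    (hν : ν = (mobilityMeasure M m μ).withDensityᵥ u) :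
    actionFunctional M m Ω μ ν = ∫⁻ x, ‖u x‖ₑ ^ 2 ∂mobilityMeasure M m μ := by
  obtain ⟨h1, h2⟩ := (hm.integrable_mobilityMeasure_iff μ hu).1 hi
  have hσ : μ.singularPart volume ⟂ₘ (volume : Measure (Rd d)) :=
    Measure.mutuallySingular_singularPart _ _
  obtain ⟨hw, hs⟩ := vecRnDeriv_ae_eq hσ h1 h2
    (hν.trans (hm.withDensityᵥ_mobilityMeasure μ hu hi))
  have hsl := hm.recessionSlope_nonneg
  -- the energy is carried by the closure
  have hcl : ∫⁻ x, ‖u x‖ₑ ^ 2 ∂mobilityMeasure M m μ =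
      ∫⁻ x in closure Ω, ‖u x‖ₑ ^ 2 ∂mobilityMeasure M m μ := by
    rw [← lintegral_add_compl _ isClosed_closure.measurableSet (A := closure Ω)]
    have h0 : ∫⁻ x in (closure Ω)ᶜ, ‖u x‖ₑ ∂mobilityMeasure M m μ = 0 := by
      rw [hν, Measure.variation_withDensityᵥ hi,
        withDensity_apply _ isClosed_closure.measurableSet.compl] at hνΩ
      exact hνΩ
    have h00 : ∫⁻ x in (closure Ω)ᶜ, ‖u x‖ₑ ^ 2 ∂mobilityMeasure M m μ = 0 := by
      rw [lintegral_eq_zero_iff hu.enorm] at h0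
      rw [lintegral_eq_zero_iff (hu.enorm.pow_const 2)]
      filter_upwards [h0] with x hx
      simp only [Pi.zero_apply] at hx ⊢
      rw [hx]; simp
    rw [h00, add_zero]
  have hac : ∫⁻ x in Ω, actionDensity M m (μ.rnDeriv volume x).toReal (vecRnDeriv ν volume x) =
      ∫⁻ x in closure Ω,
        ENNReal.ofReal (clippedMobility M m (μ.rnDeriv volume x).toReal) * ‖u x‖ₑ ^ 2 := by
    -- The boundary is Lebesgue null, so the absolutely continuous part may be integrated over the
    -- closure, where the singular part lives.
    have hset : (Ω : Set (Rd d)) =ᵐ[volume] closure Ω := by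
      refine (subset_closure.eventuallyLE).antisymm ?_
      have : volume (closure Ω \ Ω) = 0 := by
        refine measure_mono_null ?_ hfr
        rw [frontier, hΩ.interior_eq]
      exact ae_le_set.2 this
    rw [setLIntegral_congr hset]
    refine lintegral_congr_ae (ae_restrict_of_ae ?_)
    filter_upwards [hw, hadm.ae_mem] with x hx hx2
    rw [actionDensity_of_mem hx2, hx, enorm_smul_sq_div (hm.clippedMobility_nonneg _)]
  rw [hcl, hm.setLIntegral_mobilityMeasure μ (hu.enorm.pow_const 2)
    isClosed_closure.measurableSet, ← hac]
  unfold actionFunctional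
  simp only
  rw [if_neg (not_not.2 ⟨hμΩ, hνΩ⟩)]
  -- In the first two regimes the second term of the energy and the singular momentum both vanish:
  -- either `μ^⊥ = 0` or the recession slope is zero. In the third, `ν^⊥` has density `m'(∞) u` with
  -- respect to `μ^⊥`, and squaring and dividing by `m'(∞)` gives `m'(∞) |u|²`.
  split_ifs with hM hz hs0 hz hz
  · simp [hz.1]
  · refine absurd ⟨hadm.singularPart_eq_zero hM, ?_⟩ hz
    rw [hs, hadm.singularPart_eq_zero hM]
    ext B
    simp [Measure.withDensityᵥ]
  · have : recessionSlope M m = 0 := by simp [recessionSlope, hM, hs0]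
    simp [this]
  · refine absurd ?_ hz
    have : recessionSlope M m = 0 := by simp [recessionSlope, hM, hs0]
    rw [hs]
    simp only [this, zero_smul]
    exact withDensityᵥ_zero
  · have hrs : recessionSlope M m = mobilitySlope m := by simp [recessionSlope, hM]
    have hder : vecRnDeriv (vecSingularPart ν) (μ.singularPart volume)
        =ᵐ[μ.singularPart volume] fun x => recessionSlope M m • u x := by
      refine Integrable.ae_eq_of_withDensityᵥ_eq (integrable_vecRnDeriv _ _) h2 ?_
      rw [← hs]
      refine withDensityᵥ_vecRnDeriv fun B hB h0 => hz ?_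
      rwa [Measure.toENNRealVectorMeasure_apply_measurable hB]
    congr 1
    rw [← lintegral_const_mul _ (hu.enorm.pow_const 2)]
    refine lintegral_congr_ae (ae_restrict_of_ae ?_)
    filter_upwards [hder] with x hx
    rw [hx, ← hrs, enorm_smul_sq_div hsl]
  · refine absurd ?_ hz
    refine VectorMeasure.AbsolutelyContinuous.mk fun B hB h0 => ?_
    rw [Measure.toENNRealVectorMeasure_apply_measurable hB] at h0
    rw [hs, withDensityᵥ_apply h2 hB, Measure.restrict_eq_zero.2 h0, integral_zero_measure]

/-- On a Lebesgue-conull set on which `σ` vanishes, `ν` reduces to its absolutely continuous part.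
This shows that `w` vanishes outside the closure of the domain, where the action imposes no
constraint. -/
lemma ae_eq_zero_of_withDensityᵥ {ν : VectorMeasure (Rd d) (Rd d)} {σ : Measure (Rd d)}
    (hσ : σ ⟂ₘ (volume : Measure (Rd d))) {w w' : Rd d → Rd d} (hw : Integrable w)
    (hw' : Integrable w' σ) (h : ν = volume.withDensityᵥ w + σ.withDensityᵥ w') {K : Set (Rd d)}
    (hK : MeasurableSet K) (hνK : ν.variation K = 0) : ∀ᵐ x, x ∈ K → w x = 0 := by
  obtain ⟨N, hN, h1, h2⟩ := hσ
  rw [← ae_restrict_iff' hK]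
  refine Integrable.ae_eq_zero_of_forall_setIntegral_eq_zero hw.restrict fun E hE _ => ?_
  rw [Measure.restrict_restrict hE]
  have hmE : MeasurableSet (E ∩ K ∩ N) := (hE.inter hK).inter hN
  have hset : (E ∩ K : Set (Rd d)) =ᵐ[volume] (E ∩ K ∩ N : Set (Rd d)) := by
    refine EventuallyLE.antisymm ?_ inter_subset_left.eventuallyLE
    refine ae_le_set.2 (measure_mono_null (fun x hx => ?_) h2)
    exact fun hxN => hx.2 ⟨hx.1, hxN⟩
  rw [setIntegral_congr_set hset]
  have h3 : ν (E ∩ K ∩ N) = 0 := by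
    have := VectorMeasure.enorm_measure_le_variation ν (E ∩ K ∩ N)
    rw [measure_mono_null (inter_subset_left.trans inter_subset_right) hνK] at this
    simpa using this
  rw [h, _root_.add_apply, withDensityᵥ_apply hw hmE, withDensityᵥ_apply hw' hmE,
    Measure.restrict_eq_zero.2 (measure_mono_null inter_subset_right h1),
    integral_zero_measure, add_zero] at h3
  exact h3

lemma isAdmissible_of_ae_mem {μ : Measure (Rd d)} [IsFiniteMeasure μ]
    (hs : M < ⊤ → μ.singularPart volume = 0)
    (h : ∀ᵐ x, (μ.rnDeriv volume x).toReal ∈ mobilityDomain M) : IsAdmissible M μ := by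
  intro hM
  have h0 := hs hM
  conv_lhs => rw [← Measure.singularPart_add_rnDeriv μ volume]
  rw [h0, zero_add, ← withDensity_const]
  refine withDensity_mono ?_
  filter_upwards [h, Measure.rnDeriv_lt_top μ volume] with x hx hx2
  rw [← ENNReal.ofReal_toReal hx2.ne]
  exact hx.2

/-- A pair of finite action has a square integrable density. -/
lemma IsMobility.exists_density (hm : IsMobility M m) {Ω : Set (Rd d)}
    (hfr : volume (frontier Ω) = 0) {μ : Measure (Rd d)} [IsFiniteMeasure μ]
    {ν : VectorMeasure (Rd d) (Rd d)} (hfin : actionFunctional M m Ω μ ν ≠ ⊤) :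
    μ (closure Ω)ᶜ = 0 ∧ ν.variation (closure Ω)ᶜ = 0 ∧ IsAdmissible M μ ∧
    ∃ u, Measurable u ∧ Integrable u (mobilityMeasure M m μ) ∧
      ν = (mobilityMeasure M m μ).withDensityᵥ u := by
  have hsl := hm.recessionSlope_nonneg
  -- The three regimes of the action are merged: the singular momentum is `w' μ^⊥`, with `w' = 0`
  -- whenever the recession slope vanishes.
  obtain ⟨hcl, hac, hsing, w', hmw', hw', hs0, hνs⟩ : (μ (closure Ω)ᶜ = 0 ∧
      ν.variation (closure Ω)ᶜ = 0) ∧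
      (∫⁻ x in Ω, actionDensity M m (μ.rnDeriv volume x).toReal (vecRnDeriv ν volume x)) ≠ ⊤ ∧
      (M < ⊤ → μ.singularPart volume = 0) ∧
      ∃ w' : Rd d → Rd d, Measurable w' ∧ Integrable w' (μ.singularPart volume) ∧
        (recessionSlope M m = 0 → w' = 0) ∧
        vecSingularPart ν = (μ.singularPart volume).withDensityᵥ w' := by
    unfold actionFunctional at hfin
    simp only at hfin
    split_ifs at hfin with h1 hM hz hsl0 hz hz
    · exact ⟨h1, hfin, fun _ => hz.1, 0, measurable_zero, integrable_zero _ _ _,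
        fun _ => rfl, by rw [hz.2, withDensityᵥ_zero]⟩
    · exact absurd rfl hfin
    · exact ⟨h1, hfin, fun h => absurd h hM, 0, measurable_zero, integrable_zero _ _ _,
        fun _ => rfl, by rw [hz, withDensityᵥ_zero]⟩
    · exact absurd rfl hfin
    · refine ⟨h1, (ENNReal.add_ne_top.1 hfin).1, fun h => absurd h hM,
        vecRnDeriv (vecSingularPart ν) (μ.singularPart volume), measurable_vecRnDeriv _ _,
        integrable_vecRnDeriv _ _, fun h => absurd ?_ hsl0,
        (withDensityᵥ_vecRnDeriv fun B hB h0 => hz ?_).symm⟩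
      · simpa [recessionSlope, hM] using h
      · rwa [Measure.toENNRealVectorMeasure_apply_measurable hB]
    · exact absurd rfl hfin
    · exact absurd rfl hfin
  obtain ⟨hμΩ, hνΩ⟩ := hcl
  set w := vecRnDeriv ν volume with hwdef
  have hmw : Measurable w := measurable_vecRnDeriv _ _
  have hiw : Integrable w := integrable_vecRnDeriv _ _
  have hσ : μ.singularPart volume ⟂ₘ (volume : Measure (Rd d)) :=
    Measure.mutuallySingular_singularPart _ _
  have hdec : ν = volume.withDensityᵥ w + (μ.singularPart volume).withDensityᵥ w' := by
    rw [← hνs, vecSingularPart]; abel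
  have hw0 := ae_eq_zero_of_withDensityᵥ hσ hiw hw' hdec
    isClosed_closure.measurableSet.compl hνΩ
  have hactm : Measurable fun x => actionDensity M m (μ.rnDeriv volume x).toReal (w x) :=
    hm.measurable_actionDensity.comp
      ((Measure.measurable_rnDeriv _ _).ennreal_toReal.prodMk hmw)
  have hΩae : ∀ᵐ x, x ∈ Ω → actionDensity M m (μ.rnDeriv volume x).toReal (w x) < ⊤ :=
    ae_imp_of_ae_restrict (ae_lt_top hactm hac)
  have hfrae : ∀ᵐ x, x ∉ frontier Ω := measure_eq_zero_iff_ae_notMem.1 hfr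
  have hρ0 : ∀ᵐ x, x ∈ (closure Ω)ᶜ → μ.rnDeriv volume x = 0 := by
    rw [← ae_restrict_iff' isClosed_closure.measurableSet.compl]
    have : ∫⁻ x in (closure Ω)ᶜ, μ.rnDeriv volume x = 0 :=
      le_antisymm ((Measure.setLIntegral_rnDeriv_le _).trans hμΩ.le) zero_le
    exact (lintegral_eq_zero_iff (Measure.measurable_rnDeriv _ _)).1 this
  have hcase : ∀ᵐ x, x ∈ Ω ∨ x ∈ (closure Ω)ᶜ := by
    filter_upwards [hfrae] with x hx
    by_cases h : x ∈ closure Ω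
    · exact Or.inl (interior_subset (by_contra fun h2 => hx ⟨h, h2⟩))
    · exact Or.inr h
  have hmem : ∀ᵐ x, (μ.rnDeriv volume x).toReal ∈ mobilityDomain M := by
    filter_upwards [hΩae, hρ0, hcase] with x h1 h2 h3
    rcases h3 with h3 | h3
    · by_contra h
      have := h1 h3
      rw [actionDensity_of_notMem h] at this
      exact lt_irrefl _ this
    · rw [h2 h3]; simpa using zero_mem_mobilityDomain M
  have hadm := isAdmissible_of_ae_mem hsing hmem
  -- Finite action forbids momentum where the mobility vanishes, hence `w` can be recovered from its
  -- quotient by the mobility.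
  have hwm : ∀ᵐ x, clippedMobility M m (μ.rnDeriv volume x).toReal = 0 → w x = 0 := by
    filter_upwards [hΩae, hw0, hcase, hmem] with x h1 h2 h3 h4 h5
    rcases h3 with h3 | h3
    · have h6 := h1 h3
      rw [actionDensity_of_mem h4, h5, ENNReal.ofReal_zero] at h6
      by_contra h7
      rw [ENNReal.div_zero (by simpa using h7)] at h6
      exact lt_irrefl _ h6
    · exact h2 h3
  obtain ⟨N, hN, hN1, hN2⟩ := hσ
  classical
  -- `N` carries the Lebesgue measure and its complement carries `μ^⊥`, so the two quotients do not
  -- interfere. The convention `0⁻¹ = 0` is harmless because the numerators vanish where the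
  -- denominators do.
  set u : Rd d → Rd d := N.piecewise
    (fun x => (clippedMobility M m (μ.rnDeriv volume x).toReal)⁻¹ • w x)
    (fun x => (recessionSlope M m)⁻¹ • w' x) with hu
  have hum : Measurable u :=
    Measurable.piecewise hN ((hm.measurable_clippedMobility_rnDeriv μ).inv.smul hmw)
      (hmw'.const_smul (recessionSlope M m)⁻¹)
  have e1 : (fun x => clippedMobility M m (μ.rnDeriv volume x).toReal • u x) =ᵐ[volume] w := by
    filter_upwards [hwm, measure_eq_zero_iff_ae_notMem.1 hN2] with x h1 h2
    rw [hu, piecewise_eq_of_mem _ _ _ (not_not.1 h2)]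
    by_cases h0 : clippedMobility M m (μ.rnDeriv volume x).toReal = 0
    · simp [h0, h1 h0]
    · rw [smul_smul, mul_inv_cancel₀ h0, one_smul]
  have e2 : (fun x => recessionSlope M m • u x) =ᵐ[μ.singularPart volume] w' := by
    filter_upwards [measure_eq_zero_iff_ae_notMem.1 hN1] with x h2
    rw [hu, piecewise_eq_of_notMem _ _ _ h2]
    by_cases h0 : recessionSlope M m = 0
    · simp [hs0 h0]
    · rw [smul_smul, mul_inv_cancel₀ h0, one_smul]
  have hui : Integrable u (mobilityMeasure M m μ) :=
    (hm.integrable_mobilityMeasure_iff μ hum).2 ⟨hiw.congr e1.symm, hw'.congr e2.symm⟩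
  refine ⟨hμΩ, hνΩ, hadm, u, hum, hui, ?_⟩
  rw [hm.withDensityᵥ_mobilityMeasure μ hum hui, WithDensityᵥEq.congr_ae e1,
    WithDensityᵥEq.congr_ae e2]
  exact hdec

/-- The action of an absolutely continuous pair. -/
lemma actionFunctional_withDensity {Ω : Set (Rd d)} (hΩ : MeasurableSet Ω) {ρ : Rd d → ℝ}
    (hρ : Measurable ρ) (hρ0 : ∀ x, 0 ≤ ρ x) {w : Rd d → Rd d}
    (hw : IntegrableOn w Ω) :
    actionFunctional M m Ω ((volume.restrict Ω).withDensity fun x => ENNReal.ofReal (ρ x))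
      ((volume.restrict Ω).withDensityᵥ w) = ∫⁻ x in Ω, actionDensity M m (ρ x) (w x) := by
  have hcl : (volume.restrict Ω) (closure Ω)ᶜ = 0 := by
    rw [Measure.restrict_apply isClosed_closure.measurableSet.compl]
    convert measure_empty (μ := volume) using 2
    exact (disjoint_compl_left_iff_subset.2 subset_closure).inter_eq
  set μ := (volume.restrict Ω).withDensity fun x => ENNReal.ofReal (ρ x) with hμ
  set ν := (volume.restrict Ω).withDensityᵥ w with hν
  have hμe : μ = volume.withDensity (Ω.indicator fun x => ENNReal.ofReal (ρ x)) := by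
    rw [hμ, withDensity_indicator hΩ]
  have hνe : ν = volume.withDensityᵥ (Ω.indicator w) +
      (0 : Measure (Rd d)).withDensityᵥ (0 : Rd d → Rd d) := by
    rw [withDensityᵥ_zero, add_zero]
    ext1 B hB
    rw [hν, withDensityᵥ_apply hw hB, withDensityᵥ_apply ((integrable_indicator_iff hΩ).2 hw) hB,
      setIntegral_indicator hΩ, Measure.restrict_restrict hB]
  obtain ⟨h1, h2⟩ := vecRnDeriv_ae_eq Measure.MutuallySingular.zero_left
    ((integrable_indicator_iff hΩ).2 hw) (integrable_zero _ _ _) hνe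
  rw [withDensityᵥ_zero] at h2
  have h3 : μ.singularPart volume = 0 :=
    Measure.singularPart_eq_zero_of_ac ((withDensity_absolutelyContinuous _ _).trans
      (Measure.absolutelyContinuous_of_le Measure.restrict_le_self))
  have h4 : μ.rnDeriv volume =ᵐ[volume] Ω.indicator fun x => ENNReal.ofReal (ρ x) := by
    rw [hμe]
    exact Measure.rnDeriv_withDensity _ (hρ.ennreal_ofReal.indicator hΩ)
  have hac : ∫⁻ x in Ω, actionDensity M m (μ.rnDeriv volume x).toReal (vecRnDeriv ν volume x) =
      ∫⁻ x in Ω, actionDensity M m (ρ x) (w x) := by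
    refine setLIntegral_congr_fun_ae hΩ ?_
    filter_upwards [h1, h4] with x hx1 hx2 hx
    rw [hx1, hx2, indicator_of_mem hx, indicator_of_mem hx, ENNReal.toReal_ofReal (hρ0 x)]
  have hc1 : μ (closure Ω)ᶜ = 0 := withDensity_absolutelyContinuous _ _ hcl
  have hc2 : ν.variation (closure Ω)ᶜ = 0 := by
    rw [hν, Measure.variation_withDensityᵥ hw]
    exact withDensity_absolutelyContinuous _ _ hcl
  unfold actionFunctional
  simp only
  rw [if_neg (not_not.2 ⟨hc1, hc2⟩), h2, h3, hac]
  split_ifs with hM hz hs0 hz hz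
  · rfl
  · simp at hz
  · rfl
  · simp at hz
  · simp
  · refine absurd ?_ hz
    exact VectorMeasure.AbsolutelyContinuous.zero _

end ActionReference

/-! ### Mollification decreases the action -/

section Mollification

variable {d : ℕ} {M : ENNReal} {m : ℝ → ℝ}

/-- The density of the mollified measure. -/
noncomputable def mollDensity (k : Rd d → ℝ) (η : ℝ) (μ : Measure (Rd d)) (x : Rd d) : ℝ :=
  ∫ y, rescaledKernel k η (x - y) ∂μ

/-- The density of the mollified vector measure. -/
noncomputable def mollMomentum (k : Rd d → ℝ) (η : ℝ) (ν : VectorMeasure (Rd d) (Rd d))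
    (x : Rd d) : Rd d :=
  vecIntegral ν fun y => rescaledKernel k η (x - y)

variable {k : Rd d → ℝ} (hk : IsKernel k) {η : ℝ} (hη : 0 < η)
include hk hη

lemma IsKernel.integrable_rescaledKernel_sub (μ : Measure (Rd d)) [IsFiniteMeasure μ] (x : Rd d) :
    Integrable (fun y => rescaledKernel k η (x - y)) μ := by
  obtain ⟨C, h0, hC⟩ := hk.rescaledKernel_exists_le hη
  refine Integrable.of_bound ((hk.rescaledKernel_continuous η).comp
    (continuous_const.sub continuous_id)).aestronglyMeasurable C (Eventually.of_forall fun y => ?_)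
  rw [Real.norm_of_nonneg (hk.rescaledKernel_nonneg hη _)]
  exact hC _

lemma mollDensity_nonneg (μ : Measure (Rd d)) (x : Rd d) : 0 ≤ mollDensity k η μ x :=
  integral_nonneg fun _ => hk.rescaledKernel_nonneg hη _

lemma ofReal_mollDensity (μ : Measure (Rd d)) [IsFiniteMeasure μ] (x : Rd d) :
    ENNReal.ofReal (mollDensity k η μ x) = ∫⁻ y, ENNReal.ofReal (rescaledKernel k η (x - y)) ∂μ :=
  ofReal_integral_eq_lintegral_ofReal (hk.integrable_rescaledKernel_sub hη μ x)
    (Eventually.of_forall fun _ => hk.rescaledKernel_nonneg hη _)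

omit hη in
lemma IsKernel.measurable_rescaledKernel_sub (x : Rd d) :
    Measurable fun y => ENNReal.ofReal (rescaledKernel k η (x - y)) :=
  ((hk.rescaledKernel_continuous η).comp
    (continuous_const.sub continuous_id)).measurable.ennreal_ofReal

lemma lintegral_ofReal_mollDensity (μ : Measure (Rd d)) [IsFiniteMeasure μ] :
    ∫⁻ x, ENNReal.ofReal (mollDensity k η μ x) = μ univ := by
  simp_rw [ofReal_mollDensity hk hη μ]
  rw [lintegral_lintegral_swap]
  · simp [hk.lintegral_rescaledKernel_sub hη]
  · have := (hk.rescaledKernel_continuous η).measurable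
    exact (this.comp (measurable_fst.sub measurable_snd)).ennreal_ofReal.aemeasurable

lemma mollDensity_mem {μ : Measure (Rd d)} [IsFiniteMeasure μ] (h : IsAdmissible M μ)
    (x : Rd d) : mollDensity k η μ x ∈ mobilityDomain M := by
  refine ⟨mollDensity_nonneg hk hη μ x, ?_⟩
  rcases eq_top_or_lt_top M with rfl | hM
  · exact le_top
  · rw [ofReal_mollDensity hk hη]
    calc ∫⁻ y, ENNReal.ofReal (rescaledKernel k η (x - y)) ∂μ
        ≤ ∫⁻ y, ENNReal.ofReal (rescaledKernel k η (x - y)) ∂(M • volume) :=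
          lintegral_mono' (h hM) le_rfl
      _ = M := by
        rw [lintegral_smul_measure, hk.lintegral_rescaledKernel_sub_left hη, smul_eq_mul, mul_one]

lemma isProbabilityMeasure_withDensity_rescaledKernel (x : Rd d) :
    IsProbabilityMeasure
      (volume.withDensity fun y => ENNReal.ofReal (rescaledKernel k η (x - y))) :=
  ⟨by rw [withDensity_apply _ MeasurableSet.univ, setLIntegral_univ,
    hk.lintegral_rescaledKernel_sub_left hη]⟩

lemma integral_withDensity_rescaledKernel {E : Type*} [NormedAddCommGroup E] [NormedSpace ℝ E]
    (x : Rd d) (f : Rd d → E) :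
    ∫ y, f y ∂(volume.withDensity fun y => ENNReal.ofReal (rescaledKernel k η (x - y))) =
      ∫ y, rescaledKernel k η (x - y) • f y := by
  rw [integral_withDensity_eq_integral_toReal_smul (hk.measurable_rescaledKernel_sub (η := η) x)
    (Eventually.of_forall fun _ => ENNReal.ofReal_lt_top)]
  simp_rw [ENNReal.toReal_ofReal (hk.rescaledKernel_nonneg hη _)]

lemma integrable_withDensity_rescaledKernel {E : Type*} [NormedAddCommGroup E] [NormedSpace ℝ E]
    (x : Rd d) {f : Rd d → E} (hf : Integrable f) :
    Integrable f (volume.withDensity fun y => ENNReal.ofReal (rescaledKernel k η (x - y))) := by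
  rw [integrable_withDensity_iff_integrable_smul' (hk.measurable_rescaledKernel_sub (η := η) x)
    (Eventually.of_forall fun _ => ENNReal.ofReal_lt_top)]
  simp_rw [ENNReal.toReal_ofReal (hk.rescaledKernel_nonneg hη _)]
  obtain ⟨C, h0, hC⟩ := hk.rescaledKernel_exists_le hη
  refine hf.bdd_smul C ((hk.rescaledKernel_continuous η).comp
    (continuous_const.sub continuous_id)).aestronglyMeasurable (Eventually.of_forall fun y => ?_)
  rw [Real.norm_of_nonneg (hk.rescaledKernel_nonneg hη _)]
  exact hC _

/-- The mobility of a mollified measure dominates the mollified mobility. -/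
lemma IsMobility.lintegral_kernel_mobilityMeasure_le (hm : IsMobility M m) {μ : Measure (Rd d)}
    [IsFiniteMeasure μ] (h : IsAdmissible M μ) (x : Rd d) :
    ∫⁻ y, ENNReal.ofReal (rescaledKernel k η (x - y)) ∂mobilityMeasure M m μ ≤
      ENNReal.ofReal (clippedMobility M m (mollDensity k η μ x)) := by
  have hsl := hm.recessionSlope_nonneg
  have hprob := isProbabilityMeasure_withDensity_rescaledKernel hk hη x
  set ρ : Rd d → ℝ := fun y => (μ.rnDeriv volume y).toReal with hρ
  have hρi : Integrable ρ := Measure.integrable_toReal_rnDeriv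
  set τ := volume.withDensity fun y => ENNReal.ofReal (rescaledKernel k η (x - y)) with hτ
  have hρτ : Integrable ρ τ := integrable_withDensity_rescaledKernel hk hη x hρi
  have hS : ∀ᵐ y ∂τ, ρ y ∈ mobilityDomain M :=
    (withDensity_absolutelyContinuous _ _).ae_le h.ae_mem
  obtain ⟨hmem, hle⟩ := hm.integral_clippedMobility_le hρτ hS
  have hci := hm.integrable_clippedMobility hρτ (hS.mono fun y hy => hy.1)
  set t : ℝ := ∫ y, rescaledKernel k η (x - y) ∂μ.singularPart volume with ht
  have ht0 : 0 ≤ t := integral_nonneg fun _ => hk.rescaledKernel_nonneg hη _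
  -- The mollified density is the average of `ρ` under the probability measure `k_η(x - ·)ℒ`, plus
  -- the mollified singular mass `t`.
  have hsplit : mollDensity k η μ x = ∫ y, ρ y ∂τ + t := by
    rw [mollDensity, hτ, integral_withDensity_rescaledKernel hk hη]
    conv_lhs => rw [← Measure.singularPart_add_rnDeriv μ volume]
    rw [integral_add_measure (hk.integrable_rescaledKernel_sub hη _ x)
      (hk.integrable_rescaledKernel_sub hη _ x), add_comm,
      integral_withDensity_eq_integral_toReal_smul (Measure.measurable_rnDeriv _ _)
        (Measure.rnDeriv_lt_top _ _)]
    simp_rw [smul_eq_mul, mul_comm]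
    rfl
  have h1 : ∫⁻ y, ENNReal.ofReal (clippedMobility M m (μ.rnDeriv volume y).toReal) *
      ENNReal.ofReal (rescaledKernel k η (x - y)) =
      ENNReal.ofReal (∫ y, clippedMobility M m (ρ y) ∂τ) := by
    rw [ofReal_integral_eq_lintegral_ofReal hci
      (Eventually.of_forall fun y => hm.clippedMobility_nonneg _), hτ,
      lintegral_withDensity_eq_lintegral_mul _ (hk.measurable_rescaledKernel_sub (η := η) x)
        (hm.measurable_clippedMobility_rnDeriv μ).ennreal_ofReal]
    refine lintegral_congr fun y => ?_
    rw [Pi.mul_apply, mul_comm]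
  rw [hm.lintegral_mobilityMeasure μ (hk.measurable_rescaledKernel_sub (η := η) x), h1,
    ← ofReal_integral_eq_lintegral_ofReal (hk.integrable_rescaledKernel_sub hη _ x)
      (Eventually.of_forall fun _ => hk.rescaledKernel_nonneg hη _), ← ht,
    ← ENNReal.ofReal_mul hsl, ← ENNReal.ofReal_add
      (integral_nonneg fun _ => hm.clippedMobility_nonneg _) (mul_nonneg hsl ht0)]
  refine ENNReal.ofReal_le_ofReal ?_
  rw [hsplit]
  -- For `M = ∞`, Jensen treats the average of `ρ`, and the growth of `m` at rate at least `m'(∞)`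
  -- makes room for `t`. For finite `M` there is no singular part.
  rcases eq_top_or_lt_top M with hM | hM
  · have hmem2 : ∫ y, ρ y ∂τ + t ∈ mobilityDomain M :=
      ⟨add_nonneg hmem.1 ht0, by rw [hM]; exact le_top⟩
    rw [clippedMobility_of_mem hmem] at hle
    rw [clippedMobility_of_mem hmem2]
    exact (add_le_add hle le_rfl).trans (hm.add_slope_mul_le hM hmem.1 ht0)
  · have : t = 0 := by rw [ht, h.singularPart_eq_zero hM, integral_zero_measure]
    rw [this, mul_zero, add_zero, add_zero]
    exact hle

/-- Cauchy–Schwarz with weight `k_η(x - ·)` on the reference measure bounds `|∫ k u dλ|²` by `∫ k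
|u|² dλ · ∫ k dλ`, and the last factor is at most the mobility of the mollified density. Regular and
singular parts are treated together. -/
lemma IsMobility.actionDensity_moll_le (hm : IsMobility M m) {μ : Measure (Rd d)}
    [IsFiniteMeasure μ] (h : IsAdmissible M μ) {u : Rd d → Rd d} (hu : Measurable u)
    (hi : Integrable u (mobilityMeasure M m μ)) (x : Rd d) :
    actionDensity M m (mollDensity k η μ x)
        (mollMomentum k η ((mobilityMeasure M m μ).withDensityᵥ u) x) ≤
      ∫⁻ y, ENNReal.ofReal (rescaledKernel k η (x - y)) * ‖u y‖ₑ ^ 2 ∂mobilityMeasure M m μ := by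
  obtain ⟨C, h0, hC⟩ := hk.rescaledKernel_exists_le hη
  have hk0 := hk.rescaledKernel_nonneg hη
  have hkc : Continuous fun y => rescaledKernel k η (x - y) :=
    (hk.rescaledKernel_continuous η).comp (continuous_const.sub continuous_id)
  rw [actionDensity_of_mem (mollDensity_mem hk hη h x), mollMomentum,
    vecIntegral_withDensityᵥ hi hkc.measurable (C := C)
      (fun y => by rw [abs_of_nonneg (hk0 _)]; exact hC _)]
  by_cases htop : ∫⁻ y, ENNReal.ofReal (rescaledKernel k η (x - y)) * ‖u y‖ₑ ^ 2
      ∂mobilityMeasure M m μ = ⊤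
  · rw [htop]; exact le_top
  have hkm := hk.measurable_rescaledKernel_sub (η := η) x
  have e : ∀ y, (ENNReal.ofReal (rescaledKernel k η (x - y)) * ‖u y‖ₑ) ^ 2 /
      ENNReal.ofReal (rescaledKernel k η (x - y)) =
      ENNReal.ofReal (rescaledKernel k η (x - y)) * ‖u y‖ₑ ^ 2 := fun y => by
    have := enorm_smul_sq_div (hk0 (x - y)) (u y)
    rwa [enorm_smul, Real.enorm_of_nonneg (hk0 _)] at this
  have hcs := sq_lintegral_le (τ := mobilityMeasure M m μ)
    (f := fun y => ENNReal.ofReal (rescaledKernel k η (x - y)) * ‖u y‖ₑ)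
    (g := fun y => ENNReal.ofReal (rescaledKernel k η (x - y)))
    (hkm.mul hu.enorm).aemeasurable hkm.aemeasurable (fun _ => ENNReal.ofReal_ne_top)
    (by simp_rw [e]; exact htop)
  simp_rw [e] at hcs
  refine ENNReal.div_le_of_le_mul ?_
  refine le_trans ?_ (hcs.trans
    (mul_le_mul_right (hm.lintegral_kernel_mobilityMeasure_le hk hη h x) _))
  gcongr
  refine (enorm_integral_le_lintegral_enorm _).trans (le_of_eq ?_)
  refine lintegral_congr fun y => ?_
  rw [enorm_smul, Real.enorm_of_nonneg (hk0 _)]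

/-- The action of a mollified pair is at most the action of the pair. -/
lemma IsMobility.lintegral_actionDensity_moll_le (hm : IsMobility M m) {Ω : Set (Rd d)}
    (hfr : volume (frontier Ω) = 0) (hΩ : IsOpen Ω) {μ : Measure (Rd d)} [IsFiniteMeasure μ]
    {ν : VectorMeasure (Rd d) (Rd d)} :
    ∫⁻ x, actionDensity M m (mollDensity k η μ x) (mollMomentum k η ν x) ≤
      actionFunctional M m Ω μ ν := by
  by_cases htop : actionFunctional M m Ω μ ν = ⊤
  · rw [htop]; exact le_top
  obtain ⟨hμ, hνΩ, hadm, u, hu, hi, hν⟩ := hm.exists_density hfr htop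
  rw [hm.actionFunctional_eq hfr hΩ hμ hνΩ hadm hu hi hν]
  have := hm.sigmaFinite_mobilityMeasure μ
  calc ∫⁻ x, actionDensity M m (mollDensity k η μ x) (mollMomentum k η ν x)
      ≤ ∫⁻ x, ∫⁻ y, ENNReal.ofReal (rescaledKernel k η (x - y)) * ‖u y‖ₑ ^ 2
          ∂mobilityMeasure M m μ := by
        refine lintegral_mono fun x => ?_
        rw [hν]
        exact hm.actionDensity_moll_le hk hη hadm hu hi x
    _ = ∫⁻ y, (∫⁻ x, ENNReal.ofReal (rescaledKernel k η (x - y)) * ‖u y‖ₑ ^ 2)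
          ∂mobilityMeasure M m μ := by
        refine lintegral_lintegral_swap ?_
        have h1 := (hk.rescaledKernel_continuous η).measurable
        exact ((h1.comp (measurable_fst.sub measurable_snd)).ennreal_ofReal.mul
          ((hu.comp measurable_snd).enorm.pow_const 2)).aemeasurable
    _ = ∫⁻ y, ‖u y‖ₑ ^ 2 ∂mobilityMeasure M m μ := by
        refine lintegral_congr fun y => ?_
        rw [lintegral_mul_const, hk.lintegral_rescaledKernel_sub hη, one_mul]
        exact ((hk.rescaledKernel_continuous η).comp
          (continuous_id.sub continuous_const)).measurable.ennreal_ofReal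

end Mollification

/-! ### Convergence of mollifications -/

section MollificationLimits

variable {d : ℕ} {M : ENNReal} {m : ℝ → ℝ} {k : Rd d → ℝ} (hk : IsKernel k)
include hk

lemma IsKernel.continuous_mollDensity {η : ℝ} (hη : 0 < η) (μ : Measure (Rd d))
    [IsFiniteMeasure μ] : Continuous (mollDensity k η μ) := by
  obtain ⟨C, h0, hC⟩ := hk.rescaledKernel_exists_le hη
  refine continuous_of_dominated (bound := fun _ => C) (fun x => ?_) (fun x => ?_)
    (integrable_const C) (Eventually.of_forall fun y => ?_)
  · exact (hk.integrable_rescaledKernel_sub hη μ x).1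
  · refine Eventually.of_forall fun y => ?_
    rw [Real.norm_of_nonneg (hk.rescaledKernel_nonneg hη _)]
    exact hC _
  · exact (hk.rescaledKernel_continuous η).comp (continuous_id.sub continuous_const)

lemma IsKernel.integrable_mollDensity {η : ℝ} (hη : 0 < η) (μ : Measure (Rd d))
    [IsFiniteMeasure μ] : Integrable (mollDensity k η μ) := by
  refine ⟨(hk.continuous_mollDensity hη μ).aestronglyMeasurable, ?_⟩
  rw [hasFiniteIntegral_iff_ofReal
    (Eventually.of_forall fun x => mollDensity_nonneg hk hη μ x),
    lintegral_ofReal_mollDensity hk hη]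
  exact measure_lt_top _ _

lemma IsKernel.integral_mul_mollDensity {η : ℝ} (hη : 0 < η) (μ : Measure (Rd d))
    [IsFiniteMeasure μ] {f : Rd d → ℝ} (hf : Continuous f) {C : ℝ} (hC : ∀ x, |f x| ≤ C) :
    ∫ x, f x * mollDensity k η μ x = ∫ y, (∫ x, f x * rescaledKernel k η (x - y)) ∂μ := by
  simp_rw [mollDensity, ← integral_const_mul]
  refine integral_integral_swap ?_
  have hkc : Continuous fun p : Rd d × Rd d => rescaledKernel k η (p.1 - p.2) :=
    (hk.rescaledKernel_continuous η).comp (continuous_fst.sub continuous_snd)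
  have hK : Integrable (fun p : Rd d × Rd d => rescaledKernel k η (p.1 - p.2))
      (volume.prod μ) := by
    refine (integrable_prod_iff hkc.aestronglyMeasurable).2
      ⟨Eventually.of_forall fun x => hk.integrable_rescaledKernel_sub hη μ x, ?_⟩
    refine (hk.integrable_mollDensity hη μ).congr (Eventually.of_forall fun x => ?_)
    refine integral_congr_ae (Eventually.of_forall fun y => ?_)
    exact (Real.norm_of_nonneg (hk.rescaledKernel_nonneg hη _)).symm
  exact hK.bdd_mul (c := C) (hf.comp continuous_fst).aestronglyMeasurable
    (Eventually.of_forall fun p => hC _)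

/-- Integrals of a uniformly continuous function against mollified measures converge uniformly on
bounded sets of measures. -/
lemma IsKernel.exists_integral_mul_mollDensity_sub_le {f : Rd d → ℝ} (hf : UniformContinuous f)
    {C : ℝ} (hC : ∀ x, |f x| ≤ C) {e : ℝ} (he : 0 < e) :
    ∃ δ > 0, ∀ η, 0 < η → η < δ → ∀ μ : Measure (Rd d), IsFiniteMeasure μ →
      |(∫ x, f x * mollDensity k η μ x) - ∫ x, f x ∂μ| ≤ e * μ.real univ := by
  obtain ⟨δ, hδ, hfδ⟩ := Metric.uniformContinuous_iff.1 hf e he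
  refine ⟨δ, hδ, fun η hη hηδ μ _ => ?_⟩
  have hfi : Integrable f μ :=
    Integrable.of_bound hf.continuous.aestronglyMeasurable C (Eventually.of_forall hC)
  have hpt : ∀ y, ‖(∫ x, f x * rescaledKernel k η (x - y)) - f y‖ ≤ e := by
    intro y
    have hki : Integrable fun x => rescaledKernel k η (x - y) := by
      have h1 : Integrable (rescaledKernel k η) :=
        (hk.rescaledKernel_continuous η).integrable_of_hasCompactSupport
          (hk.rescaledKernel_hasCompactSupport hη)
      exact h1.comp_sub_right y
    have h1 : (∫ x, f x * rescaledKernel k η (x - y)) - f y =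
        ∫ x, (f x - f y) * rescaledKernel k η (x - y) := by
      simp_rw [sub_mul]
      rw [integral_sub (hki.bdd_mul (c := C) hf.continuous.aestronglyMeasurable
        (Eventually.of_forall hC)) (hki.const_mul _), integral_const_mul,
        hk.integral_rescaledKernel_sub' hη, mul_one]
    rw [h1]
    calc ‖∫ x, (f x - f y) * rescaledKernel k η (x - y)‖
        ≤ ∫ x, e * rescaledKernel k η (x - y) := by
          refine norm_integral_le_of_norm_le (hki.const_mul _) (Eventually.of_forall fun x => ?_)
          rw [norm_mul, Real.norm_of_nonneg (hk.rescaledKernel_nonneg hη _)]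
          by_cases hx : η < ‖x - y‖
          · rw [hk.rescaledKernel_eq_zero hη hx]; simp
          · refine mul_le_mul_of_nonneg_right (le_of_lt ?_) (hk.rescaledKernel_nonneg hη _)
            rw [← dist_eq_norm]
            refine hfδ ?_
            rw [dist_eq_norm]
            exact (not_lt.1 hx).trans_lt hηδ
      _ = e := by
          rw [integral_const_mul, hk.integral_rescaledKernel_sub' hη, mul_one]
  have hmeas : Integrable (fun y => ∫ x, f x * rescaledKernel k η (x - y)) μ := by
    have hs : StronglyMeasurable fun p : Rd d × Rd d => f p.2 * rescaledKernel k η (p.2 - p.1) :=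
      ((hf.continuous.comp continuous_snd).mul ((hk.rescaledKernel_continuous η).comp
        (continuous_snd.sub continuous_fst))).stronglyMeasurable
    refine Integrable.of_bound (hs.integral_prod_right' (ν := volume)).aestronglyMeasurable
      (e + C) (Eventually.of_forall fun y => ?_)
    calc _ = ‖((∫ x, f x * rescaledKernel k η (x - y)) - f y) + f y‖ := by rw [sub_add_cancel]
      _ ≤ _ := (norm_add_le _ _).trans (add_le_add (hpt y) (hC y))
  rw [hk.integral_mul_mollDensity hη μ hf.continuous hC, ← integral_sub hmeas hfi]
  exact norm_integral_le_of_norm_le_const (Eventually.of_forall hpt)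

lemma IsKernel.tendsto_integral_mul_mollDensity (μ : Measure (Rd d))
    [IsFiniteMeasure μ] {f : Rd d → ℝ} (hf : UniformContinuous f) {C : ℝ} (hC : ∀ x, |f x| ≤ C) :
    Tendsto (fun η => ∫ x, f x * mollDensity k η μ x) (𝓝[>] 0) (𝓝 (∫ x, f x ∂μ)) := by
  rw [Metric.tendsto_nhds]
  intro e he
  have hV : 0 ≤ μ.real univ := measureReal_nonneg
  obtain ⟨δ, hδ, h⟩ := hk.exists_integral_mul_mollDensity_sub_le hf hC
    (show 0 < e / (μ.real univ + 1) by positivity)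
  filter_upwards [Ioo_mem_nhdsGT hδ] with η ⟨hη, hηδ⟩
  refine (h η hη hηδ μ inferInstance).trans_lt ?_
  rw [div_mul_eq_mul_div, div_lt_iff₀ (by positivity)]
  nlinarith

/-- Domination by a multiple of the normalised indicator of a ball makes differentiation theorems
for balls applicable to the kernel. -/
lemma IsKernel.exists_rescaledKernel_le_inv : ∃ D, 0 ≤ D ∧ ∀ η > 0, ∀ x y,
    rescaledKernel k η (x - y) ≤ D * (volume.real (Metric.closedBall x η))⁻¹ := by
  obtain ⟨C, h0, hC⟩ := hk.exists_le
  have hv : 0 < volume.real (Metric.closedBall (0 : Rd d) 1) :=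
    ENNReal.toReal_pos (Metric.measure_closedBall_pos volume _ one_pos).ne'
      measure_closedBall_lt_top.ne
  refine ⟨C * volume.real (Metric.closedBall (0 : Rd d) 1), mul_nonneg h0 hv.le, ?_⟩
  intro η hη x y
  have h1 : volume.real (Metric.closedBall x η) =
      η ^ d * volume.real (Metric.closedBall (0 : Rd d) 1) := by
    rw [Measure.real, Measure.addHaar_closedBall' _ _ hη.le, ENNReal.toReal_mul,
      ENNReal.toReal_ofReal (by positivity), finrank_euclideanSpace_fin]
    rfl
  rw [h1, rescaledKernel]
  have : C * volume.real (Metric.closedBall (0 : Rd d) 1) *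
      (η ^ d * volume.real (Metric.closedBall (0 : Rd d) 1))⁻¹ = (η ^ d)⁻¹ * C := by
    field_simp
  rw [this]
  exact mul_le_mul_of_nonneg_left (hC _) (by positivity)

/-- Mollified measures converge almost everywhere to the Lebesgue density. -/
lemma IsKernel.ae_tendsto_mollDensity (μ : Measure (Rd d)) [IsFiniteMeasure μ] :
    ∀ᵐ x, Tendsto (fun η => mollDensity k η μ x) (𝓝[>] 0)
      (𝓝 (μ.rnDeriv volume x).toReal) := by
  obtain ⟨D, hD0, hD⟩ := hk.exists_rescaledKernel_le_inv
  have hρi : Integrable (fun y => (μ.rnDeriv volume y).toReal) :=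
    Measure.integrable_toReal_rnDeriv
  -- The good points are those where the singular part has density zero along balls and which are
  -- Lebesgue points of the density.
  filter_upwards [Besicovitch.ae_tendsto_rnDeriv (μ.singularPart volume) volume,
    (Measure.mutuallySingular_singularPart μ volume).rnDeriv_ae_eq_zero,
    (Besicovitch.vitaliFamily volume).ae_tendsto_average_norm_sub hρi.locallyIntegrable]
    with x h1 h2 h3
  set ρ := fun y => (μ.rnDeriv volume y).toReal with hρ
  have h3' := h3.comp (Besicovitch.tendsto_filterAt volume x)
  rw [h2] at h1
  have h1' := (ENNReal.tendsto_toReal ENNReal.zero_ne_top).comp h1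
  have hlim : Tendsto (fun η => D * (μ.singularPart volume).real (Metric.closedBall x η) /
      volume.real (Metric.closedBall x η) +
      D * ⨍ y in Metric.closedBall x η, ‖ρ y - ρ x‖) (𝓝[>] 0) (𝓝 0) := by
    have := (h1'.const_mul D).add (h3'.const_mul D)
    simp only [ENNReal.toReal_zero, mul_zero, add_zero] at this
    refine this.congr fun η => ?_
    simp only [Function.comp, ENNReal.toReal_div, Measure.real, mul_div_assoc]
    rfl
  rw [← tendsto_sub_nhds_zero_iff]
  refine squeeze_zero_norm' ?_ hlim
  filter_upwards [self_mem_nhdsWithin] with η (hη : 0 < η)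
  have hk0 := hk.rescaledKernel_nonneg hη
  have hki := hk.rescaledKernel_integrable hη x
  have hkρ : Integrable fun y => rescaledKernel k η (x - y) * ρ y := by
    obtain ⟨C, h0, hC⟩ := hk.rescaledKernel_exists_le hη
    refine hρi.bdd_mul (c := C) hki.1 (Eventually.of_forall fun y => ?_)
    rw [Real.norm_of_nonneg (hk0 _)]
    exact hC _
  have hsplit : mollDensity k η μ x - ρ x =
      ∫ y, rescaledKernel k η (x - y) ∂μ.singularPart volume +
      ∫ y, rescaledKernel k η (x - y) * (ρ y - ρ x) := by
    simp_rw [mul_sub]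
    rw [integral_sub hkρ (hki.mul_const _), integral_mul_const,
      hk.integral_rescaledKernel_sub hη, one_mul, ← add_sub_assoc]
    congr 1
    rw [mollDensity]
    conv_lhs => rw [← Measure.singularPart_add_rnDeriv μ volume]
    rw [integral_add_measure (hk.integrable_rescaledKernel_sub hη _ x)
      (hk.integrable_rescaledKernel_sub hη _ x),
      integral_withDensity_eq_integral_toReal_smul (Measure.measurable_rnDeriv _ _)
        (Measure.rnDeriv_lt_top _ _)]
    simp_rw [smul_eq_mul, mul_comm]
    rfl
  have hball : ∀ y, rescaledKernel k η (x - y) ≤ (Metric.closedBall x η).indicator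
      (fun _ => D * (volume.real (Metric.closedBall x η))⁻¹) y := by
    intro y
    by_cases hy : y ∈ Metric.closedBall x η
    · rw [indicator_of_mem hy]; exact hD η hη x y
    · rw [indicator_of_notMem hy, hk.rescaledKernel_eq_zero hη]
      rw [Metric.mem_closedBall, dist_comm, dist_eq_norm] at hy
      exact not_le.1 hy
  have hmB : MeasurableSet (Metric.closedBall x η) := Metric.isClosed_closedBall.measurableSet
  rw [hsplit]
  refine (norm_add_le _ _).trans (add_le_add ?_ ?_)
  · rw [Real.norm_of_nonneg (integral_nonneg fun _ => hk0 _)]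
    calc _ ≤ ∫ y, (Metric.closedBall x η).indicator
          (fun _ => D * (volume.real (Metric.closedBall x η))⁻¹) y ∂μ.singularPart volume :=
          integral_mono (hk.integrable_rescaledKernel_sub hη _ x)
            ((integrable_const _).indicator hmB) hball
      _ = _ := by
          rw [integral_indicator_const _ hmB, smul_eq_mul]
          ring
  · calc _ ≤ ∫ y, (Metric.closedBall x η).indicator (fun y =>
          D * (volume.real (Metric.closedBall x η))⁻¹ * ‖ρ y - ρ x‖) y := by
          refine norm_integral_le_of_norm_le ?_ (Eventually.of_forall fun y => ?_)
          · refine IntegrableOn.integrable_indicator ?_ hmB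
            have : IsFiniteMeasure (volume.restrict (Metric.closedBall x η)) :=
              ⟨by simpa using measure_closedBall_lt_top⟩
            exact ((hρi.integrableOn.sub (integrable_const _)).norm).const_mul _
          · rw [norm_mul, Real.norm_of_nonneg (hk0 _)]
            refine (mul_le_mul_of_nonneg_right (hball y) (norm_nonneg _)).trans (le_of_eq ?_)
            by_cases hy : y ∈ Metric.closedBall x η <;> simp [hy]
      _ = _ := by
          rw [integral_indicator hmB, integral_const_mul, setAverage_eq, smul_eq_mul, mul_assoc]

/-- If the mollified densities take values in the domain of the mobility, the measure is
admissible. -/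
lemma IsKernel.isAdmissible_of_mollDensity_mem {μ : Measure (Rd d)} [IsFiniteMeasure μ]
    (h : ∃ᶠ η in 𝓝[>] (0 : ℝ), ∀ x, mollDensity k η μ x ∈ mobilityDomain M) :
    IsAdmissible M μ := by
  intro hM
  -- Mollification moves the mass of `K` by at most `η`, so the mollified measure gives the
  -- `η`-thickening at least `μ K` and, its density being at most `M`, at most `M` times its volume.
  -- As `η → 0` the thickenings shrink to `K`; inner regularity extends the bound to Borel sets.
  have hK : ∀ K : Set (Rd d), IsCompact K → μ K ≤ M * volume K := by
    intro K hK
    have hlim : Tendsto (fun η => M * volume (Metric.cthickening η K)) (𝓝[>] 0)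
        (𝓝 (M * volume K)) :=
      ENNReal.Tendsto.const_mul
        ((tendsto_measure_cthickening_of_isCompact hK).mono_left nhdsWithin_le_nhds)
        (Or.inr hM.ne)
    refine ge_of_tendsto_of_frequently hlim ?_
    refine (h.and_eventually self_mem_nhdsWithin).mono ?_
    rintro η ⟨hS, hη : 0 < η⟩
    have hmT : MeasurableSet (Metric.cthickening η K) :=
      Metric.isClosed_cthickening.measurableSet
    have hj : Measurable fun p : Rd d × Rd d =>
        ENNReal.ofReal (rescaledKernel k η (p.1 - p.2)) :=
      ((hk.rescaledKernel_continuous η).measurable.comp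
        (measurable_fst.sub measurable_snd)).ennreal_ofReal
    calc μ K = ∫⁻ y in K, 1 ∂μ := by simp
      _ ≤ ∫⁻ y, (∫⁻ x in Metric.cthickening η K,
            ENNReal.ofReal (rescaledKernel k η (x - y))) ∂μ := by
          refine le_trans ?_ (setLIntegral_le_lintegral K _)
          refine setLIntegral_mono' hK.measurableSet fun y hy => ?_
          rw [← hk.lintegral_rescaledKernel_sub hη y, ← lintegral_indicator hmT]
          refine lintegral_mono fun x => ?_
          by_cases hx : x ∈ Metric.cthickening η K
          · rw [indicator_of_mem hx]
          · rw [hk.rescaledKernel_eq_zero hη, ENNReal.ofReal_zero]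
            · exact zero_le
            · rw [← dist_eq_norm]
              by_contra hc
              exact hx (Metric.mem_cthickening_of_dist_le x y η K hy (not_lt.1 hc))
      _ = ∫⁻ x in Metric.cthickening η K, ENNReal.ofReal (mollDensity k η μ x) := by
          simp_rw [ofReal_mollDensity hk hη μ]
          rw [lintegral_lintegral_swap]
          exact (hj.comp measurable_swap).aemeasurable
      _ ≤ ∫⁻ x in Metric.cthickening η K, M := lintegral_mono fun x => (hS x).2
      _ = M * volume (Metric.cthickening η K) := by simp
  refine Measure.le_iff.2 fun B hB => ?_
  rw [hB.measure_eq_iSup_isCompact_of_ne_top (measure_ne_top μ B)]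
  refine iSup₂_le fun K hKB => iSup_le fun hKc => (hK K hKc).trans ?_
  rw [Measure.smul_apply, smul_eq_mul]
  gcongr

omit hk in
lemma mollMomentum_apply {η : ℝ} (ν : VectorMeasure (Rd d) (Rd d)) (x : Rd d)
    (i : Fin d) : mollMomentum k η ν x i =
      mollDensity k η (posComp ν i) x - mollDensity k η (negComp ν i) x := rfl

lemma IsKernel.continuous_mollMomentum {η : ℝ} (hη : 0 < η) (ν : VectorMeasure (Rd d) (Rd d)) :
    Continuous (mollMomentum k η ν) := by
  refine (PiLp.continuous_toLp 2 _).comp (continuous_pi fun i => ?_)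
  exact (hk.continuous_mollDensity hη _).sub (hk.continuous_mollDensity hη _)

lemma IsKernel.tendsto_integral_inner_mollMomentum (ν : VectorMeasure (Rd d) (Rd d))
    {b : Rd d → Rd d} (hb : UniformContinuous b) {C : ℝ} (hC : ∀ x, ‖b x‖ ≤ C) :
    Tendsto (fun η => ∫ x, inner ℝ (b x) (mollMomentum k η ν x)) (𝓝[>] 0)
      (𝓝 (ν.integral b (innerSL ℝ))) := by
  have hbi : ∀ i, UniformContinuous fun x => b x i := fun i =>
    (EuclideanSpace.proj i : Rd d →L[ℝ] ℝ).uniformContinuous.comp hb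
  have hCi : ∀ i x, |b x i| ≤ C := fun i x => (PiLp.norm_apply_le (b x) i).trans (hC x)
  rw [integral_innerSL_eq_sum ν hb.continuous.measurable hC]
  have h1 := tendsto_finsetSum Finset.univ fun i (_ : i ∈ Finset.univ) =>
    (hk.tendsto_integral_mul_mollDensity (posComp ν i) (hbi i) (hCi i)).sub
    (hk.tendsto_integral_mul_mollDensity (negComp ν i) (hbi i) (hCi i))
  refine h1.congr' ?_
  filter_upwards [self_mem_nhdsWithin] with η (hη : 0 < η)
  have hint : ∀ i, ∀ σ : Measure (Rd d), IsFiniteMeasure σ →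
      Integrable fun x => b x i * mollDensity k η σ x := fun i σ hσ =>
    (hk.integrable_mollDensity hη σ).bdd_mul (c := C) (hbi i).continuous.aestronglyMeasurable
      (Eventually.of_forall (hCi i))
  have h2 : ∀ x, inner ℝ (b x) (mollMomentum k η ν x) =
      ∑ i, (b x i * mollDensity k η (posComp ν i) x -
        b x i * mollDensity k η (negComp ν i) x) := by
    intro x
    rw [PiLp.inner_apply]
    refine Finset.sum_congr rfl fun i _ => ?_
    rw [mollMomentum_apply, ← mul_sub]
    simp [mul_comm]
  simp_rw [h2]
  have h3 := integral_finsetSum (μ := volume) Finset.univ fun i (_ : i ∈ Finset.univ) =>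
    (hint i (posComp ν i) inferInstance).sub (hint i (negComp ν i) inferInstance)
  refine Eq.trans ?_ h3.symm
  refine Finset.sum_congr rfl fun i _ => ?_
  exact (integral_sub (hint i _ inferInstance) (hint i _ inferInstance)).symm

end MollificationLimits

/-! ### Lower semicontinuity of the action under mollification -/

section LowerSemicontinuity

open scoped BoundedContinuousFunction

variable {d : ℕ} {M : ENNReal} {m : ℝ → ℝ}

/-- Vector measures are determined by their integrals of bounded continuous functions. -/
lemma ext_vecIntegral {ν ν' : VectorMeasure (Rd d) (Rd d)}
    (h : ∀ g : Rd d →ᵇ ℝ, vecIntegral ν g = vecIntegral ν' g) : ν = ν' := by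
  refine ext_vecComponent fun i => ?_
  -- Moving the negative parts to the other side turns an identity of signed measures into one of
  -- finite positive measures, which bounded continuous functions determine.
  have key : posComp ν i + negComp ν' i = posComp ν' i + negComp ν i := by
    refine ext_of_forall_integral_eq_of_IsFiniteMeasure fun g => ?_
    rw [integral_add_measure (g.integrable _) (g.integrable _),
      integral_add_measure (g.integrable _) (g.integrable _)]
    have := congrArg (fun v : Rd d => v i) (h g)
    simp only [vecIntegral] at this
    linarith
  rw [← SignedMeasure.toSignedMeasure_toJordanDecomposition (vecComponent ν i),
    ← SignedMeasure.toSignedMeasure_toJordanDecomposition (vecComponent ν' i)]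
  ext B hB
  have hB' := congrArg (fun σ : Measure (Rd d) => σ.real B) key
  change (posComp ν i + negComp ν' i).real B = (posComp ν' i + negComp ν i).real B at hB'
  rw [measureReal_add_apply, measureReal_add_apply] at hB'
  rw [JordanDecomposition.toSignedMeasure, JordanDecomposition.toSignedMeasure,
    _root_.sub_apply, _root_.sub_apply,
    Measure.toSignedMeasure_apply_measurable hB, Measure.toSignedMeasure_apply_measurable hB,
    Measure.toSignedMeasure_apply_measurable hB, Measure.toSignedMeasure_apply_measurable hB]
  change (posComp ν i).real B - (negComp ν i).real B =
    (posComp ν' i).real B - (negComp ν' i).real B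
  linarith

lemma IsMobility.integral_mobilityMeasure (hm : IsMobility M m) (μ : Measure (Rd d))
    [IsFiniteMeasure μ] {f : Rd d → ℝ} (hf : Continuous f) (hfc : HasCompactSupport f) :
    ∫ x, f x ∂mobilityMeasure M m μ =
      (∫ x, f x * clippedMobility M m (μ.rnDeriv volume x).toReal) +
        recessionSlope M m * ∫ x, f x ∂μ.singularPart volume := by
  have hloc := hm.isLocallyFiniteMeasure_mobilityMeasure μ
  have h1 : Integrable f (mobilityMeasure M m μ) := hf.integrable_of_hasCompactSupport hfc
  rw [mobilityMeasure] at h1 ⊢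
  rw [integrable_add_measure] at h1
  rw [integral_add_measure h1.1 h1.2, integral_smul_measure,
    ENNReal.toReal_ofReal hm.recessionSlope_nonneg,
    integral_withDensity_eq_integral_toReal_smul
      (hm.measurable_clippedMobility_rnDeriv μ).ennreal_ofReal
      (Eventually.of_forall fun _ => ENNReal.ofReal_lt_top)]
  simp_rw [ENNReal.toReal_ofReal (hm.clippedMobility_nonneg _), smul_eq_mul, mul_comm]

/-- Upper semicontinuity of the mobility under mollification. -/
lemma IsMobility.eventually_integral_clippedMobility_le (hm : IsMobility M m) {k : Rd d → ℝ}
    (hk : IsKernel k) {μ : Measure (Rd d)} [IsFiniteMeasure μ] (hadm : IsAdmissible M μ)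
    {η : ℕ → ℝ} (hη0 : ∀ n, 0 < η n) (hη : Tendsto η atTop (𝓝 0)) {f : Rd d → ℝ} (hf : Continuous f)
    (hfc : HasCompactSupport f) (hf0 : ∀ x, 0 ≤ f x) {e : ℝ} (he : 0 < e) :
    ∀ᶠ n in atTop, (∫ x, f x * clippedMobility M m (mollDensity k (η n) μ x)) ≤
      (∫ x, f x ∂mobilityMeasure M m μ) + e := by
  obtain ⟨C₁, hC₁⟩ := hf.bounded_above_of_compact_support hfc
  have hfμ : ∀ σ : Measure (Rd d), IsFiniteMeasureOnCompacts σ → Integrable f σ :=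
    fun σ _ => hf.integrable_of_hasCompactSupport hfc
  set F := ∫ x, f x ∂μ with hF
  have hF0 : 0 ≤ F := integral_nonneg hf0
  -- The affine bound for the mobility overshoots the recession slope by `κ`. On a measure with
  -- integral `F` the excess is at most `e / 3`.
  set κ := e / (3 * (F + 1)) with hκd
  have hκ : 0 < κ := by positivity
  have hκF : κ * F ≤ e / 3 := by
    rw [hκd, div_mul_eq_mul_div, div_le_div_iff₀ (by positivity) (by positivity)]
    nlinarith
  obtain ⟨C, hC0, hC⟩ := hm.exists_clippedMobility_le hκ
  set a := recessionSlope M m + κ with ha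
  have ha0 : 0 ≤ a := add_nonneg hm.recessionSlope_nonneg hκ.le
  set ρ : Rd d → ℝ := fun x => (μ.rnDeriv volume x).toReal with hρ
  have hη' : Tendsto η atTop (𝓝[>] 0) :=
    tendsto_nhdsWithin_iff.2 ⟨hη, Eventually.of_forall hη0⟩
  have hmeas : ∀ n, 0 < η n →
      Integrable (fun x => f x * clippedMobility M m (mollDensity k (η n) μ x)) := by
    intro n hn
    have h1 : Integrable fun x => f x * (a * mollDensity k (η n) μ x + C) := by
      simp_rw [mul_add]
      exact ((hk.integrable_mollDensity hn μ).const_mul a).bdd_mul (c := C₁)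
        hf.aestronglyMeasurable (Eventually.of_forall hC₁) |>.add ((hfμ volume inferInstance).mul_const C)
    refine h1.mono' (hf.measurable.mul (hm.measurable_clippedMobility.comp
      (hk.continuous_mollDensity hn μ).measurable)).aestronglyMeasurable
      (Eventually.of_forall fun x => ?_)
    rw [Real.norm_of_nonneg (mul_nonneg (hf0 x) (hm.clippedMobility_nonneg _))]
    exact mul_le_mul_of_nonneg_left (hC _ (mollDensity_nonneg hk hn μ x)) (hf0 x)
  have hρi : Integrable ρ := Measure.integrable_toReal_rnDeriv
  have hfρ : Integrable fun x => f x * ρ x :=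
    hρi.bdd_mul (c := C₁) hf.aestronglyMeasurable (Eventually.of_forall hC₁)
  have hfm : Integrable fun x => f x * clippedMobility M m (ρ x) := by
    have h1 : Integrable fun x => f x * (a * ρ x + C) := by
      simp_rw [mul_add]
      exact (hρi.const_mul a).bdd_mul (c := C₁)
        hf.aestronglyMeasurable (Eventually.of_forall hC₁) |>.add ((hfμ volume inferInstance).mul_const C)
    refine h1.mono' (hf.measurable.mul
      (hm.measurable_clippedMobility_rnDeriv μ)).aestronglyMeasurable
      (Eventually.of_forall fun x => ?_)
    rw [Real.norm_of_nonneg (mul_nonneg (hf0 x) (hm.clippedMobility_nonneg _))]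
    exact mul_le_mul_of_nonneg_left (hC _ ENNReal.toReal_nonneg) (hf0 x)
  -- Mass of `μ^⊥` disappears in the almost everywhere limit, so Fatou cannot be applied to the
  -- mobility itself. Subtracting it from its affine bound gives nonnegative functions; the
  -- integrals of `f ρ_n` converge to `F`, and the lost mass reappears with the factor `a = m'(∞) +
  -- κ`.
  set h : ℕ → Rd d → ℝ := fun n x =>
    f x * (a * mollDensity k (η n) μ x + C - clippedMobility M m (mollDensity k (η n) μ x)) with hh
  set h₀ : Rd d → ℝ := fun x => f x * (a * ρ x + C - clippedMobility M m (ρ x)) with hh0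
  have hh00 : ∀ x, 0 ≤ h₀ x := fun x =>
    mul_nonneg (hf0 x) (sub_nonneg.2 (hC _ ENNReal.toReal_nonneg))
  have hh0i : Integrable h₀ := by
    refine (((hfρ.const_mul a).add ((hfμ volume inferInstance).mul_const C)).sub hfm).congr
      (Eventually.of_forall fun x => ?_)
    simp only [Pi.add_apply, Pi.sub_apply, hh0]; ring
  have hint : ∀ R : Rd d → ℝ, Integrable (fun x => f x * R x) →
      Integrable (fun x => f x * clippedMobility M m (R x)) →
      ∫ x, f x * (a * R x + C - clippedMobility M m (R x)) = a * (∫ x, f x * R x) +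
        (∫ x, f x) * C - ∫ x, f x * clippedMobility M m (R x) := by
    intro R hR hRm
    have i1 := hR.const_mul a
    have i2 := (hfμ volume inferInstance).mul_const C
    have i3 : Integrable fun x => a * (f x * R x) + f x * C := i1.add i2
    rw [← integral_const_mul, ← integral_mul_const, ← integral_add i1 i2,
      ← integral_sub i3 hRm]
    refine integral_congr_ae (Eventually.of_forall fun x => ?_)
    simp only; ring
  have hfρn : ∀ n, Integrable fun x => f x * mollDensity k (η n) μ x := fun n =>
    (hk.integrable_mollDensity (hη0 n) μ).bdd_mul (c := C₁) hf.aestronglyMeasurable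
      (Eventually.of_forall hC₁)
  have hhm : ∀ n, Measurable (h n) := fun n => by
    have := (hk.continuous_mollDensity (hη0 n) μ).measurable
    exact hf.measurable.mul (((this.const_mul a).add_const C).sub
      (hm.measurable_clippedMobility.comp this))
  have hh0n : ∀ n x, 0 ≤ h n x := fun n x =>
    mul_nonneg (hf0 x) (sub_nonneg.2 (hC _ (mollDensity_nonneg hk (hη0 n) μ x)))
  have hhi : ∀ n, Integrable (h n) := fun n => by
    refine ((((hfρn n).const_mul a).add ((hfμ volume inferInstance).mul_const C)).sub
      (hmeas n (hη0 n))).congr (Eventually.of_forall fun x => ?_)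
    simp only [Pi.add_apply, Pi.sub_apply, hh]; ring
  have hFatou : ENNReal.ofReal (∫ x, h₀ x) ≤
      liminf (fun n => ENNReal.ofReal (∫ x, h n x)) atTop := by
    simp_rw [ofReal_integral_eq_lintegral_ofReal (hhi _) (Eventually.of_forall (hh0n _)),
      ofReal_integral_eq_lintegral_ofReal hh0i (Eventually.of_forall hh00)]
    refine le_trans (lintegral_mono_ae ?_)
      (lintegral_liminf_le fun n => (hhm n).ennreal_ofReal)
    filter_upwards [hk.ae_tendsto_mollDensity μ, hadm.ae_mem] with x hx hxS
    have hx' := hx.comp hη'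
    have hS : ∀ n, mollDensity k (η n) μ x ∈ mobilityDomain M := fun n =>
      mollDensity_mem hk (hη0 n) hadm x
    have h1 : Tendsto (fun n => clippedMobility M m (mollDensity k (η n) μ x)) atTop
        (𝓝 (clippedMobility M m (ρ x))) := by
      rw [clippedMobility_of_mem hxS]
      simp_rw [clippedMobility_of_mem (hS _)]
      exact (hm.continuousOn_mobilityExt _ hxS).tendsto.comp
        (tendsto_nhdsWithin_iff.2 ⟨hx', Eventually.of_forall hS⟩)
    have h2 : Tendsto (fun n => ENNReal.ofReal (h n x)) atTop (𝓝 (ENNReal.ofReal (h₀ x))) :=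
      (ENNReal.continuous_ofReal.tendsto _).comp
        ((((hx'.const_mul a).add_const C).sub h1).const_mul (f x))
    exact h2.liminf_eq.ge
  have hev : ∀ᶠ n in atTop, (∫ x, h₀ x) - e / 6 < ∫ x, h n x := by
    rcases le_or_gt ((∫ x, h₀ x) - e / 6) 0 with hc | hc
    · rcases hc.lt_or_eq with hc | hc
      · exact Eventually.of_forall fun n => hc.trans_le (integral_nonneg (hh0n n))
      · have h6 : ENNReal.ofReal 0 < ENNReal.ofReal (∫ x, h₀ x) :=
          (ENNReal.ofReal_lt_ofReal_iff (by linarith)).2 (by linarith)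
        filter_upwards [eventually_lt_of_lt_liminf (h6.trans_le hFatou)] with n hn
        rw [hc]
        exact (ENNReal.ofReal_lt_ofReal_iff'.1 hn).1
    · have h6 : ENNReal.ofReal ((∫ x, h₀ x) - e / 6) < ENNReal.ofReal (∫ x, h₀ x) :=
        (ENNReal.ofReal_lt_ofReal_iff (by linarith)).2 (by linarith)
      filter_upwards [eventually_lt_of_lt_liminf (h6.trans_le hFatou)] with n hn
      exact (ENNReal.ofReal_lt_ofReal_iff'.1 hn).1
  have hlim : ∀ᶠ n in atTop, ∫ x, f x * mollDensity k (η n) μ x < F + e / (6 * (a + 1)) := by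
    refine ((hk.tendsto_integral_mul_mollDensity μ
      (hfc.uniformContinuous_of_continuous hf) hC₁).comp hη').eventually_lt_const ?_
    have : 0 < e / (6 * (a + 1)) := by positivity
    linarith
  have hFsplit : F = (∫ x, f x * ρ x) + ∫ x, f x ∂μ.singularPart volume := by
    rw [hF]
    conv_lhs => rw [← Measure.singularPart_add_rnDeriv μ volume]
    rw [integral_add_measure (hfμ _ inferInstance) (hfμ _ inferInstance), add_comm,
      integral_withDensity_eq_integral_toReal_smul (Measure.measurable_rnDeriv _ _)
        (Measure.rnDeriv_lt_top _ _)]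
    simp_rw [smul_eq_mul, mul_comm]
    rfl
  have hae : a * (e / (6 * (a + 1))) ≤ e / 6 := by
    rw [← mul_div_assoc, div_le_div_iff₀ (by positivity) (by positivity)]
    nlinarith
  have hfs0 : 0 ≤ ∫ x, f x * ρ x := integral_nonneg fun x =>
    mul_nonneg (hf0 x) ENNReal.toReal_nonneg
  -- The errors are `e / 6` from Fatou, `e / 6` from the mass integral and `e / 3` from `κ`.
  filter_upwards [hev, hlim] with n h1 h2
  rw [hint _ hfρ hfm, hint _ (hfρn n) (hmeas n (hη0 n))] at h1
  rw [hm.integral_mobilityMeasure μ hf hfc]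
  have h3 := mul_le_mul_of_nonneg_left h2.le ha0
  have h4 : κ * ∫ x, f x ∂μ.singularPart volume ≤ e / 3 :=
    (mul_le_mul_of_nonneg_left (by linarith) hκ.le).trans hκF
  have h5 : a * F = a * (∫ x, f x * ρ x) +
      recessionSlope M m * (∫ x, f x ∂μ.singularPart volume) +
      κ * ∫ x, f x ∂μ.singularPart volume := by rw [hFsplit, ha]; ring
  change _ ≤ (∫ x, f x * clippedMobility M m (ρ x)) + _ + e
  linarith

/-- If the actions of mollifications are frequently bounded by `A`, the vector measure acts
boundedly on the `L²` space of the mobility measure. -/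
lemma IsMobility.sq_integral_le_of_frequently (hm : IsMobility M m) {k : Rd d → ℝ}
    (hk : IsKernel k) {μ : Measure (Rd d)} [IsFiniteMeasure μ] (hadm : IsAdmissible M μ)
    {ν : VectorMeasure (Rd d) (Rd d)}
    {η : ℕ → ℝ} (hη0 : ∀ n, 0 < η n) (hη : Tendsto η atTop (𝓝 0)) {A : ENNReal} (hA : A ≠ ⊤)
    (hfreq : ∃ᶠ n in atTop,
      ∫⁻ x, actionDensity M m (mollDensity k (η n) μ x) (mollMomentum k (η n) ν x) ≤ A)
    {b : Rd d → Rd d} (hb : Continuous b) (hbc : HasCompactSupport b) :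
    (ν.integral b (innerSL ℝ)) ^ 2 ≤ A.toReal * ∫ x, ‖b x‖ ^ 2 ∂mobilityMeasure M m μ := by
  obtain ⟨C, hC⟩ := hb.bounded_above_of_compact_support hbc
  have hη' : Tendsto η atTop (𝓝[>] 0) :=
    tendsto_nhdsWithin_iff.2 ⟨hη, Eventually.of_forall hη0⟩
  have hf : Continuous fun x => ‖b x‖ ^ 2 := hb.norm.pow 2
  have hfc : HasCompactSupport fun x => ‖b x‖ ^ 2 :=
    hbc.norm.comp_left (g := fun t : ℝ => t ^ 2) (by simp)
  have hf0 : ∀ x, 0 ≤ ‖b x‖ ^ 2 := fun x => by positivity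
  have hlim := (hk.tendsto_integral_inner_mollMomentum ν
    (hbc.uniformContinuous_of_continuous hb) hC).comp hη'
  -- Cauchy–Schwarz with weight `|b|² m(ρ_n)`; upper semicontinuity of the mobility then removes `n`
  -- from the right-hand side.
  have key : ∀ n, ∫⁻ x, actionDensity M m (mollDensity k (η n) μ x)
      (mollMomentum k (η n) ν x) ≤ A →
      (∫ x, inner ℝ (b x) (mollMomentum k (η n) ν x)) ^ 2 ≤
        A.toReal * ∫ x, ‖b x‖ ^ 2 * clippedMobility M m (mollDensity k (η n) μ x) := by
    intro n hn
    have hρc := hk.continuous_mollDensity (hη0 n) μ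
    have hwc := hk.continuous_mollMomentum (hη0 n) ν
    set ρ := mollDensity k (η n) μ with hρ
    set w := mollMomentum k (η n) ν with hw
    have hgm : Measurable fun x => clippedMobility M m (ρ x) :=
      hm.measurable_clippedMobility.comp hρc.measurable
    have hX : ∫⁻ x, ENNReal.ofReal (‖b x‖ ^ 2 * clippedMobility M m (ρ x)) =
        ENNReal.ofReal (∫ x, ‖b x‖ ^ 2 * clippedMobility M m (ρ x)) := by
      refine (ofReal_integral_eq_lintegral_ofReal ?_ (Eventually.of_forall fun x =>
        mul_nonneg (hf0 x) (hm.clippedMobility_nonneg _))).symm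
      obtain ⟨C₂, h20, hC₂⟩ := hm.exists_clippedMobility_le one_pos
      have i1 : Integrable (fun x => ‖b x‖ ^ 2 * ((recessionSlope M m + 1) * ρ x + C₂)) := by
        refine Continuous.integrable_of_hasCompactSupport
          (hf.mul ((hρc.const_mul _).add continuous_const)) (hfc.mul_right)
      refine i1.mono' (hf.measurable.mul hgm).aestronglyMeasurable
        (Eventually.of_forall fun x => ?_)
      rw [Real.norm_of_nonneg (mul_nonneg (hf0 x) (hm.clippedMobility_nonneg _))]
      exact mul_le_mul_of_nonneg_left (hC₂ _ (mollDensity_nonneg hk (hη0 n) μ x)) (hf0 x)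
    have hfg : ∀ x, (‖b x‖ₑ * ‖w x‖ₑ) ^ 2 /
        ENNReal.ofReal (‖b x‖ ^ 2 * clippedMobility M m (ρ x)) ≤
        actionDensity M m (ρ x) (w x) := by
      intro x
      rw [actionDensity_of_mem (mollDensity_mem hk (hη0 n) hadm x),
        ENNReal.ofReal_mul (hf0 x), ENNReal.ofReal_pow (norm_nonneg _), ofReal_norm, mul_pow]
      by_cases h0 : ‖b x‖ₑ = 0
      · rw [h0]; simp
      · rw [ENNReal.mul_div_mul_left _ _ (pow_ne_zero 2 h0) (ENNReal.pow_ne_top enorm_ne_top)]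
    have hle : ∫⁻ x, (‖b x‖ₑ * ‖w x‖ₑ) ^ 2 /
        ENNReal.ofReal (‖b x‖ ^ 2 * clippedMobility M m (ρ x)) ≤ A :=
      (lintegral_mono hfg).trans hn
    have hcs := sq_lintegral_le (τ := volume) (f := fun x => ‖b x‖ₑ * ‖w x‖ₑ)
      (g := fun x => ENNReal.ofReal (‖b x‖ ^ 2 * clippedMobility M m (ρ x)))
      (hb.measurable.enorm.mul hwc.measurable.enorm).aemeasurable
      (hf.measurable.mul hgm).ennreal_ofReal.aemeasurable (fun _ => ENNReal.ofReal_ne_top)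
      (ne_top_of_le_ne_top hA hle)
    rw [hX] at hcs
    have h1 : ‖∫ x, inner ℝ (b x) (w x)‖ₑ ≤ ∫⁻ x, ‖b x‖ₑ * ‖w x‖ₑ := by
      refine (enorm_integral_le_lintegral_enorm _).trans (lintegral_mono fun x => ?_)
      rw [← enorm_norm (b x), ← enorm_norm (w x), ← enorm_mul]
      exact enorm_le_iff_norm_le.2 (by simpa using norm_inner_le_norm (𝕜 := ℝ) (b x) (w x))
    have h2 : ‖∫ x, inner ℝ (b x) (w x)‖ₑ ^ 2 ≤
        A * ENNReal.ofReal (∫ x, ‖b x‖ ^ 2 * clippedMobility M m (ρ x)) :=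
      (pow_le_pow_left' h1 2).trans (hcs.trans (mul_le_mul_left hle _))
    have h3 := ENNReal.toReal_mono (ENNReal.mul_ne_top hA ENNReal.ofReal_ne_top) h2
    rw [ENNReal.toReal_mul, ENNReal.toReal_ofReal (integral_nonneg fun x =>
      mul_nonneg (hf0 x) (hm.clippedMobility_nonneg _)), ENNReal.toReal_pow, toReal_enorm,
      Real.norm_eq_abs, sq_abs] at h3
    exact h3
  refine le_of_forall_pos_le_add fun e he => ?_
  have he' : 0 < e / (A.toReal + 1) := div_pos he (by positivity)
  have hev := hm.eventually_integral_clippedMobility_le hk hadm hη0 hη hf hfc hf0 he'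
  refine le_of_tendsto_of_frequently (hlim.pow 2) ((hfreq.and_eventually hev).mono ?_)
  rintro n ⟨h1, h2⟩
  refine (key n h1).trans ((mul_le_mul_of_nonneg_left h2 ENNReal.toReal_nonneg).trans ?_)
  rw [mul_add]
  gcongr
  rw [← mul_div_assoc, div_le_iff₀ (by positivity)]
  nlinarith [ENNReal.toReal_nonneg (a := A)]

lemma ae_mem_of_concentrated {ν : VectorMeasure (Rd d) (Rd d)} {K : Set (Rd d)}
    (h : ν.variation Kᶜ = 0) (i : Fin d) :
    (∀ᵐ x ∂posComp ν i, x ∈ K) ∧ ∀ᵐ x ∂negComp ν i, x ∈ K :=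
  ⟨le_antisymm ((posComp_le_variation ν i _).trans h.le) zero_le,
    le_antisymm ((negComp_le_variation ν i _).trans h.le) zero_le⟩

/-- Restriction of the quadratic bound to a compact set carrying the vector measure. -/
lemma sq_integral_le_restrict {ν : VectorMeasure (Rd d) (Rd d)} {lam : Measure (Rd d)}
    [IsLocallyFiniteMeasure lam] {K : Set (Rd d)} (hK : IsCompact K) (hν : ν.variation Kᶜ = 0)
    {a : ℝ} (h : ∀ b : Rd d → Rd d, Continuous b → HasCompactSupport b →
      (ν.integral b (innerSL ℝ)) ^ 2 ≤ a * ∫ x, ‖b x‖ ^ 2 ∂lam) (b : Rd d →ᵇ Rd d) :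
    (ν.integral b (innerSL ℝ)) ^ 2 ≤ a * ∫ x, ‖b x‖ ^ 2 ∂lam.restrict K := by
  have hδ : ∀ j : ℕ, (0 : ℝ) < 1 / ((j : ℝ) + 1) := fun j => Nat.one_div_pos_of_nat
  -- These cutoffs equal one on `K`, so they do not change the integral against `ν`, while they
  -- decrease to the indicator of `K` and so restrict the right-hand side in the limit.
  set χ : ℕ → Rd d → ℝ := fun j x => thickenedIndicator (hδ j) K x with hχ
  have hχc : ∀ j, Continuous (χ j) := fun j =>
    NNReal.continuous_coe.comp (thickenedIndicator (hδ j) K).continuous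
  have hχ0 : ∀ j x, 0 ≤ χ j x := fun j x => NNReal.coe_nonneg _
  have hχ1 : ∀ j x, χ j x ≤ 1 := fun j x => by
    exact NNReal.coe_le_one.2 (thickenedIndicator_le_one (hδ j) K x)
  have hχK : ∀ j, ∀ x ∈ K, χ j x = 1 := fun j x hx => by
    simp only [hχ, thickenedIndicator_one (hδ j) K hx, NNReal.coe_one]
  have hχn : ∀ j, ∀ x ∉ Metric.cthickening 1 K, χ j x = 0 := fun j x hx => by
    have : x ∉ Metric.thickening (1 / ((j : ℝ) + 1)) K := fun h' => hx
      (Metric.thickening_subset_cthickening_of_le (by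
        rw [div_le_one (by positivity)]; linarith [Nat.cast_nonneg (α := ℝ) j]) K h')
    simp only [hχ, thickenedIndicator_zero (hδ j) K this, NNReal.coe_zero]
  have hcomp : IsCompact (Metric.cthickening 1 K) := hK.cthickening
  have hb : ∀ x, ‖b x‖ ≤ ‖b‖ := b.norm_coe_le_norm
  have hsm : ∀ j, Continuous fun x => χ j x • b x := fun j => (hχc j).smul b.continuous
  have hint : ∀ j, ν.integral (fun x => χ j x • b x) (innerSL ℝ) = ν.integral b (innerSL ℝ) := by
    intro j
    rw [integral_innerSL_eq_sum ν (hsm j).measurable (C := ‖b‖) fun x => by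
        rw [norm_smul, Real.norm_of_nonneg (hχ0 j x)]
        exact (mul_le_of_le_one_left (norm_nonneg _) (hχ1 j x)).trans (hb x),
      integral_innerSL_eq_sum ν b.continuous.measurable hb]
    refine Finset.sum_congr rfl fun i _ => ?_
    obtain ⟨h1, h2⟩ := ae_mem_of_concentrated hν i
    congr 1
    · refine integral_congr_ae (h1.mono fun x hx => ?_)
      simp [hχK j x hx]
    · refine integral_congr_ae (h2.mono fun x hx => ?_)
      simp [hχK j x hx]
  have hlim : Tendsto (fun j => ∫ x, ‖χ j x • b x‖ ^ 2 ∂lam) atTop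
      (𝓝 (∫ x, ‖b x‖ ^ 2 ∂lam.restrict K)) := by
    rw [← integral_indicator hK.measurableSet]
    refine tendsto_integral_of_dominated_convergence
      ((Metric.cthickening 1 K).indicator fun _ => ‖b‖ ^ 2) (fun j =>
        ((hsm j).norm.pow 2).aestronglyMeasurable) ?_ (fun j => Eventually.of_forall fun x => ?_)
      (Eventually.of_forall fun x => ?_)
    · rw [integrable_indicator_iff hcomp.measurableSet]
      exact integrableOn_const hcomp.measure_lt_top.ne
    · rw [Real.norm_of_nonneg (by positivity)]
      by_cases hx : x ∈ Metric.cthickening 1 K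
      · rw [indicator_of_mem hx, norm_smul, Real.norm_of_nonneg (hχ0 j x)]
        gcongr
        exact (mul_le_of_le_one_left (norm_nonneg _) (hχ1 j x)).trans (hb x)
      · rw [indicator_of_notMem hx, hχn j x hx]; simp
    · by_cases hx : x ∈ K
      · rw [indicator_of_mem hx]
        refine tendsto_const_nhds.congr fun j => ?_
        rw [hχK j x hx, one_smul]
      · rw [indicator_of_notMem hx]
        have h1 := tendsto_pi_nhds.1 (thickenedIndicator_tendsto_indicator_closure hδ
          tendsto_one_div_add_atTop_nhds_zero_nat K) x
        rw [hK.isClosed.closure_eq, indicator_of_notMem hx] at h1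
        have h2 : Tendsto (fun j => χ j x) atTop (𝓝 0) := by
          have := (NNReal.continuous_coe.tendsto 0).comp h1
          rwa [NNReal.coe_zero] at this
        have h3 := (h2.smul_const (b x)).norm.pow 2
        simpa using h3
  refine ge_of_tendsto (hlim.const_mul a) (Eventually.of_forall fun j => ?_)
  rw [← hint j]
  exact h _ (hsm j) (hcomp.of_isClosed_subset (isClosed_tsupport _) (closure_minimal
    (fun x hx => by
      by_contra hc
      exact hx (by simp [hχn j x hc])) hcomp.isClosed))

end LowerSemicontinuity

/-! ### Densities from the Riesz theorem, and lower semicontinuity along mollifications -/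

section RieszDensity

open scoped BoundedContinuousFunction

variable {d : ℕ} {M : ENNReal} {m : ℝ → ℝ}

/-- A vector measure acting boundedly on `L²` of a finite measure has a square integrable
density. -/
lemma exists_density_of_sq_integral_le {ν : VectorMeasure (Rd d) (Rd d)} {τ : Measure (Rd d)}
    [IsFiniteMeasure τ] {A : ENNReal}
    (h : ∀ b : Rd d →ᵇ Rd d, (ν.integral b (innerSL ℝ)) ^ 2 ≤ A.toReal * ∫ x, ‖b x‖ ^ 2 ∂τ) :
    ∃ u, Measurable u ∧ Integrable u τ ∧ ν = τ.withDensityᵥ u ∧ ∫⁻ x, ‖u x‖ₑ ^ 2 ∂τ ≤ A := by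
  have hi : ∀ b : Rd d →ᵇ Rd d, ν.Integrable b := fun b => b.integrable _
  let f : (Rd d →ᵇ Rd d) →ₗ[ℝ] ℝ :=
    { toFun := fun b => ν.integral b (innerSL ℝ)
      map_add' := fun b c => VectorMeasure.integral_add (hi b) (hi c)
      map_smul' := fun c b => VectorMeasure.integral_smul (f := b) (μ := ν) (B := innerSL ℝ) c }
  let e := BoundedContinuousFunction.toLp (E := Rd d) 2 τ ℝ
  have hnorm : ∀ b, ‖e b‖ ^ 2 = ∫ x, ‖b x‖ ^ 2 ∂τ := by
    intro b
    rw [← real_inner_self_eq_norm_sq, L2.inner_def]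
    refine integral_congr_ae ((BoundedContinuousFunction.coeFn_toLp 2 τ ℝ b).mono fun x hx => ?_)
    simp only [e]
    rw [hx, real_inner_self_eq_norm_sq]
  have hbd : ∀ b, ‖f b‖ ≤ √A.toReal * ‖e b‖ := by
    intro b
    refine abs_le_of_sq_le_sq ?_ (by positivity)
    rw [mul_pow, Real.sq_sqrt ENNReal.toReal_nonneg, hnorm]
    exact h b
  have hdense : DenseRange e.toLinearMap :=
    BoundedContinuousFunction.toLp_denseRange (Rd d) τ ℝ (by simp)
  -- Bounded continuous fields are dense in `L²(τ)`, so the functional extends there with norm at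
  -- most `√A`, and the Riesz representative is the density.
  let T := f.extendOfNorm e.toLinearMap
  have hT : ∀ b, T (e b) = f b := fun b => f.extendOfNorm_eq hdense ⟨_, hbd⟩ b
  have hTn : ‖T‖ ≤ √A.toReal := f.opNorm_extendOfNorm_le hdense (Real.sqrt_nonneg _) hbd
  let v := (InnerProductSpace.toDual ℝ (Lp (Rd d) 2 τ)).symm T
  have hv : ∀ b, inner ℝ v (e b) = f b := fun b => by
    rw [InnerProductSpace.toDual_symm_apply, hT]
  have hvn : ‖v‖ ≤ √A.toReal := by
    rw [LinearIsometryEquiv.norm_map]; exact hTn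
  have hmem : MemLp v 2 τ := Lp.memLp v
  have hum : Measurable (v : Rd d → Rd d) := (Lp.stronglyMeasurable v).measurable
  have hui : Integrable v τ := hmem.integrable (by norm_num)
  refine ⟨v, hum, hui, ext_vecIntegral fun g => ?_, ?_⟩
  · ext i
    rw [vecIntegral_withDensityᵥ hui g.continuous.measurable (C := ‖g‖) g.norm_coe_le_norm]
    -- A field along one coordinate axis isolates the corresponding component of `ν`.
    let b : Rd d →ᵇ Rd d := BoundedContinuousFunction.ofNormedAddCommGroup
      (fun x => g x • (EuclideanSpace.single i 1 : Rd d)) (g.continuous.smul continuous_const) ‖g‖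
      (fun x => by simpa [norm_smul] using g.norm_coe_le_norm x)
    have hbx : ∀ x, b x = g x • (EuclideanSpace.single i 1 : Rd d) := fun x => rfl
    have h1 := hv b
    have h2 : f b = vecIntegral ν g i := by
      change ν.integral b (innerSL ℝ) = _
      rw [integral_innerSL_eq_sum ν b.continuous.measurable b.norm_coe_le_norm,
        Finset.sum_eq_single i]
      · simp [hbx, vecIntegral]
      · intro j _ hj
        simp [hbx, hj]
      · simp
    have hgv : Integrable (fun x => g x • (v : Rd d → Rd d) x) τ :=
      hui.bdd_smul ‖g‖ g.continuous.aestronglyMeasurable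
        (Eventually.of_forall g.norm_coe_le_norm)
    have h3 : (∫ x, g x • (v : Rd d → Rd d) x ∂τ) i = ∫ x, (g x • (v : Rd d → Rd d) x) i ∂τ :=
      ((EuclideanSpace.proj i : Rd d →L[ℝ] ℝ).integral_comp_comm hgv).symm
    rw [← h2, ← h1, h3, L2.inner_def]
    refine integral_congr_ae ((BoundedContinuousFunction.coeFn_toLp 2 τ ℝ b).mono fun x hx => ?_)
    simp only [e]
    rw [hx, hbx, inner_smul_right, EuclideanSpace.inner_single_right]
    simp
  · have h1 := eLpNorm_nnreal_pow_eq_lintegral (f := (v : Rd d → Rd d)) (μ := τ) (p := 2)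
      two_ne_zero
    have h2 : eLpNorm v 2 τ = ENNReal.ofReal ‖v‖ := by
      rw [Lp.norm_def, ENNReal.ofReal_toReal (Lp.eLpNorm_ne_top v)]
    have h3 : ‖v‖ ^ 2 ≤ A.toReal := by
      rw [← Real.sq_sqrt (ENNReal.toReal_nonneg (a := A))]
      gcongr
    calc ∫⁻ x, ‖v x‖ₑ ^ 2 ∂τ = eLpNorm v 2 τ ^ 2 := by
          simpa using h1.symm
      _ = ENNReal.ofReal (‖v‖ ^ 2) := by rw [h2, ENNReal.ofReal_pow (norm_nonneg _)]
      _ ≤ A := ENNReal.ofReal_le_of_le_toReal h3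

/-- Lower semicontinuity of the action along mollifications. -/
lemma IsMobility.actionFunctional_le_liminf (hm : IsMobility M m) {k : Rd d → ℝ}
    (hk : IsKernel k) {Ω : Set (Rd d)} (hfr : volume (frontier Ω) = 0) (hΩ : IsOpen Ω)
    (hΩb : Bornology.IsBounded Ω) {μ : Measure (Rd d)} [IsFiniteMeasure μ]
    {ν : VectorMeasure (Rd d) (Rd d)} (hμΩ : μ (closure Ω)ᶜ = 0)
    (hνΩ : ν.variation (closure Ω)ᶜ = 0) (hadm : IsAdmissible M μ)
    {η : ℕ → ℝ} (hη0 : ∀ n, 0 < η n) (hη : Tendsto η atTop (𝓝 0)) :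
    actionFunctional M m Ω μ ν ≤ liminf (fun n => ∫⁻ x, actionDensity M m
      (mollDensity k (η n) μ x) (mollMomentum k (η n) ν x)) atTop := by
  -- Any `A` above the limit inferior bounds the mollified actions frequently, which is all that the
  -- duality estimate requires.
  refine le_of_forall_gt_imp_ge_of_dense fun A hA => ?_
  by_cases hAt : A = ⊤
  · rw [hAt]; exact le_top
  have hfreq := (frequently_lt_of_liminf_lt (by isBoundedDefault) hA).mono fun n hn => hn.le
  have hK : IsCompact (closure Ω) := hΩb.isCompact_closure
  have hloc := hm.isLocallyFiniteMeasure_mobilityMeasure μ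
  set lam := mobilityMeasure M m μ with hlam
  have : IsFiniteMeasure (lam.restrict (closure Ω)) :=
    ⟨by rw [Measure.restrict_apply_univ]; exact hK.measure_lt_top⟩
  obtain ⟨u, hu, hui, hν, huA⟩ := exists_density_of_sq_integral_le
    (sq_integral_le_restrict hK hνΩ fun b hb hbc =>
      hm.sq_integral_le_of_frequently hk hadm hη0 hη hAt hfreq hb hbc)
  have hmK : MeasurableSet (closure Ω) := isClosed_closure.measurableSet
  have hind : Integrable ((closure Ω).indicator u) lam := (integrable_indicator_iff hmK).2 hui
  have hν' : ν = lam.withDensityᵥ ((closure Ω).indicator u) := by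
    rw [hν]
    ext1 B hB
    rw [withDensityᵥ_apply hui hB, withDensityᵥ_apply hind hB, setIntegral_indicator hmK,
      Measure.restrict_restrict hB]
  rw [hm.actionFunctional_eq hfr hΩ hμΩ hνΩ hadm (hu.indicator hmK) hind hν']
  refine le_trans (le_of_eq ?_) huA
  rw [← lintegral_indicator hmK]
  refine lintegral_congr fun x => ?_
  by_cases hx : x ∈ closure Ω <;> simp [hx]

end RieszDensity

/-! ### Measurable families of measures -/

section MeasurableFamilies

open ProbabilityTheory

variable {α β : Type*} [MeasurableSpace α] [MeasurableSpace β]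

/-- The positive part of a measurable family of signed measures is measurable. -/
lemma measurable_jordan_posPart [MeasurableSpace.CountablyGenerated β] {σ : α → SignedMeasure β}
    (h : ∀ B, MeasurableSet B → Measurable fun a => σ a B) :
    Measurable fun a => (σ a).toJordanDecomposition.posPart := by
  refine Measure.measurable_of_measurable_coe _ fun B hB => ?_
  set 𝒞 := MeasurableSpace.countableGeneratingSet β
  set 𝒜 := generateSetAlgebra 𝒞 with h𝒜
  have hcount : 𝒜.Countable := countable_generateSetAlgebra
    (MeasurableSpace.countable_countableGeneratingSet)
  have halg : IsSetAlgebra 𝒜 := isSetAlgebra_generateSetAlgebra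
  have hgen : ‹MeasurableSpace β› = MeasurableSpace.generateFrom 𝒜 := by
    rw [generateFrom_generateSetAlgebra_eq, MeasurableSpace.generateFrom_countableGeneratingSet]
  have hmA : ∀ A ∈ 𝒜, MeasurableSet A := fun A hA => by
    rw [hgen]; exact MeasurableSpace.measurableSet_generateFrom hA
  -- The positive part is the supremum of `σ(A ∩ B)` over measurable `A`, attained at a Hahn set. A
  -- countable generating algebra approximates that set for both Jordan parts at once, so a
  -- countable supremum suffices.
  have key : ∀ a, (σ a).toJordanDecomposition.posPart B =
      ⨆ A : 𝒜, ENNReal.ofReal (σ a (A ∩ B)) := by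
    intro a
    set j := (σ a).toJordanDecomposition with hj
    have hσ : ∀ C, MeasurableSet C → σ a C = j.posPart.real C - j.negPart.real C := by
      intro C hC
      conv_lhs => rw [← SignedMeasure.toSignedMeasure_toJordanDecomposition (σ a)]
      rw [JordanDecomposition.toSignedMeasure, Measure.toSignedMeasure_sub_apply hC]
    refine le_antisymm ?_ (iSup_le fun A => ?_)
    · obtain ⟨S, hS, hpS, hnS⟩ := j.mutuallySingular
      refine ENNReal.le_of_forall_pos_le_add fun e he _ => ?_
      obtain ⟨A, hA, hAe⟩ := (Measure.MeasureDense.of_generateFrom_isSetAlgebra_finite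
        (μ := j.posPart + j.negPart) halg hgen).approx Sᶜ hS.compl (measure_ne_top _ _)
          (e / 2) (by positivity)
      have hAm := hmA A hA
      have h1 : j.posPart Aᶜ ≤ ENNReal.ofReal (e / 2) := by
        have : j.posPart Aᶜ ≤ j.posPart (symmDiff Sᶜ A) + j.posPart S := by
          refine (measure_mono ?_).trans (measure_union_le _ _)
          intro x hx
          by_cases hxS : x ∈ S
          · exact Or.inr hxS
          · exact Or.inl (Or.inl ⟨hxS, hx⟩)
        rw [hpS, add_zero] at this
        exact this.trans ((Measure.le_add_right le_rfl _).trans hAe.le)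
      have h2 : j.negPart A ≤ ENNReal.ofReal (e / 2) := by
        have : j.negPart A ≤ j.negPart (symmDiff Sᶜ A) + j.negPart Sᶜ := by
          refine (measure_mono ?_).trans (measure_union_le _ _)
          intro x hx
          by_cases hxS : x ∈ S
          · exact Or.inl (Or.inr ⟨hx, fun h => h hxS⟩)
          · exact Or.inr hxS
        rw [hnS, add_zero] at this
        exact this.trans ((Measure.le_add_left le_rfl _).trans hAe.le)
      have h3 : j.posPart.real B ≤ σ a (A ∩ B) + e := by
        rw [hσ _ (hAm.inter hB)]
        have h4 : j.posPart.real B ≤ j.posPart.real (A ∩ B) + j.posPart.real Aᶜ := by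
          refine (measureReal_mono ?_).trans (measureReal_union_le _ _)
          intro x hx
          by_cases hxA : x ∈ A
          · exact Or.inl ⟨hxA, hx⟩
          · exact Or.inr hxA
        have h5 : j.negPart.real (A ∩ B) ≤ j.negPart.real A :=
          measureReal_mono inter_subset_left
        have h6 : j.posPart.real Aᶜ ≤ e / 2 :=
          ENNReal.toReal_le_of_le_ofReal (by positivity) h1
        have h7 : j.negPart.real A ≤ e / 2 :=
          ENNReal.toReal_le_of_le_ofReal (by positivity) h2
        linarith
      calc j.posPart B = ENNReal.ofReal (j.posPart.real B) := by
            rw [ofReal_measureReal]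
        _ ≤ ENNReal.ofReal (σ a (A ∩ B) + e) := ENNReal.ofReal_le_ofReal h3
        _ ≤ ENNReal.ofReal (σ a (A ∩ B)) + ENNReal.ofReal e := ENNReal.ofReal_add_le
        _ ≤ _ := by
            rw [ENNReal.ofReal_coe_nnreal]
            gcongr
            exact le_iSup (fun A : 𝒜 => ENNReal.ofReal (σ a (A ∩ B))) ⟨A, hA⟩
    · have hAm := hmA A A.2
      rw [hσ _ (hAm.inter hB)]
      calc ENNReal.ofReal (j.posPart.real (A ∩ B) - j.negPart.real (A ∩ B))
          ≤ ENNReal.ofReal (j.posPart.real (A ∩ B)) :=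
            ENNReal.ofReal_le_ofReal (sub_le_self _ measureReal_nonneg)
        _ = j.posPart (A ∩ B) := ofReal_measureReal
        _ ≤ j.posPart B := measure_mono inter_subset_right
  simp_rw [key]
  have : Countable 𝒜 := hcount
  exact Measurable.iSup fun A => (h _ ((hmA A A.2).inter hB)).ennreal_ofReal

lemma measurable_jordan_negPart [MeasurableSpace.CountablyGenerated β] {σ : α → SignedMeasure β}
    (h : ∀ B, MeasurableSet B → Measurable fun a => σ a B) :
    Measurable fun a => (σ a).toJordanDecomposition.negPart := by
  have h1 := measurable_jordan_posPart (σ := fun a => -σ a) fun B hB => (h B hB).neg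
  simpa [SignedMeasure.toJordanDecomposition_neg] using h1

/-- A kernel of finite measures is s-finite. -/
lemma isSFiniteKernel_of_isFiniteMeasure (κ : Kernel α β) [∀ a, IsFiniteMeasure (κ a)] :
    IsSFiniteKernel κ := by
  have hmass : Measurable fun a => κ a univ := κ.measurable_coe MeasurableSet.univ
  -- Normalising by the mass gives a finite kernel, from which the original one is recovered by a
  -- finite density; where the mass is zero both vanish.
  let κ' : Kernel α β := ⟨fun a => (κ a univ)⁻¹ • κ a, by
    refine Measure.measurable_of_measurable_coe _ fun B hB => ?_
    exact hmass.inv.mul (κ.measurable_coe hB)⟩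
  have hκ' : ∀ a, κ' a = (κ a univ)⁻¹ • κ a := fun _ => rfl
  have : IsFiniteKernel κ' := ⟨1, ENNReal.one_lt_top, fun a => by
    rw [hκ', Measure.smul_apply, smul_eq_mul]
    exact ENNReal.inv_mul_le_one _⟩
  have h2 : Kernel.withDensity κ' (fun a _ => κ a univ) = κ := by
    ext1 a
    rw [Kernel.withDensity_apply _ (show Measurable (Function.uncurry fun a (_ : β) => κ a univ) from
      hmass.comp measurable_fst), withDensity_const, hκ', smul_smul]
    by_cases h0 : κ a univ = 0
    · rw [Measure.measure_univ_eq_zero.1 h0, smul_zero]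
    · rw [ENNReal.mul_inv_cancel h0 (measure_ne_top _ _), one_smul]
  rw [← h2]
  exact Kernel.IsSFiniteKernel.withDensity _ fun a _ => measure_ne_top _ _

/-- A family of measures carried by a compact set, with measurable integrals of compactly supported
continuous functions, is measurable. -/
lemma measurable_of_measurable_integral {d : ℕ} {μ : α → Measure (Rd d)}
    (hfin : ∀ a, IsFiniteMeasure (μ a)) {K : Set (Rd d)} (hK : IsCompact K)
    (hμK : ∀ a, μ a Kᶜ = 0)
    (h : ∀ f : Rd d → ℝ, Continuous f → HasCompactSupport f →
      Measurable fun a => ∫ x, f x ∂μ a) : Measurable μ := by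
  -- A cutoff equal to one on `K` makes bounded continuous functions compactly supported without
  -- changing their integrals.
  obtain ⟨ξ, hξ1, -, hξc, hξ01⟩ := exists_continuous_one_zero_of_isCompact hK isClosed_empty
    (disjoint_empty K)
  have hξcs : HasCompactSupport ξ := hξc
  have hb : ∀ f : BoundedContinuousFunction (Rd d) NNReal,
      Measurable fun a => ∫⁻ x, f x ∂μ a := by
    intro f
    have hc : Continuous fun x => (f x : ℝ) * ξ x :=
      (NNReal.continuous_coe.comp f.continuous).mul ξ.continuous
    have h1 := (h _ hc hξcs.mul_left).ennreal_ofReal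
    convert h1 using 2 with a
    have := hfin a
    have hae : ∀ᵐ x ∂μ a, ξ x = 1 := by
      have h2 : ∀ᵐ x ∂μ a, x ∈ K := hμK a
      exact h2.mono fun x hx => hξ1 hx
    rw [ofReal_integral_eq_lintegral_ofReal (hc.integrable_of_hasCompactSupport hξcs.mul_left)
      (Eventually.of_forall fun x => mul_nonneg (NNReal.coe_nonneg _) (hξ01 x).1)]
    refine lintegral_congr_ae (hae.mono fun x hx => ?_)
    simp [hx]
  have hcl : ∀ F : Set (Rd d), IsClosed F → Measurable fun a => μ a F := by
    intro F hF
    refine measurable_of_tendsto_metrizable (fun n => hb (hF.apprSeq n)) ?_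
    rw [tendsto_pi_nhds]
    exact fun a => HasOuterApproxClosed.tendsto_lintegral_apprSeq hF (μ a)
  refine Measurable.measure_of_isPiSystem (S := {F | IsClosed F}) ?_ isPiSystem_isClosed
    (fun F hF => hcl F hF) (hcl univ isClosed_univ)
  rw [← borel_eq_generateFrom_isClosed]
  exact BorelSpace.measurable_eq

end MeasurableFamilies

/-! ### Space-time mollification -/

section TimeKernel

/-- A smooth bump function on the real line supported in `[-ε, ε]`. -/
noncomputable def timeBump (ε : ℝ) : ContDiffBump (0 : ℝ) where
  -- For `ε ≤ 0` the outer radius is set to `1`, merely to have a bump function for every real `ε`.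
  rIn := (if 0 < ε then ε else 1) / 2
  rOut := if 0 < ε then ε else 1
  rIn_pos := by split_ifs <;> linarith
  rIn_lt_rOut := by split_ifs <;> linarith

/-- A smooth nonnegative kernel on the real line with integral `1` and support in `[-ε, ε]`. -/
noncomputable def timeKernel (ε : ℝ) : ℝ → ℝ := (timeBump ε).normed volume

lemma timeKernel_contDiff (ε : ℝ) : ContDiff ℝ ∞ (timeKernel ε) := (timeBump ε).contDiff_normed

lemma timeKernel_continuous (ε : ℝ) : Continuous (timeKernel ε) := (timeBump ε).continuous_normed

lemma timeKernel_nonneg (ε t : ℝ) : 0 ≤ timeKernel ε t := (timeBump ε).nonneg_normed t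

lemma timeKernel_hasCompactSupport (ε : ℝ) : HasCompactSupport (timeKernel ε) :=
  (timeBump ε).hasCompactSupport_normed

lemma integral_timeKernel (ε : ℝ) : ∫ t, timeKernel ε t = 1 := (timeBump ε).integral_normed

lemma integrable_timeKernel (ε : ℝ) : Integrable (timeKernel ε) := (timeBump ε).integrable_normed

lemma integrable_timeKernel_sub (ε t : ℝ) : Integrable fun s => timeKernel ε (t - s) :=
  (integrable_timeKernel ε).comp_sub_left t

lemma integral_timeKernel_sub (ε t : ℝ) : ∫ s, timeKernel ε (t - s) = 1 := by
  rw [integral_sub_left_eq_self (timeKernel ε) volume t, integral_timeKernel]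

lemma integral_timeKernel_sub_right (ε s : ℝ) : ∫ t, timeKernel ε (t - s) = 1 := by
  rw [integral_sub_right_eq_self (timeKernel ε) s, integral_timeKernel]

lemma timeKernel_eq_zero {ε : ℝ} (hε : 0 < ε) {t : ℝ} (ht : ε ≤ |t|) : timeKernel ε t = 0 := by
  have h : t ∉ Function.support (timeKernel ε) := by
    rw [timeKernel, ContDiffBump.support_normed_eq, Metric.mem_ball, dist_zero_right]
    simpa [timeBump, hε] using ht
  exact Function.notMem_support.1 h

/-- The factor `2` is the ratio of the outer to the inner radius of the bump, to the power of the
dimension, which is one. -/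
lemma timeKernel_le {ε : ℝ} (hε : 0 < ε) (t s : ℝ) :
    timeKernel ε s ≤ 2 / volume.real (Metric.closedBall t ε) := by
  have h := (timeBump ε).normed_le_div_measure_closedBall_rOut (μ := volume) 2
    (by simp only [timeBump]; linarith) s
  have h1 : (timeBump ε).rOut = ε := by simp [timeBump, hε]
  rw [h1] at h
  simpa [timeKernel, Real.volume_real_closedBall hε.le] using h

/-- Lebesgue differentiation along the time kernels. -/
lemma ae_tendsto_integral_timeKernel {g : ℝ → ℝ} (hg : LocallyIntegrable g) :
    ∀ᵐ s, ∀ ε t : ℕ → ℝ, (∀ n, 0 < ε n) → Tendsto ε atTop (𝓝 0) → (∀ n, |t n - s| ≤ ε n) →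
      Tendsto (fun n => ∫ r, timeKernel (ε n) (t n - r) * g r) atTop (𝓝 (g s)) := by
  -- Differentiation along balls that contain `s` without being centred there: the time change moves
  -- the centre of the kernel by up to `ε`.
  filter_upwards [IsUnifLocDoublingMeasure.ae_tendsto_average_norm_sub volume hg 1]
    with s hs ε t hε0 hε ht
  have h1 := hs t ε (tendsto_nhdsWithin_iff.2 ⟨hε, Eventually.of_forall hε0⟩)
    (Eventually.of_forall fun n => by
      rw [one_mul, Metric.mem_closedBall, dist_comm, Real.dist_eq]; exact ht n)
  rw [← tendsto_sub_nhds_zero_iff]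
  refine squeeze_zero_norm (fun n => ?_) (by simpa using h1.const_mul 2)
  have hmB : MeasurableSet (Metric.closedBall (t n) (ε n)) :=
    Metric.isClosed_closedBall.measurableSet
  have hgB : IntegrableOn g (Metric.closedBall (t n) (ε n)) :=
    hg.integrableOn_isCompact (isCompact_closedBall _ _)
  have hout : ∀ r ∉ Metric.closedBall (t n) (ε n), timeKernel (ε n) (t n - r) = 0 := by
    intro r hr
    refine timeKernel_eq_zero (hε0 n) ?_
    rw [Metric.mem_closedBall, dist_comm, Real.dist_eq] at hr
    exact (not_le.1 hr).le
  have hi : Integrable fun r => timeKernel (ε n) (t n - r) * g r := by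
    have : (fun r => timeKernel (ε n) (t n - r) * g r) =
        (Metric.closedBall (t n) (ε n)).indicator fun r => timeKernel (ε n) (t n - r) * g r := by
      ext r
      by_cases hr : r ∈ Metric.closedBall (t n) (ε n)
      · rw [indicator_of_mem hr]
      · rw [indicator_of_notMem hr, hout r hr, zero_mul]
    rw [this, integrable_indicator_iff hmB]
    refine hgB.bdd_mul (c := 2 / volume.real (Metric.closedBall (t n) (ε n)))
      ((timeKernel_continuous _).comp (continuous_const.sub continuous_id)).aestronglyMeasurable
      (Eventually.of_forall fun r => ?_)
    rw [Real.norm_of_nonneg (timeKernel_nonneg _ _)]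
    exact timeKernel_le (hε0 n) _ _
  have h2 : (∫ r, timeKernel (ε n) (t n - r) * g r) - g s =
      ∫ r, timeKernel (ε n) (t n - r) * (g r - g s) := by
    simp_rw [mul_sub]
    rw [integral_sub hi ((integrable_timeKernel_sub _ _).mul_const _), integral_mul_const,
      integral_timeKernel_sub, one_mul]
  rw [h2]
  calc _ ≤ ∫ r, (Metric.closedBall (t n) (ε n)).indicator (fun r =>
        2 / volume.real (Metric.closedBall (t n) (ε n)) * ‖g r - g s‖) r := by
        refine norm_integral_le_of_norm_le ?_ (Eventually.of_forall fun r => ?_)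
        · refine IntegrableOn.integrable_indicator ?_ hmB
          have : IsFiniteMeasure (volume.restrict (Metric.closedBall (t n) (ε n))) :=
            ⟨by rw [Measure.restrict_apply_univ]; exact measure_closedBall_lt_top⟩
          exact ((hgB.sub (integrable_const _)).norm).const_mul _
        · rw [norm_mul, Real.norm_of_nonneg (timeKernel_nonneg _ _)]
          by_cases hr : r ∈ Metric.closedBall (t n) (ε n)
          · rw [indicator_of_mem hr]
            exact mul_le_mul_of_nonneg_right (timeKernel_le (hε0 n) _ _) (norm_nonneg _)
          · rw [indicator_of_notMem hr, hout r hr, zero_mul]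
    _ = _ := by
        rw [integral_indicator hmB, integral_const_mul, setAverage_eq, smul_eq_mul, div_eq_mul_inv,
          mul_assoc]
        rfl

end TimeKernel

/-! ### Mollification in time and space of a measurable family of measures -/

section SpaceTime

open scoped Pointwise

open ProbabilityTheory

variable {d : ℕ} {k : Rd d → ℝ}

/-- The space-time mollification kernel. -/
noncomputable def spaceTimeKernel (k : Rd d → ℝ) (ε : ℝ) (z : ℝ × Rd d) : ℝ :=
  timeKernel ε z.1 * rescaledKernel k ε z.2

/-- The space-time mollification of a measure. -/
noncomputable def spaceTimeMoll (k : Rd d → ℝ) (ε : ℝ) (N : Measure (ℝ × Rd d)) (z : ℝ × Rd d) :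
    ℝ :=
  ∫ z', spaceTimeKernel k ε (z - z') ∂N

variable (hk : IsKernel k) {ε : ℝ}
include hk

lemma IsKernel.spaceTimeKernel_contDiff (ε : ℝ) : ContDiff ℝ ∞ (spaceTimeKernel k ε) :=
  ((timeKernel_contDiff ε).comp contDiff_fst).mul ((hk.rescaledKernel_smooth ε).comp contDiff_snd)

lemma IsKernel.spaceTimeKernel_hasCompactSupport (hε : 0 < ε) :
    HasCompactSupport (spaceTimeKernel k ε) := by
  refine HasCompactSupport.intro
    ((timeKernel_hasCompactSupport ε).isCompact.prod (hk.rescaledKernel_hasCompactSupport hε))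
    fun z hz => ?_
  rw [mem_prod, not_and_or] at hz
  rcases hz with hz | hz
  · rw [spaceTimeKernel, image_eq_zero_of_notMem_tsupport hz, zero_mul]
  · rw [spaceTimeKernel, image_eq_zero_of_notMem_tsupport hz, mul_zero]

lemma IsKernel.spaceTimeKernel_nonneg (hε : 0 < ε) (z : ℝ × Rd d) : 0 ≤ spaceTimeKernel k ε z :=
  mul_nonneg (timeKernel_nonneg _ _) (hk.rescaledKernel_nonneg hε _)

lemma spaceTimeMoll_nonneg (hε : 0 < ε) (N : Measure (ℝ × Rd d)) (z : ℝ × Rd d) :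
    0 ≤ spaceTimeMoll k ε N z :=
  integral_nonneg fun _ => hk.spaceTimeKernel_nonneg hε _

omit hk in
lemma spaceTimeMoll_eq_convolution (N : Measure (ℝ × Rd d)) :
    spaceTimeMoll k ε N =
      MeasureTheory.convolution (fun _ => (1 : ℝ)) (spaceTimeKernel k ε)
        (ContinuousLinearMap.lsmul ℝ ℝ) N := by
  ext z
  simp [spaceTimeMoll, convolution_def]

lemma IsKernel.spaceTimeMoll_contDiff (hε : 0 < ε) (N : Measure (ℝ × Rd d))
    [IsLocallyFiniteMeasure N] : ContDiff ℝ ∞ (spaceTimeMoll k ε N) := by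
  rw [spaceTimeMoll_eq_convolution]
  exact (hk.spaceTimeKernel_hasCompactSupport hε).contDiff_convolution_right _
    (locallyIntegrable_const _) (hk.spaceTimeKernel_contDiff ε)

lemma IsKernel.fderiv_spaceTimeMoll (hε : 0 < ε) (N : Measure (ℝ × Rd d))
    [IsLocallyFiniteMeasure N] (z v : ℝ × Rd d) :
    fderiv ℝ (spaceTimeMoll k ε N) z v = ∫ z', fderiv ℝ (spaceTimeKernel k ε) (z - z') v ∂N := by
  have hcs := hk.spaceTimeKernel_hasCompactSupport hε
  have hs : ContDiff ℝ 1 (spaceTimeKernel k ε) := (hk.spaceTimeKernel_contDiff ε).of_le (by simp)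
  have hD : Continuous (fderiv ℝ (spaceTimeKernel k ε)) := hs.continuous_fderiv one_ne_zero
  obtain ⟨C, hC⟩ := hD.bounded_above_of_compact_support (hcs.fderiv ℝ)
  -- For centres within distance one of `z`, the kernel sees only points of this compact set. It has
  -- finite mass, so a constant on it is an integrable bound.
  set K' := Metric.closedBall z 1 - tsupport (spaceTimeKernel k ε) with hK'd
  have hK' : IsCompact K' := by
    rw [hK'd, sub_eq_add_neg]; exact (isCompact_closedBall z 1).add hcs.isCompact.neg
  have hDi : Integrable (fun z' => fderiv ℝ (spaceTimeKernel k ε) (z - z')) N :=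
    (hD.comp (continuous_const.sub continuous_id)).integrable_of_hasCompactSupport
      ((hcs.fderiv ℝ).comp_homeomorph (Homeomorph.subLeft z))
  have h : HasFDerivAt (spaceTimeMoll k ε N)
      (∫ z', fderiv ℝ (spaceTimeKernel k ε) (z - z') ∂N) z := by
    refine hasFDerivAt_integral_of_dominated_of_fderiv_le (bound := K'.indicator fun _ => C)
      (F' := fun x z' => fderiv ℝ (spaceTimeKernel k ε) (x - z'))
      (Metric.ball_mem_nhds z one_pos) (Eventually.of_forall fun x =>
        (hs.continuous.comp (continuous_const.sub continuous_id)).aestronglyMeasurable)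
      ?_ hDi.1 (Eventually.of_forall fun z' x hx => ?_) ?_
      (Eventually.of_forall fun z' x _ => ?_)
    · exact (hs.continuous.comp (continuous_const.sub
        continuous_id)).integrable_of_hasCompactSupport
        (hcs.comp_homeomorph (Homeomorph.subLeft z))
    · by_cases hz' : z' ∈ K'
      · rw [indicator_of_mem hz']; exact hC _
      · rw [indicator_of_notMem hz']
        have h0 : x - z' ∉ tsupport (spaceTimeKernel k ε) := fun h0 => hz'
          ⟨x, Metric.ball_subset_closedBall hx, x - z', h0, sub_sub_cancel x z'⟩
        have h1 : x - z' ∉ tsupport (fderiv ℝ (spaceTimeKernel k ε)) := fun h1 =>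
          h0 (tsupport_fderiv_subset ℝ h1)
        rw [image_eq_zero_of_notMem_tsupport h1, norm_zero]
    · rw [integrable_indicator_iff hK'.measurableSet]
      exact integrableOn_const hK'.measure_lt_top.ne
    · have h2 := (hs.differentiable one_ne_zero).differentiableAt.hasFDerivAt (x := x - z')
      simpa using! h2.comp x ((hasFDerivAt_id x).sub (hasFDerivAt_const z' x))
  rw [h.fderiv, ContinuousLinearMap.integral_apply hDi]

lemma IsKernel.integrable_spaceTimeKernel (hε : 0 < ε) (N : Measure (ℝ × Rd d))
    [IsLocallyFiniteMeasure N] (z : ℝ × Rd d) :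
    Integrable (fun z' => spaceTimeKernel k ε (z - z')) N := by
  refine ((hk.spaceTimeKernel_contDiff ε).continuous.comp
    (continuous_const.sub continuous_id)).integrable_of_hasCompactSupport ?_
  exact (hk.spaceTimeKernel_hasCompactSupport hε).comp_homeomorph (Homeomorph.subLeft z)

omit hk in
lemma isLocallyFiniteMeasure_compProd {κ : Kernel ℝ (Rd d)} [IsSFiniteKernel κ]
    [∀ s, IsFiniteMeasure (κ s)] (hloc : LocallyIntegrable fun s => (κ s).real univ) :
    IsLocallyFiniteMeasure ((volume : Measure ℝ) ⊗ₘ κ) := by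
  refine ⟨fun z => ⟨Ioo (z.1 - 1) (z.1 + 1) ×ˢ univ,
    prod_mem_nhds (Ioo_mem_nhds (by linarith) (by linarith)) univ_mem, ?_⟩⟩
  rw [Measure.compProd_apply_prod measurableSet_Ioo MeasurableSet.univ]
  have h1 : IntegrableOn (fun s => (κ s).real univ) (Ioo (z.1 - 1) (z.1 + 1)) :=
    (hloc.integrableOn_isCompact isCompact_Icc).mono_set Ioo_subset_Icc_self
  have h2 := h1.2
  rw [hasFiniteIntegral_iff_ofReal (Eventually.of_forall fun _ => measureReal_nonneg)] at h2
  simpa [ofReal_measureReal] using h2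

variable {κ : Kernel ℝ (Rd d)} [IsSFiniteKernel κ] [∀ s, IsFiniteMeasure (κ s)]
  (hloc : LocallyIntegrable fun s => (κ s).real univ)

lemma IsKernel.stronglyMeasurable_mollDensity_kernel (κ : Kernel ℝ (Rd d)) [IsSFiniteKernel κ]
    (ε : ℝ) : StronglyMeasurable fun p : ℝ × Rd d => mollDensity k ε (κ p.1) p.2 := by
  let κ' : Kernel (ℝ × Rd d) (Rd d) := Kernel.prodMkRight (Rd d) κ
  have h : StronglyMeasurable fun q : (ℝ × Rd d) × Rd d => rescaledKernel k ε (q.1.2 - q.2) :=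
    ((hk.rescaledKernel_continuous ε).comp
      ((continuous_snd.comp continuous_fst).sub continuous_snd)).stronglyMeasurable
  exact h.integral_kernel_prod_right' (κ := κ')

include hloc

lemma IsKernel.spaceTimeMoll_eq_integral (hε : 0 < ε) (t : ℝ) (x : Rd d) :
    spaceTimeMoll k ε (volume ⊗ₘ κ) (t, x) =
      ∫ s, timeKernel ε (t - s) * mollDensity k ε (κ s) x := by
  have := isLocallyFiniteMeasure_compProd hloc
  rw [spaceTimeMoll, Measure.integral_compProd (hk.integrable_spaceTimeKernel hε _ _)]
  refine integral_congr_ae (Eventually.of_forall fun s => ?_)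
  exact integral_const_mul (timeKernel ε (t - s)) _

omit hk [IsSFiniteKernel κ] [∀ s, IsFiniteMeasure (κ s)] in
lemma integrable_timeKernel_mul {g : ℝ → ℝ} (hg : AEStronglyMeasurable g) {C : ℝ}
    (hgC : ∀ s, |g s| ≤ C * (κ s).real univ) (ε t : ℝ) :
    Integrable fun s => timeKernel ε (t - s) * g s := by
  have hcs : HasCompactSupport fun s => timeKernel ε (t - s) :=
    (timeKernel_hasCompactSupport ε).comp_homeomorph (Homeomorph.subLeft t)
  have hc : Continuous fun s => timeKernel ε (t - s) :=
    (timeKernel_continuous ε).comp (continuous_const.sub continuous_id)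
  have h1 : Integrable fun s => timeKernel ε (t - s) * (C * (κ s).real univ) := by
    exact (hloc.smul C).integrable_smul_left_of_hasCompactSupport hc hcs
  refine h1.mono' (hc.aestronglyMeasurable.mul hg) (Eventually.of_forall fun s => ?_)
  rw [norm_mul, Real.norm_of_nonneg (timeKernel_nonneg _ _)]
  exact mul_le_mul_of_nonneg_left (hgC s) (timeKernel_nonneg _ _)

lemma IsKernel.integrable_timeKernel_mul_mollDensity (hε : 0 < ε) (t : ℝ) (x : Rd d) :
    Integrable fun s => timeKernel ε (t - s) * mollDensity k ε (κ s) x := by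
  obtain ⟨C, h0, hC⟩ := hk.rescaledKernel_exists_le hε
  refine integrable_timeKernel_mul hloc (C := C)
    ((hk.stronglyMeasurable_mollDensity_kernel κ ε).comp_measurable
      measurable_prodMk_right).aestronglyMeasurable (fun s => ?_) ε t
  rw [← Real.norm_eq_abs]
  refine norm_integral_le_of_norm_le_const (μ := κ s) (Eventually.of_forall fun y => ?_)
  rw [Real.norm_of_nonneg (hk.rescaledKernel_nonneg hε _)]
  exact hC _

omit hloc in
lemma IsKernel.spaceTimeMoll_eq_zero (hε : 0 < ε) {K : Set (Rd d)}
    (hκK : ∀ s, κ s Kᶜ = 0) {t : ℝ} {x : Rd d} (hx : ε < Metric.infDist x K)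
    (hloc : LocallyIntegrable fun s => (κ s).real univ) :
    spaceTimeMoll k ε (volume ⊗ₘ κ) (t, x) = 0 := by
  rw [hk.spaceTimeMoll_eq_integral hloc hε]
  have h : ∀ s, mollDensity k ε (κ s) x = 0 := by
    intro s
    have hae : ∀ᵐ y ∂κ s, y ∈ K := hκK s
    rw [mollDensity, integral_congr_ae (g := fun _ => 0) (hae.mono fun y hy => ?_), integral_zero]
    refine hk.rescaledKernel_eq_zero hε ?_
    rw [← dist_eq_norm]
    exact hx.trans_le (Metric.infDist_le_dist_of_mem hy)
  simp [h]

lemma IsKernel.integral_mul_spaceTimeMoll (hε : 0 < ε) (t : ℝ) {f : Rd d → ℝ}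
    (hf : Continuous f) {C : ℝ} (hC : ∀ x, |f x| ≤ C) :
    ∫ x, f x * spaceTimeMoll k ε (volume ⊗ₘ κ) (t, x) =
      ∫ s, timeKernel ε (t - s) * ∫ x, f x * mollDensity k ε (κ s) x := by
  simp_rw [hk.spaceTimeMoll_eq_integral hloc hε, ← integral_const_mul]
  rw [integral_integral_swap]
  · refine integral_congr_ae (Eventually.of_forall fun s => ?_)
    refine integral_congr_ae (Eventually.of_forall fun x => ?_)
    simp only; ring
  · have hsm : StronglyMeasurable fun p : Rd d × ℝ =>
        f p.1 * (timeKernel ε (t - p.2) * mollDensity k ε (κ p.2) p.1) :=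
      (hf.comp continuous_fst).stronglyMeasurable.mul
        (((timeKernel_continuous ε).comp (continuous_const.sub continuous_snd)).stronglyMeasurable.mul
          ((hk.stronglyMeasurable_mollDensity_kernel κ ε).comp_measurable measurable_swap))
    refine (integrable_prod_iff' hsm.aestronglyMeasurable).2
      ⟨Eventually.of_forall fun s => ?_, ?_⟩
    · exact ((hk.integrable_mollDensity hε (κ s)).const_mul (timeKernel ε (t - s))).bdd_mul (c := C)
        hf.aestronglyMeasurable (Eventually.of_forall hC)
    · have hbound : ∀ s, ∫ x, ‖f x * (timeKernel ε (t - s) * mollDensity k ε (κ s) x)‖ =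
          timeKernel ε (t - s) * ∫ x, ‖f x * mollDensity k ε (κ s) x‖ := by
        intro s
        rw [← integral_const_mul]
        refine integral_congr_ae (Eventually.of_forall fun x => ?_)
        simp only [norm_mul, Real.norm_of_nonneg (timeKernel_nonneg _ _)]
        ring
      simp_rw [hbound]
      refine integrable_timeKernel_mul hloc (C := C) ?_ (fun s => ?_) ε t
      · refine StronglyMeasurable.aestronglyMeasurable ?_
        exact (((hf.comp continuous_snd).stronglyMeasurable.mul
          (hk.stronglyMeasurable_mollDensity_kernel κ ε)).norm).integral_prod_right'
      · rw [abs_of_nonneg (integral_nonneg fun _ => norm_nonneg _)]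
        have hmass : ∫ x, mollDensity k ε (κ s) x = (κ s).real univ := by
          rw [integral_eq_lintegral_of_nonneg_ae (Eventually.of_forall fun x =>
            mollDensity_nonneg hk hε _ x) (hk.continuous_mollDensity hε _).aestronglyMeasurable,
            lintegral_ofReal_mollDensity hk hε]
          rfl
        rw [← hmass, ← integral_const_mul]
        refine integral_mono_of_nonneg (Eventually.of_forall fun _ => norm_nonneg _)
          ((hk.integrable_mollDensity hε _).const_mul _) (Eventually.of_forall fun x => ?_)
        simp only [norm_mul, Real.norm_of_nonneg (mollDensity_nonneg hk hε _ x)]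
        exact mul_le_mul_of_nonneg_right (hC x) (mollDensity_nonneg hk hε _ x)

/-- Space-time mollifications converge to the measure, tested against continuous functions, at
almost every time. -/
lemma IsKernel.ae_tendsto_integral_mul_spaceTimeMoll {f : Rd d → ℝ} (hf : UniformContinuous f)
    {C : ℝ} (hC : ∀ x, |f x| ≤ C) :
    ∀ᵐ s, ∀ ε t : ℕ → ℝ, (∀ n, 0 < ε n) → Tendsto ε atTop (𝓝 0) → (∀ n, |t n - s| ≤ ε n) →
      Tendsto (fun n => ∫ x, f x * spaceTimeMoll k (ε n) (volume ⊗ₘ κ) (t n, x)) atTop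
        (𝓝 (∫ x, f x ∂κ s)) := by
  have hFm : StronglyMeasurable fun s => ∫ x, f x ∂κ s :=
    (hf.continuous.comp continuous_snd).stronglyMeasurable.integral_kernel_prod_right'
      (f := fun p : ℝ × Rd d => f p.2)
  have hFC : ∀ s, |∫ x, f x ∂κ s| ≤ C * (κ s).real univ := fun s =>
    norm_integral_le_of_norm_le_const (f := f) (μ := κ s) (Eventually.of_forall hC)
  have hFloc : LocallyIntegrable fun s => ∫ x, f x ∂κ s :=
    (hloc.smul C).mono hFm.aestronglyMeasurable (Eventually.of_forall fun s =>
      (hFC s).trans (le_abs_self _))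
  filter_upwards [ae_tendsto_integral_timeKernel hFloc, ae_tendsto_integral_timeKernel hloc]
    with s h1 h2 ε t hε0 hε ht
  have h1' := h1 ε t hε0 hε ht
  have h2' := h2 ε t hε0 hε ht
  simp_rw [hk.integral_mul_spaceTimeMoll hloc (hε0 _) _ hf.continuous hC]
  rw [← tendsto_sub_nhds_zero_iff] at h1' ⊢
  -- The error of the space mollification is at most a small constant times the mass, uniformly over
  -- measures. After averaging in time, what remains is the averaged mass, which converges at `s`.
  -- The outer time average is treated by Lebesgue differentiation.
  have hdiff : Tendsto (fun n => (∫ r, timeKernel (ε n) (t n - r) *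
      ∫ x, f x * mollDensity k (ε n) (κ r) x) -
      ∫ r, timeKernel (ε n) (t n - r) * ∫ x, f x ∂κ r) atTop (𝓝 0) := by
    rw [Metric.tendsto_nhds]
    intro e he
    have hV : 0 ≤ (κ s).real univ := measureReal_nonneg
    obtain ⟨δ, hδ, h⟩ := hk.exists_integral_mul_mollDensity_sub_le hf hC
      (show 0 < e / ((κ s).real univ + 1) by positivity)
    filter_upwards [hε.eventually_lt_const hδ, h2'.eventually_lt_const
      (show (κ s).real univ < (κ s).real univ + 1 by linarith)] with n hn hn2
    have hmm : ∀ r, |∫ x, f x * mollDensity k (ε n) (κ r) x| ≤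
        (e / ((κ s).real univ + 1) + C) * (κ r).real univ := by
      intro r
      have := h (ε n) (hε0 n) hn (κ r) inferInstance
      calc _ = |((∫ x, f x * mollDensity k (ε n) (κ r) x) - ∫ x, f x ∂κ r) +
            ∫ x, f x ∂κ r| := by rw [sub_add_cancel]
        _ ≤ _ := by
          rw [add_mul]
          exact (abs_add_le _ _).trans (add_le_add this (hFC r))
    have i1 : Integrable fun r => timeKernel (ε n) (t n - r) *
        ∫ x, f x * mollDensity k (ε n) (κ r) x := by
      refine integrable_timeKernel_mul hloc ?_ hmm (ε n) _
      exact (((hf.continuous.comp continuous_snd).stronglyMeasurable.mul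
          (hk.stronglyMeasurable_mollDensity_kernel κ
            (ε n))).integral_prod_right').aestronglyMeasurable
    have i2 : Integrable fun r => timeKernel (ε n) (t n - r) * ∫ x, f x ∂κ r :=
      integrable_timeKernel_mul hloc hFm.aestronglyMeasurable hFC (ε n) _
    have i3 : Integrable fun r => timeKernel (ε n) (t n - r) * (κ r).real univ := by
      refine integrable_timeKernel_mul hloc (C := 1) hloc.aestronglyMeasurable (fun r => ?_)
        (ε n) _
      rw [one_mul, abs_of_nonneg measureReal_nonneg]
    rw [dist_zero_right, ← integral_sub i1 i2]
    calc _ ≤ ∫ r, e / ((κ s).real univ + 1) *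
          (timeKernel (ε n) (t n - r) * (κ r).real univ) := by
          refine norm_integral_le_of_norm_le (i3.const_mul _) (Eventually.of_forall fun r => ?_)
          rw [← mul_sub, norm_mul, Real.norm_of_nonneg (timeKernel_nonneg _ _), mul_left_comm]
          exact mul_le_mul_of_nonneg_left (h (ε n) (hε0 n) hn (κ r) inferInstance)
            (timeKernel_nonneg _ _)
      _ < e / ((κ s).real univ + 1) * ((κ s).real univ + 1) := by
          rw [integral_const_mul]
          exact mul_lt_mul_of_pos_left hn2 (by positivity)
      _ = e := by field_simp
  have := hdiff.add h1'
  rw [add_zero] at this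
  refine this.congr fun n => ?_
  ring

end SpaceTime

/-! ### Extension of the continuity equation to all times -/

section TimeStep

/-- The primitive of the time kernel. -/
noncomputable def timeStep (ε t : ℝ) : ℝ := ∫ s in (-ε)..t, timeKernel ε s

lemma hasDerivAt_timeStep (ε t : ℝ) : HasDerivAt (timeStep ε) (timeKernel ε t) t :=
  intervalIntegral.integral_hasDerivAt_right ((timeKernel_continuous ε).intervalIntegrable _ _)
    (timeKernel_continuous ε).aestronglyMeasurable.stronglyMeasurableAtFilter
    (timeKernel_continuous ε).continuousAt

lemma timeStep_contDiff (ε : ℝ) : ContDiff ℝ ∞ (timeStep ε) := by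
  refine contDiff_infty_iff_deriv.2 ⟨fun t => (hasDerivAt_timeStep ε t).differentiableAt, ?_⟩
  rw [funext fun t => (hasDerivAt_timeStep ε t).deriv]
  exact timeKernel_contDiff ε

lemma timeStep_of_le {ε t : ℝ} (hε : 0 < ε) (ht : t ≤ -ε) : timeStep ε t = 0 := by
  rw [timeStep, intervalIntegral.integral_zero_ae]
  refine Eventually.of_forall fun s hs => timeKernel_eq_zero hε ?_
  rw [uIoc_of_ge ht] at hs
  rw [abs_of_neg (by linarith [hs.2])]
  linarith [hs.2]

lemma timeStep_of_ge {ε t : ℝ} (hε : 0 < ε) (ht : ε ≤ t) : timeStep ε t = 1 := by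
  rw [timeStep, intervalIntegral.integral_of_le (by linarith), ← integral_timeKernel ε]
  refine setIntegral_eq_integral_of_forall_compl_eq_zero fun s hs => timeKernel_eq_zero hε ?_
  rw [mem_Ioc, not_and_or] at hs
  rcases hs with hs | hs
  · rw [abs_of_neg (by linarith)]; linarith
  · rw [abs_of_pos (by linarith)]; linarith

lemma timeStep_mem {ε : ℝ} (hε : 0 < ε) (t : ℝ) : timeStep ε t ∈ Icc (0 : ℝ) 1 := by
  have hmono : Monotone (timeStep ε) := monotone_of_hasDerivAt_nonneg
    (fun t => hasDerivAt_timeStep ε t) fun t => timeKernel_nonneg ε t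
  constructor
  · rw [← timeStep_of_le hε (min_le_right t (-ε))]; exact hmono (min_le_left _ _)
  · rw [← timeStep_of_ge hε (le_max_right t ε)]; exact hmono (le_max_left _ _)

/-- A smooth approximation of the indicator function of `[a, b]`. -/
noncomputable def timeCutoff (ε a b s : ℝ) : ℝ := timeStep ε (s - a) - timeStep ε (s - b)

lemma timeCutoff_contDiff (ε a b : ℝ) : ContDiff ℝ ∞ (timeCutoff ε a b) :=
  ((timeStep_contDiff ε).comp (contDiff_id.sub contDiff_const)).sub
    ((timeStep_contDiff ε).comp (contDiff_id.sub contDiff_const))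

lemma hasDerivAt_timeCutoff (ε a b s : ℝ) :
    HasDerivAt (timeCutoff ε a b) (timeKernel ε (s - a) - timeKernel ε (s - b)) s :=
  ((hasDerivAt_timeStep ε (s - a)).comp_sub_const s a).sub
    ((hasDerivAt_timeStep ε (s - b)).comp_sub_const s b)

lemma timeCutoff_eq_zero {ε a b s : ℝ} (hε : 0 < ε) (hab : a ≤ b)
    (hs : s ∉ Icc (a - ε) (b + ε)) : timeCutoff ε a b s = 0 := by
  rw [mem_Icc, not_and_or, not_le, not_le] at hs
  rcases hs with hs | hs
  · rw [timeCutoff, timeStep_of_le hε (by linarith), timeStep_of_le hε (by linarith), sub_zero]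
  · rw [timeCutoff, timeStep_of_ge hε (by linarith), timeStep_of_ge hε (by linarith), sub_self]

lemma timeCutoff_eq_one {ε a b s : ℝ} (hε : 0 < ε) (hs : s ∈ Icc (a + ε) (b - ε)) :
    timeCutoff ε a b s = 1 := by
  rw [timeCutoff, timeStep_of_ge hε (by linarith [hs.1]), timeStep_of_le hε (by linarith [hs.2]),
    sub_zero]

lemma abs_timeCutoff_le {ε : ℝ} (hε : 0 < ε) (a b s : ℝ) : |timeCutoff ε a b s| ≤ 1 := by
  have h1 := timeStep_mem hε (s - a)
  have h2 := timeStep_mem hε (s - b)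
  rw [timeCutoff, abs_le]
  constructor <;> linarith [h1.1, h1.2, h2.1, h2.2]

lemma timeCutoff_tsupport {ε a b : ℝ} (hε : 0 < ε) (hab : a ≤ b) :
    tsupport (timeCutoff ε a b) ⊆ Icc (a - ε) (b + ε) :=
  closure_minimal (fun s hs => by
    by_contra hc
    exact hs (timeCutoff_eq_zero hε hab hc)) isClosed_Icc

lemma timeKernel_neg (ε t : ℝ) : timeKernel ε (-t) = timeKernel ε t := (timeBump ε).normed_neg t

lemma timeKernel_sub_comm (ε s t : ℝ) : timeKernel ε (s - t) = timeKernel ε (t - s) := by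
  rw [← timeKernel_neg, neg_sub]

lemma integrable_timeKernel_mul_continuous {g : ℝ → ℝ} (hg : Continuous g) (ε t : ℝ) :
    Integrable fun r => timeKernel ε (t - r) * g r :=
  (((timeKernel_continuous ε).comp (continuous_const.sub continuous_id)).mul
    hg).integrable_of_hasCompactSupport
    (((timeKernel_hasCompactSupport ε).comp_homeomorph (Homeomorph.subLeft t)).mul_right)

lemma tendsto_integral_timeKernel_continuous {g : ℝ → ℝ} (hg : Continuous g) {ε t : ℕ → ℝ} {c : ℝ}
    (hε0 : ∀ n, 0 < ε n) (hε : Tendsto ε atTop (𝓝 0)) (ht : Tendsto t atTop (𝓝 c)) :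
    Tendsto (fun n => ∫ r, timeKernel (ε n) (t n - r) * g r) atTop (𝓝 (g c)) := by
  rw [Metric.tendsto_nhds]
  intro e he
  obtain ⟨δ, hδ, hgδ⟩ := Metric.continuousAt_iff.1 hg.continuousAt (e / 2) (half_pos he)
  filter_upwards [hε.eventually_lt_const (half_pos hδ),
    Metric.tendsto_nhds.1 ht (δ / 2) (half_pos hδ)] with n hn htn
  have h2 : (∫ r, timeKernel (ε n) (t n - r) * g r) - g c =
      ∫ r, timeKernel (ε n) (t n - r) * (g r - g c) := by
    simp_rw [mul_sub]
    rw [integral_sub (integrable_timeKernel_mul_continuous hg _ _)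
      ((integrable_timeKernel_sub _ _).mul_const _), integral_mul_const,
      integral_timeKernel_sub, one_mul]
  rw [dist_eq_norm, h2]
  calc ‖∫ r, timeKernel (ε n) (t n - r) * (g r - g c)‖
      ≤ ∫ r, timeKernel (ε n) (t n - r) * (e / 2) := by
        refine norm_integral_le_of_norm_le ((integrable_timeKernel_sub _ _).mul_const _)
          (Eventually.of_forall fun r => ?_)
        rw [norm_mul, Real.norm_of_nonneg (timeKernel_nonneg _ _)]
        rcases le_or_gt (ε n) |t n - r| with hr | hr
        · rw [timeKernel_eq_zero (hε0 n) hr]; simp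
        · refine mul_le_mul_of_nonneg_left (hgδ ?_).le (timeKernel_nonneg _ _)
          rw [Real.dist_eq] at htn ⊢
          calc |r - c| = |(t n - c) - (t n - r)| := by congr 1; ring
            _ ≤ |t n - c| + |t n - r| := abs_sub _ _
            _ < δ := by linarith
    _ = e / 2 := by rw [integral_mul_const, integral_timeKernel_sub, one_mul]
    _ < e := by linarith

/-- A continuous curve with integrable distributional derivative on `(0,1)`, extended by constants,
satisfies the same equation on the whole line. -/
lemma integral_deriv_mul_add_eq_zero {g h : ℝ → ℝ} (hg : Continuous g)
    (hg0 : ∀ s ≤ 0, g s = g 0) (hg1 : ∀ s, 1 ≤ s → g s = g 1) (hh : Integrable h)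
    (hh0 : ∀ s ∉ Ioo (0 : ℝ) 1, h s = 0)
    (heq : ∀ χ : ℝ → ℝ, ContDiff ℝ ∞ χ → HasCompactSupport χ → tsupport χ ⊆ Ioo (0 : ℝ) 1 →
      ∫ s in Ioo (0 : ℝ) 1, (deriv χ s * g s + χ s * h s) = 0)
    {χ : ℝ → ℝ} (hχ : ContDiff ℝ ∞ χ) (hχc : HasCompactSupport χ) :
    ∫ s, (deriv χ s * g s + χ s * h s) = 0 := by
  have hχd : Continuous (deriv χ) := hχ.continuous_deriv (by simp)
  obtain ⟨C, hC⟩ := hχ.continuous.bounded_above_of_compact_support hχc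
  have i1 : Integrable fun s => deriv χ s * g s :=
    (hχd.mul hg).integrable_of_hasCompactSupport hχc.deriv.mul_right
  have i2 : Integrable fun s => χ s * h s :=
    hh.bdd_mul (c := C) hχ.continuous.aestronglyMeasurable (Eventually.of_forall hC)
  have i3 : Integrable fun s => deriv χ s * g s + χ s * h s := i1.add i2
  set F := fun s => deriv χ s * g s + χ s * h s with hF
  -- With `ε ≤ 1/6`, the points `2ε` and `1 - 2ε` are in order, and the transition layers of width
  -- `ε` around them stay inside `(0,1)`.
  set ε : ℕ → ℝ := fun n => 1 / ((n : ℝ) + 1) / 6 with hεd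
  have hε0 : ∀ n, 0 < ε n := fun n => by positivity
  have hε6 : ∀ n, ε n ≤ 1 / 6 := fun n => by
    have : 1 / ((n : ℝ) + 1) ≤ 1 := by
      rw [div_le_one (by positivity)]; linarith [Nat.cast_nonneg (α := ℝ) n]
    simp only [hεd]; linarith
  have hε : Tendsto ε atTop (𝓝 0) := by
    have h := (tendsto_one_div_add_atTop_nhds_zero_nat (𝕜 := ℝ)).div_const 6
    rw [zero_div] at h
    exact h
  set ψ : ℕ → ℝ → ℝ := fun n => timeCutoff (ε n) (2 * ε n) (1 - 2 * ε n) with hψ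
  have hab : ∀ n, 2 * ε n ≤ 1 - 2 * ε n := fun n => by linarith [hε6 n]
  have hψ0 : ∀ n, ∀ s ∉ Ioo (0 : ℝ) 1, ψ n s = 0 := fun n s hs =>
    timeCutoff_eq_zero (hε0 n) (hab n) fun h' => hs
      ⟨by linarith [h'.1, hε0 n], by linarith [h'.2, hε0 n]⟩
  have hχg : Continuous fun s => χ s * g s := hχ.continuous.mul hg
  -- The test function is `χ ψ_n`. The derivative of the cutoff contributes time kernels near the
  -- two endpoints, which in the limit produce `χ(0) g(0) - χ(1) g(1)`.
  have key : ∀ n, (∫ s, ψ n s * F s) + ((∫ s, timeKernel (ε n) (2 * ε n - s) * (χ s * g s)) -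
      ∫ s, timeKernel (ε n) (1 - 2 * ε n - s) * (χ s * g s)) = 0 := by
    intro n
    have hψs := timeCutoff_contDiff (ε n) (2 * ε n) (1 - 2 * ε n)
    have hts : tsupport (fun s => χ s * ψ n s) ⊆ Ioo (0 : ℝ) 1 :=
      (tsupport_mul_subset_right.trans (timeCutoff_tsupport (hε0 n) (hab n))).trans fun s hs =>
        ⟨by linarith [hs.1, hε0 n], by linarith [hs.2, hε0 n]⟩
    have h1 := heq (fun s => χ s * ψ n s) (hχ.mul hψs) hχc.mul_right hts
    have hd : ∀ s, deriv (fun s => χ s * ψ n s) s * g s + χ s * ψ n s * h s =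
        ψ n s * F s + (timeKernel (ε n) (2 * ε n - s) * (χ s * g s) -
          timeKernel (ε n) (1 - 2 * ε n - s) * (χ s * g s)) := by
      intro s
      have hd1 := ((hχ.differentiable (by simp) s).hasDerivAt.mul
        (hasDerivAt_timeCutoff (ε n) (2 * ε n) (1 - 2 * ε n) s)).deriv
      rw [show (fun s => χ s * ψ n s) = χ * timeCutoff (ε n) (2 * ε n) (1 - 2 * ε n) from rfl, hd1,
        timeKernel_sub_comm _ s, timeKernel_sub_comm _ s]
      simp only [hF, hψ]; ring
    rw [setIntegral_eq_integral_of_forall_compl_eq_zero] at h1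
    · simp_rw [hd] at h1
      have j1 : Integrable fun s => ψ n s * F s := i3.bdd_mul (c := 1)
        hψs.continuous.aestronglyMeasurable
        (Eventually.of_forall fun s => abs_timeCutoff_le (hε0 n) _ _ s)
      have j2 := integrable_timeKernel_mul_continuous hχg (ε n) (2 * ε n)
      have j3 := integrable_timeKernel_mul_continuous hχg (ε n) (1 - 2 * ε n)
      rw [← integral_sub j2 j3]
      exact (integral_add j1 (j2.sub j3)).symm.trans h1
    · intro s hs
      have h0 : χ s * ψ n s = 0 := by rw [hψ0 n s hs, mul_zero]
      have h2 : deriv (fun s => χ s * ψ n s) s = 0 :=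
        image_eq_zero_of_notMem_tsupport fun hc => hs (hts (tsupport_deriv_subset hc))
      rw [h0, h2, zero_mul, zero_mul, add_zero]
  have l1 : Tendsto (fun n => ∫ s, ψ n s * F s) atTop (𝓝 (∫ s in Ioo (0 : ℝ) 1, F s)) := by
    rw [← integral_indicator measurableSet_Ioo]
    refine tendsto_integral_of_dominated_convergence (fun s => ‖F s‖) (fun n =>
      (timeCutoff_contDiff _ _ _).continuous.aestronglyMeasurable.mul i3.1) i3.norm
      (fun n => Eventually.of_forall fun s => ?_) (Eventually.of_forall fun s => ?_)
    · rw [norm_mul]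
      exact mul_le_of_le_one_left (norm_nonneg _) (abs_timeCutoff_le (hε0 n) _ _ s)
    · by_cases hs : s ∈ Ioo (0 : ℝ) 1
      · rw [indicator_of_mem hs]
        refine tendsto_const_nhds.congr' ?_
        have e1 : 0 < min s (1 - s) / 3 := by
          have := lt_min hs.1 (sub_pos.2 hs.2); linarith
        filter_upwards [hε.eventually_lt_const e1] with n hn
        have := min_le_left s (1 - s)
        have := min_le_right s (1 - s)
        rw [hψ]
        simp only
        rw [timeCutoff_eq_one (hε0 n) ⟨by linarith, by linarith⟩, one_mul]
      · rw [indicator_of_notMem hs]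
        refine tendsto_const_nhds.congr fun n => ?_
        rw [hψ0 n s hs, zero_mul]
  have l2 := tendsto_integral_timeKernel_continuous hχg (t := fun n => 2 * ε n) (c := 0) hε0 hε
    (by simpa using hε.const_mul 2)
  have l3 := tendsto_integral_timeKernel_continuous hχg (t := fun n => 1 - 2 * ε n) (c := 1) hε0 hε
    (by simpa using (hε.const_mul 2).const_sub 1)
  have hlim := tendsto_nhds_unique (l1.add (l2.sub l3))
    ((tendsto_const_nhds (x := (0 : ℝ))).congr fun n => (key n).symm)
  -- Outside `[0,1]` the extension is constant and `h` vanishes, so only the integral of `χ'`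
  -- remains. These two contributions cancel the boundary terms.
  have hleft : ∫ s in Iic (0 : ℝ), F s = χ 0 * g 0 := by
    have : ∀ s ∈ Iic (0 : ℝ), F s = deriv χ s * g 0 := fun s (hs : s ≤ 0) => by
      simp only [hF]
      rw [hg0 s hs, hh0 s fun h' => not_lt.2 hs h'.1, mul_zero, add_zero]
    rw [setIntegral_congr_fun measurableSet_Iic this, integral_mul_const,
      hχc.integral_Iic_deriv_eq (hχ.of_le (by simp))]
  have hright : ∫ s in Ioi (1 : ℝ), F s = - (χ 1 * g 1) := by
    have : ∀ s ∈ Ioi (1 : ℝ), F s = deriv χ s * g 1 := fun s (hs : 1 < s) => by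
      simp only [hF]
      rw [hg1 s hs.le, hh0 s fun h' => not_lt.2 hs.le h'.2, mul_zero, add_zero]
    rw [setIntegral_congr_fun measurableSet_Ioi this, integral_mul_const,
      hχc.integral_Ioi_deriv_eq (hχ.of_le (by simp)), neg_mul]
  have hsplit : ∫ s, F s = (∫ s in Iic (0 : ℝ), F s) + ((∫ s in Ioo (0 : ℝ) 1, F s) +
      ∫ s in Ioi (1 : ℝ), F s) := by
    rw [← integral_Ioc_eq_integral_Ioo, ← setIntegral_union (Ioc_disjoint_Ioi_same)
      measurableSet_Ioi i3.integrableOn i3.integrableOn, Ioc_union_Ioi_eq_Ioi zero_le_one,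
      ← compl_Iic, integral_add_compl measurableSet_Iic i3]
  rw [hsplit, hleft, hright]
  linarith

/-- A continuous function whose integral against derivatives of test functions vanishes is
constant. -/
lemma eq_of_integral_deriv_mul_eq_zero {g : ℝ → ℝ} (hg : Continuous g)
    (h : ∀ χ : ℝ → ℝ, ContDiff ℝ ∞ χ → HasCompactSupport χ → ∫ s, deriv χ s * g s = 0)
    {a b : ℝ} (hab : a ≤ b) : g a = g b := by
  set ε : ℕ → ℝ := fun n => 1 / ((n : ℝ) + 1) with hεd
  have hε0 : ∀ n, 0 < ε n := fun n => by positivity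
  have hε : Tendsto ε atTop (𝓝 0) := tendsto_one_div_add_atTop_nhds_zero_nat
  have l1 := tendsto_integral_timeKernel_continuous hg hε0 hε (tendsto_const_nhds (x := a))
  have l2 := tendsto_integral_timeKernel_continuous hg hε0 hε (tendsto_const_nhds (x := b))
  refine tendsto_nhds_unique l1 (l2.congr fun n => ?_)
  -- The derivative of a smoothed indicator of `[a,b]` is the difference of two time kernels, which
  -- evaluate `g` at `a` and `b` in the limit.
  have h1 := h _ (timeCutoff_contDiff (ε n) a b) (HasCompactSupport.of_support_subset_isCompact
    isCompact_Icc ((subset_tsupport _).trans (timeCutoff_tsupport (hε0 n) hab)))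
  simp_rw [(hasDerivAt_timeCutoff (ε n) a b _).deriv, timeKernel_sub_comm _ _ a,
    timeKernel_sub_comm _ _ b, sub_mul] at h1
  rw [integral_sub (integrable_timeKernel_mul_continuous hg _ _)
    (integrable_timeKernel_mul_continuous hg _ _)] at h1
  linarith

end TimeStep

/-! ### Extension of the curve to all times, conservation of mass, admissibility -/

section GlobalCurve

open ProbabilityTheory

variable {d : ℕ}

/-- The projection of the real line to `[0,1]`. -/
noncomputable def clampTime (s : ℝ) : ℝ := projIcc (0 : ℝ) 1 zero_le_one s

lemma clampTime_mem (s : ℝ) : clampTime s ∈ Icc (0 : ℝ) 1 := (projIcc (0 : ℝ) 1 zero_le_one s).2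

lemma clampTime_of_mem {s : ℝ} (hs : s ∈ Icc (0 : ℝ) 1) : clampTime s = s := by
  rw [clampTime, projIcc_of_mem _ hs]

lemma clampTime_of_le {s : ℝ} (hs : s ≤ 0) : clampTime s = 0 := by
  rw [clampTime, projIcc_of_le_left _ hs]

lemma clampTime_of_ge {s : ℝ} (hs : 1 ≤ s) : clampTime s = 1 := by
  rw [clampTime, projIcc_of_right_le _ hs]

lemma continuous_clampTime : Continuous clampTime :=
  continuous_subtype_val.comp continuous_projIcc

/-- A solution of the continuity equation on the whole real line, of constant mass `𝔪` and
concentrated on `K`. -/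
structure IsGlobalCE (K : Set (Rd d)) (𝔪 : NNReal) (μ : ℝ → Measure (Rd d))
    (ν : ℝ → VectorMeasure (Rd d) (Rd d)) : Prop where
  mass : ∀ s, μ s univ = 𝔪
  concentrated_μ : ∀ s, μ s Kᶜ = 0
  concentrated_ν : ∀ s, (ν s).variation Kᶜ = 0
  measurable_μ : Measurable μ
  measurable_pos : ∀ i, Measurable fun s => posComp (ν s) i
  measurable_neg : ∀ i, Measurable fun s => negComp (ν s) i
  integrable_pos : ∀ i, Integrable fun s => (posComp (ν s) i).real univ
  integrable_neg : ∀ i, Integrable fun s => (negComp (ν s) i).real univ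
  continuity_equation : ∀ χ : ℝ → ℝ, ContDiff ℝ ∞ χ → HasCompactSupport χ →
    ∀ ξ : Rd d → ℝ, ContDiff ℝ ∞ ξ → HasCompactSupport ξ →
    ∫ s, (deriv χ s * (∫ x, ξ x ∂μ s) + χ s *
      ∑ i, vecIntegral (ν s) (fun x => fderiv ℝ ξ x (EuclideanSpace.single i 1)) i) = 0

lemma abs_integral_le_mul_real {τ : Measure (Rd d)} [IsFiniteMeasure τ] {f : Rd d → ℝ} {C : ℝ}
    (hC : ∀ x, |f x| ≤ C) : |∫ x, f x ∂τ| ≤ C * τ.real univ :=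
  norm_integral_le_of_norm_le_const (f := f) (μ := τ) (Eventually.of_forall hC)

lemma integrable_integral_of_measurable {κ : ℝ → Measure (Rd d)} (hκ : Measurable κ)
    [∀ s, IsFiniteMeasure (κ s)] (hi : Integrable fun s => (κ s).real univ)
    {f : Rd d → ℝ} (hf : Continuous f) {C : ℝ} (hC : ∀ x, |f x| ≤ C) :
    Integrable fun s => ∫ x, f x ∂κ s := by
  let κ' : Kernel ℝ (Rd d) := ⟨κ, hκ⟩
  have : ∀ s, IsFiniteMeasure (κ' s) := fun s => inferInstanceAs (IsFiniteMeasure (κ s))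
  have := isSFiniteKernel_of_isFiniteMeasure κ'
  have hm : StronglyMeasurable fun s => ∫ x, f x ∂κ' s :=
    (hf.comp continuous_snd).stronglyMeasurable.integral_kernel_prod_right'
      (f := fun p : ℝ × Rd d => f p.2)
  exact (hi.const_mul C).mono' hm.aestronglyMeasurable
    (Eventually.of_forall fun s => abs_integral_le_mul_real hC)

variable {Ω : Set (Rd d)} {μ₀ μ₁ : Measure (Rd d)} {μ : ℝ → Measure (Rd d)}
  {ν : ℝ → VectorMeasure (Rd d) (Rd d)}

lemma IsCE.continuous_integral_clampTime (hCE : IsCE Ω μ₀ μ₁ μ ν) {f : Rd d → ℝ}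
    (hf : Continuous f) (hfc : HasCompactSupport f) :
    Continuous fun s => ∫ x, f x ∂μ (clampTime s) :=
  (hCE.weakStar_continuous f hf hfc).comp_continuous continuous_clampTime clampTime_mem

lemma gradient_apply (f : Rd d → ℝ) (x : Rd d) (i : Fin d) :
    gradient f x i = fderiv ℝ f x (EuclideanSpace.single i 1) := by
  rw [← inner_gradient_left, EuclideanSpace.inner_single_right]
  simp

lemma continuous_gradient {f : Rd d → ℝ} (hf : ContDiff ℝ ∞ f) : Continuous (gradient f) :=
  (InnerProductSpace.toDual ℝ (Rd d)).symm.continuous.comp (hf.continuous_fderiv (by simp))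

lemma hasCompactSupport_gradient {f : Rd d → ℝ} (hf : HasCompactSupport f) :
    HasCompactSupport (gradient f) :=
  (hf.fderiv ℝ).comp_left (g := (InnerProductSpace.toDual ℝ (Rd d)).symm) (map_zero _)

lemma integral_gradient_innerSL (ν : VectorMeasure (Rd d) (Rd d)) {f : Rd d → ℝ}
    (hf : ContDiff ℝ ∞ f) (hfc : HasCompactSupport f) :
    ν.integral (fun x => gradient f x) (innerSL ℝ) =
      ∑ i, vecIntegral ν (fun x => fderiv ℝ f x (EuclideanSpace.single i 1)) i := by
  obtain ⟨C, hC⟩ := (continuous_gradient hf).bounded_above_of_compact_support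
    (hasCompactSupport_gradient hfc)
  rw [integral_innerSL_eq_sum ν (continuous_gradient hf).measurable hC]
  simp_rw [gradient_apply]
  rfl

lemma vecIntegral_const_mul (ν : VectorMeasure (Rd d) (Rd d)) (c : ℝ) (f : Rd d → ℝ) (i : Fin d) :
    vecIntegral ν (fun x => c * f x) i = c * vecIntegral ν f i := by
  simp only [vecIntegral, integral_const_mul]
  ring

/-- Products of a time and a space function are the only test functions that mollification and
conservation of mass require. -/
lemma IsCE.tensor_equation (hCE : IsCE Ω μ₀ μ₁ μ ν) {χ : ℝ → ℝ} (hχ : ContDiff ℝ ∞ χ)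
    (hχc : HasCompactSupport χ) (hχs : tsupport χ ⊆ Ioo (0 : ℝ) 1) {ξ : Rd d → ℝ}
    (hξ : ContDiff ℝ ∞ ξ) (hξc : HasCompactSupport ξ) :
    ∫ s in Ioo (0 : ℝ) 1, (deriv χ s * (∫ x, ξ x ∂μ s) + χ s *
      ∑ i, vecIntegral (ν s) (fun x => fderiv ℝ ξ x (EuclideanSpace.single i 1)) i) = 0 := by
  have hsub : tsupport (fun p : ℝ × Rd d => χ p.1 * ξ p.2) ⊆ tsupport χ ×ˢ tsupport ξ := by
    refine closure_minimal (fun p hp => ?_) ((isClosed_tsupport _).prod (isClosed_tsupport _))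
    rw [Function.mem_support] at hp
    exact ⟨subset_tsupport _ (left_ne_zero_of_mul hp), subset_tsupport _ (right_ne_zero_of_mul hp)⟩
  have h := hCE.continuity_equation (fun p => χ p.1 * ξ p.2)
    ((hχ.comp contDiff_fst).mul (hξ.comp contDiff_snd))
    ((hχc.isCompact.prod hξc.isCompact).of_isClosed_subset (isClosed_tsupport _) hsub)
    (hsub.trans (prod_mono hχs (subset_univ _)))
  refine Eq.trans ?_ h
  refine setIntegral_congr_fun (measurableSet_Ioo (a := (0 : ℝ)) (b := 1)) fun s _ => ?_
  simp only
  congr 1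
  · rw [← integral_const_mul]
    refine integral_congr_ae (Eventually.of_forall fun x => ?_)
    simp only
    rw [deriv_mul_const (hχ.differentiable (by simp) s)]
  · rw [integral_gradient_innerSL (ν s) (f := fun y => χ s * ξ y) (contDiff_const.mul hξ)
      hξc.mul_left, Finset.mul_sum]
    refine Finset.sum_congr rfl fun i _ => ?_
    rw [← vecIntegral_const_mul]
    refine congrArg (fun f => vecIntegral (ν s) f i) (funext fun x => ?_)
    rw [fderiv_const_mul (hξ.differentiable (by simp) x)]
    rfl

lemma vecIntegral_apply_eq_zero {ν : VectorMeasure (Rd d) (Rd d)} {K : Set (Rd d)}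
    (h : ν.variation Kᶜ = 0) {f : Rd d → ℝ} (hf : ∀ x ∈ K, f x = 0) (i : Fin d) :
    vecIntegral ν f i = 0 := by
  have h1 := ae_mem_of_concentrated h i
  simp only [vecIntegral]
  rw [integral_congr_ae (g := fun _ => 0) (h1.1.mono fun x hx => hf x hx),
    integral_congr_ae (g := fun _ => 0) (h1.2.mono fun x hx => hf x hx)]
  simp

lemma posComp_zero (i : Fin d) : posComp (0 : VectorMeasure (Rd d) (Rd d)) i = 0 := by
  have h : posComp (0 : VectorMeasure (Rd d) (Rd d)) i ≤ 0 := by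
    simpa using posComp_le_variation (0 : VectorMeasure (Rd d) (Rd d)) i
  exact le_antisymm h bot_le

lemma negComp_zero (i : Fin d) : negComp (0 : VectorMeasure (Rd d) (Rd d)) i = 0 := by
  have h : negComp (0 : VectorMeasure (Rd d) (Rd d)) i ≤ 0 := by
    simpa using negComp_le_variation (0 : VectorMeasure (Rd d) (Rd d)) i
  exact le_antisymm h bot_le

/-- The extension of a momentum by zero. -/
noncomputable def extMomentum (ν : ℝ → VectorMeasure (Rd d) (Rd d)) :
    ℝ → VectorMeasure (Rd d) (Rd d) :=
  (Ioo (0 : ℝ) 1).indicator ν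

lemma IsCE.measurable_extMomentum (hCE : IsCE Ω μ₀ μ₁ μ ν) {B : Set (Rd d)}
    (hB : MeasurableSet B) : Measurable fun s => extMomentum ν s B := by
  refine measurable_of_restrict_of_restrict_compl
    (measurableSet_Ioo (a := (0 : ℝ)) (b := 1)) ?_ ?_
  · have h : (Ioo (0 : ℝ) 1).domRestrict (fun s => extMomentum ν s B) =
        fun s : Ioo (0 : ℝ) 1 => ν s B :=
      funext fun s => by simp only [extMomentum, domRestrict, indicator_of_mem s.2]
    rw [h]
    exact hCE.borel B hB
  · have h : (Ioo (0 : ℝ) 1)ᶜ.domRestrict (fun s => extMomentum ν s B) = fun _ => 0 :=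
      funext fun s => by
        have := s.2
        simp only [extMomentum, domRestrict, indicator_of_notMem this]
        rfl
    rw [h]
    exact measurable_const

lemma IsCE.extMomentum_concentrated (hCE : IsCE Ω μ₀ μ₁ μ ν) (s : ℝ) :
    (extMomentum ν s).variation (closure Ω)ᶜ = 0 := by
  by_cases hs : s ∈ Ioo (0 : ℝ) 1
  · rw [extMomentum, indicator_of_mem hs]; exact hCE.concentrated_ν s hs
  · rw [extMomentum, indicator_of_notMem hs]; simp

lemma IsCE.integrable_extMomentum (hCE : IsCE Ω μ₀ μ₁ μ ν)
    {κ : ℝ → Measure (Rd d)} (hκ : Measurable κ) [∀ s, IsFiniteMeasure (κ s)]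
    (hle : ∀ s, κ s ≤ (extMomentum ν s).variation) : Integrable fun s => (κ s).real univ := by
  have hm : Measurable fun s => κ s univ := (Measure.measurable_coe MeasurableSet.univ).comp hκ
  refine ⟨hm.ennreal_toReal.aestronglyMeasurable, ?_⟩
  rw [hasFiniteIntegral_iff_ofReal (Eventually.of_forall fun _ => measureReal_nonneg)]
  refine lt_of_le_of_lt ?_ hCE.variation_integrable
  rw [← lintegral_indicator measurableSet_Ioo]
  refine lintegral_mono fun s => ?_
  rw [ofReal_measureReal]
  refine (hle s univ).trans ?_
  by_cases hs : s ∈ Ioo (0 : ℝ) 1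
  · rw [indicator_of_mem hs, extMomentum, indicator_of_mem hs, ← union_compl_self (closure Ω)]
    refine (measure_union_le _ _).trans ?_
    rw [hCE.concentrated_ν s hs, add_zero]
  · rw [extMomentum, indicator_of_notMem hs]; simp

lemma exists_bump_eq_one {K : Set (Rd d)} (hK : Bornology.IsBounded K) :
    ∃ ξ : Rd d → ℝ, ContDiff ℝ ∞ ξ ∧ HasCompactSupport ξ ∧ (∀ x ∈ K, ξ x = 1) ∧
      ∀ x ∈ K, fderiv ℝ ξ x = 0 := by
  obtain ⟨r, hr, hKr⟩ := hK.subset_ball_lt 0 0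
  let b : ContDiffBump (0 : Rd d) := ⟨r, r + 1, hr, by linarith⟩
  refine ⟨b, b.contDiff, b.hasCompactSupport, fun x hx =>
    b.one_of_mem_closedBall (Metric.ball_subset_closedBall (hKr hx)), fun x hx => ?_⟩
  have h : (b : Rd d → ℝ) =ᶠ[𝓝 x] fun _ => 1 := by
    filter_upwards [Metric.isOpen_ball.mem_nhds (hKr hx)] with y hy
    exact b.one_of_mem_closedBall (Metric.ball_subset_closedBall hy)
  rw [h.fderiv_eq, fderiv_const_apply]

/-- Freezing the measures before `0` and after `1`, with zero momentum there, creates no source at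
the endpoints because the curve is weakly* continuous. -/
lemma IsCE.isGlobalCE (hCE : IsCE Ω μ₀ μ₁ μ ν) (hΩ : Bornology.IsBounded Ω) {𝔪 : NNReal}
    (hmass : μ₀ univ = 𝔪) :
    IsGlobalCE (closure Ω) 𝔪 (fun s => μ (clampTime s)) (extMomentum ν) := by
  have hfin : ∀ s, IsFiniteMeasure (μ (clampTime s)) := fun s => hCE.finite _ (clampTime_mem s)
  have hμK : ∀ s, μ (clampTime s) (closure Ω)ᶜ = 0 := fun s =>
    hCE.concentrated_μ _ (clampTime_mem s)
  have hpos : ∀ i, Measurable fun s => posComp (extMomentum ν s) i := fun i =>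
    measurable_jordan_posPart fun B hB => by
      simp_rw [vecComponent_apply]
      exact (EuclideanSpace.proj (𝕜 := ℝ) i).measurable.comp (hCE.measurable_extMomentum hB)
  have hneg : ∀ i, Measurable fun s => negComp (extMomentum ν s) i := fun i =>
    measurable_jordan_negPart fun B hB => by
      simp_rw [vecComponent_apply]
      exact (EuclideanSpace.proj (𝕜 := ℝ) i).measurable.comp (hCE.measurable_extMomentum hB)
  have hipos := fun i => hCE.integrable_extMomentum (hpos i) fun s => posComp_le_variation _ i
  have hineg := fun i => hCE.integrable_extMomentum (hneg i) fun s => negComp_le_variation _ i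
  have hce : ∀ χ : ℝ → ℝ, ContDiff ℝ ∞ χ → HasCompactSupport χ →
      ∀ ξ : Rd d → ℝ, ContDiff ℝ ∞ ξ → HasCompactSupport ξ →
      ∫ s, (deriv χ s * (∫ x, ξ x ∂μ (clampTime s)) + χ s * ∑ i, vecIntegral (extMomentum ν s)
        (fun x => fderiv ℝ ξ x (EuclideanSpace.single i 1)) i) = 0 := by
    intro χ hχ hχc ξ hξ hξc
    have hD : ∀ i : Fin d, Continuous fun x => fderiv ℝ ξ x (EuclideanSpace.single i 1) :=
      fun i => (hξ.continuous_fderiv (by simp)).clm_apply continuous_const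
    have hDC : ∀ i : Fin d, ∃ C, ∀ x, |fderiv ℝ ξ x (EuclideanSpace.single i 1)| ≤ C := fun i =>
      (hD i).bounded_above_of_compact_support (hξc.fderiv_apply ℝ _)
    choose C hC using hDC
    refine integral_deriv_mul_add_eq_zero (hCE.continuous_integral_clampTime hξ.continuous hξc)
      (fun s hs => by rw [clampTime_of_le hs, clampTime_of_le le_rfl])
      (fun s hs => by rw [clampTime_of_ge hs, clampTime_of_ge le_rfl]) ?_ (fun s hs => ?_)
      (fun χ' h1 h2 h3 => ?_) hχ hχc
    · exact integrable_finsetSum _ fun i _ =>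
        (integrable_integral_of_measurable (hpos i) (hipos i) (hD i) (hC i)).sub
          (integrable_integral_of_measurable (hneg i) (hineg i) (hD i) (hC i))
    · refine Finset.sum_eq_zero fun i _ => vecIntegral_apply_eq_zero (K := ∅) ?_ (by simp) i
      rw [extMomentum, indicator_of_notMem hs]; simp
    · refine Eq.trans ?_ (hCE.tensor_equation h1 h2 h3 hξ hξc)
      refine setIntegral_congr_fun (measurableSet_Ioo (a := (0 : ℝ)) (b := 1)) fun s hs => ?_
      simp only
      rw [clampTime_of_mem (Ioo_subset_Icc_self hs), extMomentum, indicator_of_mem hs]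
  refine ⟨fun s => ?_, hμK, hCE.extMomentum_concentrated, ?_, hpos, hneg, hipos, hineg, hce⟩
  -- Conservation of mass: a bump equal to one on the carrier, with zero gradient there, tests the
  -- mass alone, and the flux term drops out.
  · obtain ⟨ξ, hξ, hξc, h1, h0⟩ := exists_bump_eq_one hΩ.closure
    have hg : ∀ s, ∫ x, ξ x ∂μ (clampTime s) = (μ (clampTime s)).real univ := fun s => by
      have hae : ∀ᵐ x ∂μ (clampTime s), x ∈ closure Ω := hμK s
      rw [integral_congr_ae (g := fun _ => 1) (hae.mono fun x hx => h1 x hx)]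
      simp
    have hc : ∀ a b, a ≤ b → (μ (clampTime a)).real univ = (μ (clampTime b)).real univ := by
      intro a b hab
      rw [← hg, ← hg]
      refine eq_of_integral_deriv_mul_eq_zero
        (hCE.continuous_integral_clampTime hξ.continuous hξc) (fun χ hχ hχc => ?_) hab
      refine Eq.trans ?_ (hce χ hχ hχc ξ hξ hξc)
      refine integral_congr_ae (Eventually.of_forall fun s => ?_)
      simp only
      rw [Finset.sum_eq_zero fun i _ => vecIntegral_apply_eq_zero
        (hCE.extMomentum_concentrated s) (fun x hx => by rw [h0 x hx]; rfl) i]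
      ring
    have h2 : (μ (clampTime s)).real univ = (μ (clampTime 0)).real univ := by
      rcases le_total s 0 with h | h
      · exact hc _ _ h
      · exact (hc _ _ h).symm
    rw [clampTime_of_le (s := 0) le_rfl, hCE.initial] at h2
    have : IsFiniteMeasure μ₀ := ⟨by rw [hmass]; exact ENNReal.coe_lt_top⟩
    rw [← ofReal_measureReal (μ := μ (clampTime s)), h2, ofReal_measureReal, hmass]
  · exact measurable_of_measurable_integral hfin hΩ.isCompact_closure hμK fun f hf hfc =>
      (hCE.continuous_integral_clampTime hf hfc).measurable

/-- If no time in a relatively open set were admissible, the action would be infinite on a set of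
positive length. Hence the admissible times are dense. Each mollified density is continuous in time
and the mobility domain is closed, so the bound passes to every time, endpoints included. -/
lemma IsCE.isAdmissible (hCE : IsCE Ω μ₀ μ₁ μ ν) {k : Rd d → ℝ} (hk : IsKernel k) {M : ENNReal}
    {m : ℝ → ℝ} (hm : IsMobility M m) (hfr : volume (frontier Ω) = 0)
    (hfin : curveAction M m Ω μ ν < ⊤) {s : ℝ} (hs : s ∈ Icc (0 : ℝ) 1) :
    IsAdmissible M (μ s) := by
  have hfs := hCE.finite s hs
  have hd : s ∈ closure {r | r ∈ Icc (0 : ℝ) 1 ∧ IsAdmissible M (μ r)} := by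
    refine mem_closure_iff.2 fun U hU hsU => ?_
    rw [← closure_Ioo (zero_ne_one' ℝ)] at hs
    have hne := mem_closure_iff.1 hs U hU hsU
    by_contra hemp
    refine hfin.ne (top_le_iff.1 ?_)
    have htop : ∀ r ∈ U ∩ Ioo (0 : ℝ) 1, actionFunctional M m Ω (μ r) (ν r) = ⊤ := by
      intro r hr
      by_contra h
      have := hCE.finite r (Ioo_subset_Icc_self hr.2)
      exact hemp ⟨r, hr.1, Ioo_subset_Icc_self hr.2, (hm.exists_density hfr h).2.2.1⟩
    calc (⊤ : ENNReal) = ∫⁻ _ in U ∩ Ioo (0 : ℝ) 1, ⊤ := by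
          rw [setLIntegral_const, ENNReal.top_mul
            ((hU.inter isOpen_Ioo).measure_pos volume hne).ne']
      _ = ∫⁻ r in U ∩ Ioo (0 : ℝ) 1, actionFunctional M m Ω (μ r) (ν r) :=
          (setLIntegral_congr_fun (hU.inter isOpen_Ioo).measurableSet htop).symm
      _ ≤ _ := lintegral_mono_set inter_subset_right
  refine hk.isAdmissible_of_mollDensity_mem (Eventually.frequently ?_)
  filter_upwards [self_mem_nhdsWithin] with η (hη : 0 < η) x
  have hc : ContinuousOn (fun r => mollDensity k η (μ r) x) (Icc 0 1) :=
    hCE.weakStar_continuous _ ((hk.rescaledKernel_continuous η).comp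
      (continuous_const.sub continuous_id))
      ((hk.rescaledKernel_hasCompactSupport hη).comp_homeomorph (Homeomorph.subLeft x))
  refine (isClosed_mobilityDomain M).closure_subset_iff.2 ?_
    ((hc s hs).mono (fun r hr => hr.1) |>.mem_closure_image hd)
  rintro _ ⟨r, hr, rfl⟩
  have := hCE.finite r hr.1
  exact mollDensity_mem hk hη hr.2 x

end GlobalCurve

/-! ### Space-time mollification of a curve and its continuity equation -/

section CurveMollification

open ProbabilityTheory

variable {d : ℕ} {k : Rd d → ℝ}

/-- A measurable curve of finite measures with locally integrable mass. -/
structure IsMeasureCurve (κ : ℝ → Measure (Rd d)) : Prop where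
  measurable : Measurable κ
  finite : ∀ s, IsFiniteMeasure (κ s)
  locallyIntegrable : LocallyIntegrable fun s => (κ s).real univ

open Classical in
/-- A measurable curve of measures as a kernel. -/
noncomputable def curveKernel (κ : ℝ → Measure (Rd d)) : Kernel ℝ (Rd d) :=
  if h : Measurable κ then ⟨κ, h⟩ else 0

lemma curveKernel_apply {κ : ℝ → Measure (Rd d)} (h : Measurable κ) (s : ℝ) :
    curveKernel κ s = κ s := by
  rw [curveKernel, dif_pos h]; rfl

/-- The space-time mollification of a curve of measures. -/
noncomputable def curveMoll (k : Rd d → ℝ) (ε : ℝ) (κ : ℝ → Measure (Rd d)) : ℝ × Rd d → ℝ :=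
  spaceTimeMoll k ε (volume ⊗ₘ curveKernel κ)

namespace IsMeasureCurve

variable {κ : ℝ → Measure (Rd d)} (hκ : IsMeasureCurve κ)
include hκ

lemma isFiniteMeasure_curveKernel (s : ℝ) : IsFiniteMeasure (curveKernel κ s) := by
  rw [curveKernel_apply hκ.measurable]; exact hκ.finite s

lemma isSFiniteKernel : IsSFiniteKernel (curveKernel κ) := by
  have := hκ.isFiniteMeasure_curveKernel
  exact isSFiniteKernel_of_isFiniteMeasure _

lemma locallyIntegrable_curveKernel : LocallyIntegrable fun s => (curveKernel κ s).real univ := by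
  simp_rw [curveKernel_apply hκ.measurable]
  exact hκ.locallyIntegrable

lemma isLocallyFiniteMeasure :
    IsLocallyFiniteMeasure ((volume : Measure ℝ) ⊗ₘ curveKernel κ) := by
  have := hκ.isFiniteMeasure_curveKernel
  have := hκ.isSFiniteKernel
  exact isLocallyFiniteMeasure_compProd hκ.locallyIntegrable_curveKernel

variable (hk : IsKernel k) {ε : ℝ}
include hk

lemma contDiff_curveMoll (hε : 0 < ε) : ContDiff ℝ ∞ (curveMoll k ε κ) := by
  have := hκ.isLocallyFiniteMeasure
  exact hk.spaceTimeMoll_contDiff hε _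

omit hκ in
lemma _root_.curveMoll_nonneg (hε : 0 < ε) (z : ℝ × Rd d) : 0 ≤ curveMoll k ε κ z :=
  spaceTimeMoll_nonneg hk hε _ z

lemma stronglyMeasurable_mollDensity (η : ℝ) :
    StronglyMeasurable fun p : ℝ × Rd d => mollDensity k η (κ p.1) p.2 := by
  have := hκ.isSFiniteKernel
  have h := hk.stronglyMeasurable_mollDensity_kernel (curveKernel κ) η
  simp_rw [curveKernel_apply hκ.measurable] at h
  exact h

lemma curveMoll_eq_integral (hε : 0 < ε) (t : ℝ) (x : Rd d) :
    curveMoll k ε κ (t, x) = ∫ s, timeKernel ε (t - s) * mollDensity k ε (κ s) x := by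
  have := hκ.isFiniteMeasure_curveKernel
  have := hκ.isSFiniteKernel
  have h := hk.spaceTimeMoll_eq_integral hκ.locallyIntegrable_curveKernel hε t x
  simp_rw [curveKernel_apply hκ.measurable] at h
  exact h

lemma integrable_timeKernel_mul_mollDensity (hε : 0 < ε) (t : ℝ) (x : Rd d) :
    Integrable fun s => timeKernel ε (t - s) * mollDensity k ε (κ s) x := by
  have := hκ.isFiniteMeasure_curveKernel
  have := hκ.isSFiniteKernel
  have h := hk.integrable_timeKernel_mul_mollDensity hκ.locallyIntegrable_curveKernel hε t x
  simp_rw [curveKernel_apply hκ.measurable] at h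
  exact h

lemma curveMoll_eq_zero (hε : 0 < ε) {K : Set (Rd d)} (hκK : ∀ s, κ s Kᶜ = 0) {t : ℝ} {x : Rd d}
    (hx : ε < Metric.infDist x K) : curveMoll k ε κ (t, x) = 0 := by
  have := hκ.isFiniteMeasure_curveKernel
  have := hκ.isSFiniteKernel
  refine hk.spaceTimeMoll_eq_zero hε (fun s => ?_) hx hκ.locallyIntegrable_curveKernel
  rw [curveKernel_apply hκ.measurable, hκK]

lemma integral_mul_curveMoll (hε : 0 < ε) (t : ℝ) {f : Rd d → ℝ} (hf : Continuous f) {C : ℝ}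
    (hC : ∀ x, |f x| ≤ C) :
    ∫ x, f x * curveMoll k ε κ (t, x) =
      ∫ s, timeKernel ε (t - s) * ∫ x, f x * mollDensity k ε (κ s) x := by
  have := hκ.isFiniteMeasure_curveKernel
  have := hκ.isSFiniteKernel
  have h := hk.integral_mul_spaceTimeMoll hκ.locallyIntegrable_curveKernel hε t hf hC
  simp_rw [curveKernel_apply hκ.measurable] at h
  exact h

lemma ae_tendsto_integral_mul_curveMoll {f : Rd d → ℝ} (hf : UniformContinuous f) {C : ℝ}
    (hC : ∀ x, |f x| ≤ C) :
    ∀ᵐ s, ∀ ε t : ℕ → ℝ, (∀ n, 0 < ε n) → Tendsto ε atTop (𝓝 0) → (∀ n, |t n - s| ≤ ε n) →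
      Tendsto (fun n => ∫ x, f x * curveMoll k (ε n) κ (t n, x)) atTop
        (𝓝 (∫ x, f x ∂κ s)) := by
  have := hκ.isFiniteMeasure_curveKernel
  have := hκ.isSFiniteKernel
  have h := hk.ae_tendsto_integral_mul_spaceTimeMoll hκ.locallyIntegrable_curveKernel hf hC
  simp_rw [curveKernel_apply hκ.measurable] at h
  exact h

lemma fderiv_curveMoll_eq_integral (hε : 0 < ε) (t : ℝ) (x : Rd d) (v : ℝ × Rd d) :
    (Integrable fun s => ∫ y, fderiv ℝ (spaceTimeKernel k ε) (t - s, x - y) v ∂κ s) ∧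
    fderiv ℝ (curveMoll k ε κ) (t, x) v =
      ∫ s, ∫ y, fderiv ℝ (spaceTimeKernel k ε) (t - s, x - y) v ∂κ s := by
  have := hκ.isFiniteMeasure_curveKernel
  have := hκ.isSFiniteKernel
  have := hκ.isLocallyFiniteMeasure
  have hi : Integrable (fun z' => fderiv ℝ (spaceTimeKernel k ε) ((t, x) - z') v)
      (volume ⊗ₘ curveKernel κ) := by
    have hc : Continuous fun z => fderiv ℝ (spaceTimeKernel k ε) z v :=
      ((hk.spaceTimeKernel_contDiff ε).continuous_fderiv (by simp)).clm_apply continuous_const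
    exact (hc.comp (continuous_const.sub continuous_id)).integrable_of_hasCompactSupport
      (((hk.spaceTimeKernel_hasCompactSupport hε).fderiv_apply ℝ v).comp_homeomorph
        (Homeomorph.subLeft (t, x)))
  have h1 := hi.integral_compProd
  have h2 := hk.fderiv_spaceTimeMoll hε (volume ⊗ₘ curveKernel κ) (t, x) v
  rw [Measure.integral_compProd hi] at h2
  simp only [Kernel.prodMkLeft_apply, Kernel.const_apply, curveKernel_apply hκ.measurable]
    at h1 h2
  exact ⟨h1, h2⟩

end IsMeasureCurve

lemma fderiv_spaceTimeKernel (hk : IsKernel k) (ε : ℝ) (t : ℝ) (x : Rd d) (v : ℝ × Rd d) :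
    fderiv ℝ (spaceTimeKernel k ε) (t, x) v =
      deriv (timeKernel ε) t * v.1 * rescaledKernel k ε x +
        timeKernel ε t * fderiv ℝ (rescaledKernel k ε) x v.2 := by
  have h1 : HasFDerivAt (fun z : ℝ × Rd d => timeKernel ε z.1) _ (t, x) :=
    (((timeKernel_contDiff ε).differentiable (by simp) t).hasFDerivAt).comp (t, x) hasFDerivAt_fst
  have h2 : HasFDerivAt (fun z : ℝ × Rd d => rescaledKernel k ε z.2) _ (t, x) :=
    HasFDerivAt.comp (g := rescaledKernel k ε) (t, x)
      (((hk.rescaledKernel_smooth ε).differentiable (by simp) x).hasFDerivAt) hasFDerivAt_snd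
  have h3 : HasFDerivAt (spaceTimeKernel k ε) _ (t, x) := h1.mul h2
  rw [h3.fderiv]
  simp only [add_apply, smul_apply,
    ContinuousLinearMap.comp_apply, ContinuousLinearMap.coe_fst', ContinuousLinearMap.coe_snd',
    smul_eq_mul, fderiv_eq_smul_deriv]
  ring

/-- The space-time mollification of a momentum. -/
noncomputable def momentumMoll (k : Rd d → ℝ) (ε : ℝ) (ν : ℝ → VectorMeasure (Rd d) (Rd d))
    (z : ℝ × Rd d) : Rd d :=
  WithLp.toLp 2 fun i => curveMoll k ε (fun s => posComp (ν s) i) z -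
    curveMoll k ε (fun s => negComp (ν s) i) z

namespace IsGlobalCE

variable {K : Set (Rd d)} {𝔪 : NNReal} {μ : ℝ → Measure (Rd d)}
  {ν : ℝ → VectorMeasure (Rd d) (Rd d)} (h : IsGlobalCE K 𝔪 μ ν)
include h

lemma isFiniteMeasure (s : ℝ) : IsFiniteMeasure (μ s) :=
  ⟨by rw [h.mass]; exact ENNReal.coe_lt_top⟩

lemma curve_μ : IsMeasureCurve μ where
  measurable := h.measurable_μ
  finite := h.isFiniteMeasure
  locallyIntegrable := by
    simp_rw [Measure.real, h.mass]
    exact locallyIntegrable_const _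

lemma curve_pos (i : Fin d) : IsMeasureCurve fun s => posComp (ν s) i :=
  ⟨h.measurable_pos i, fun _ => inferInstance, (h.integrable_pos i).locallyIntegrable⟩

lemma curve_neg (i : Fin d) : IsMeasureCurve fun s => negComp (ν s) i :=
  ⟨h.measurable_neg i, fun _ => inferInstance, (h.integrable_neg i).locallyIntegrable⟩

variable (hk : IsKernel k) {ε : ℝ} (hε : 0 < ε)
include hk hε

lemma contDiff_momentumMoll : ContDiff ℝ ∞ (momentumMoll k ε ν) :=
  contDiff_piLp' 2 fun i =>
    ((h.curve_pos i).contDiff_curveMoll hk hε).sub ((h.curve_neg i).contDiff_curveMoll hk hε)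

lemma curveMoll_eq_zero {t : ℝ} {x : Rd d} (hx : ε < Metric.infDist x K) :
    curveMoll k ε μ (t, x) = 0 :=
  h.curve_μ.curveMoll_eq_zero hk hε h.concentrated_μ hx

lemma momentumMoll_eq_zero {t : ℝ} {x : Rd d} (hx : ε < Metric.infDist x K) :
    momentumMoll k ε ν (t, x) = 0 := by
  ext i
  have h1 : ∀ s, posComp (ν s) i Kᶜ = 0 := fun s => (ae_mem_of_concentrated (h.concentrated_ν s) i).1
  have h2 : ∀ s, negComp (ν s) i Kᶜ = 0 := fun s => (ae_mem_of_concentrated (h.concentrated_ν s) i).2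
  simp [momentumMoll, (h.curve_pos i).curveMoll_eq_zero hk hε h1 hx,
    (h.curve_neg i).curveMoll_eq_zero hk hε h2 hx]

lemma integral_curveMoll (t : ℝ) : ∫ x, curveMoll k ε μ (t, x) = 𝔪 := by
  have h1 := h.curve_μ.integral_mul_curveMoll hk hε t (f := fun _ => 1) continuous_const (C := 1)
    (by simp)
  have h2 : ∀ s, ∫ x, mollDensity k ε (μ s) x = 𝔪 := fun s => by
    have := h.isFiniteMeasure s
    have h3 := hk.integral_mul_mollDensity hε (μ s) (f := fun _ => 1) continuous_const (C := 1)
      (by simp)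
    simp only [one_mul, hk.integral_rescaledKernel_sub' hε] at h3
    rw [h3]
    simp [Measure.real, h.mass]
  simp only [one_mul, h2] at h1
  rw [h1, integral_mul_const, integral_timeKernel_sub, one_mul]

lemma momentumMoll_eq_integral (t : ℝ) (x : Rd d) :
    (Integrable fun s => timeKernel ε (t - s) • mollMomentum k ε (ν s) x) ∧
    momentumMoll k ε ν (t, x) = ∫ s, timeKernel ε (t - s) • mollMomentum k ε (ν s) x := by
  have h1 := fun i => (h.curve_pos i).integrable_timeKernel_mul_mollDensity hk hε t x
  have h2 := fun i => (h.curve_neg i).integrable_timeKernel_mul_mollDensity hk hε t x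
  have h3 : ∀ i s, (timeKernel ε (t - s) • mollMomentum k ε (ν s) x) i =
      timeKernel ε (t - s) * mollDensity k ε (posComp (ν s) i) x -
        timeKernel ε (t - s) * mollDensity k ε (negComp (ν s) i) x := fun i s => by
    rw [PiLp.smul_apply, mollMomentum_apply, smul_eq_mul, mul_sub]
  have h4 : ∀ i, Integrable fun s => (timeKernel ε (t - s) • mollMomentum k ε (ν s) x) i :=
    fun i => by simp_rw [h3]; exact (h1 i).sub (h2 i)
  refine ⟨Integrable.of_eval_piLp h4, ?_⟩
  ext i
  rw [eval_integral_piLp h4]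
  simp_rw [h3]
  rw [integral_sub (h1 i) (h2 i), ← (h.curve_pos i).curveMoll_eq_integral hk hε,
    ← (h.curve_neg i).curveMoll_eq_integral hk hε]
  rfl

/-- The mollified curve solves the continuity equation. -/
lemma deriv_curveMoll_add_divergenceAt (t : ℝ) (x : Rd d) :
    deriv (fun t => curveMoll k ε μ (t, x)) t +
      divergenceAt (fun y => momentumMoll k ε ν (t, y)) x = 0 := by
  have hcd : ∀ {κ : ℝ → Measure (Rd d)}, IsMeasureCurve κ → Differentiable ℝ (curveMoll k ε κ) :=
    fun hκ => (hκ.contDiff_curveMoll hk hε).differentiable (by simp)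
  have ht : deriv (fun t => curveMoll k ε μ (t, x)) t =
      fderiv ℝ (curveMoll k ε μ) (t, x) (1, 0) :=
    ((hcd h.curve_μ (t, x)).hasFDerivAt.comp_hasDerivAt t
      ((hasDerivAt_id t).prodMk (hasDerivAt_const t x))).deriv
  have hW : ∀ i, (fderiv ℝ (fun y => momentumMoll k ε ν (t, y)) x
      (EuclideanSpace.single i 1)) i =
      fderiv ℝ (curveMoll k ε fun s => posComp (ν s) i) (t, x) (0, EuclideanSpace.single i 1) -
      fderiv ℝ (curveMoll k ε fun s => negComp (ν s) i) (t, x) (0, EuclideanSpace.single i 1) := by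
    intro i
    have e1 : DifferentiableAt ℝ (fun y => momentumMoll k ε ν (t, y)) x :=
      (((h.contDiff_momentumMoll hk hε).differentiable (by simp)) (t, x)).comp x
        (hasFDerivAt_prodMk_right t x).differentiableAt
    have e2 := ((EuclideanSpace.proj i : Rd d →L[ℝ] ℝ).hasFDerivAt).comp x e1.hasFDerivAt
    have e3 := ((hcd (h.curve_pos i) (t, x)).hasFDerivAt.comp x
      (hasFDerivAt_prodMk_right t x)).sub
      ((hcd (h.curve_neg i) (t, x)).hasFDerivAt.comp x (hasFDerivAt_prodMk_right t x))
    exact congrArg (fun L : Rd d →L[ℝ] ℝ => L (EuclideanSpace.single i 1)) (e2.unique e3)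
  have hξ : ContDiff ℝ ∞ fun y => rescaledKernel k ε (x - y) :=
    (hk.rescaledKernel_smooth ε).comp (contDiff_const.sub contDiff_id)
  have hξc : HasCompactSupport fun y => rescaledKernel k ε (x - y) :=
    (hk.rescaledKernel_hasCompactSupport hε).comp_homeomorph (Homeomorph.subLeft x)
  have hχ : ContDiff ℝ ∞ fun s => timeKernel ε (t - s) :=
    (timeKernel_contDiff ε).comp (contDiff_const.sub contDiff_id)
  have hχc : HasCompactSupport fun s => timeKernel ε (t - s) :=
    (timeKernel_hasCompactSupport ε).comp_homeomorph (Homeomorph.subLeft t)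
  -- The weak equation is tested with the reflected kernels `s ↦ θ_ε(t - s)` and `y ↦ k_ε(x - y)`.
  -- Both reflections reverse the sign of a first derivative, so the result is minus the pointwise
  -- equation.
  have hce := h.continuity_equation _ hχ hχc _ hξ hξc
  have hdξ : ∀ y v, fderiv ℝ (fun y => rescaledKernel k ε (x - y)) y v =
      - fderiv ℝ (rescaledKernel k ε) (x - y) v := fun y v => by
    have e := HasFDerivAt.comp (g := rescaledKernel k ε) y
      (((hk.rescaledKernel_smooth ε).differentiable (by simp) (x - y)).hasFDerivAt)
      ((hasFDerivAt_id (𝕜 := ℝ) y).const_sub x)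
    have e' : HasFDerivAt (fun y => rescaledKernel k ε (x - y)) _ y := e
    rw [e'.fderiv]
    simp
  have hdχ : ∀ s, deriv (fun s => timeKernel ε (t - s)) s = - deriv (timeKernel ε) (t - s) :=
    fun s => deriv_comp_const_sub (timeKernel ε) t s
  have A := h.curve_μ.fderiv_curveMoll_eq_integral hk hε t x (1, 0)
  have P := fun i => (h.curve_pos i).fderiv_curveMoll_eq_integral hk hε t x
    (0, EuclideanSpace.single i 1)
  have N := fun i => (h.curve_neg i).fderiv_curveMoll_eq_integral hk hε t x
    (0, EuclideanSpace.single i 1)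
  rw [ht, divergenceAt, Finset.sum_congr rfl fun i _ => hW i, A.2]
  simp_rw [(P _).2, (N _).2]
  simp_rw [← integral_sub (P _).1 (N _).1]
  have S : ∀ i, Integrable fun s =>
      (∫ y, fderiv ℝ (spaceTimeKernel k ε) (t - s, x - y) (0, EuclideanSpace.single i 1)
        ∂posComp (ν s) i) -
      ∫ y, fderiv ℝ (spaceTimeKernel k ε) (t - s, x - y) (0, EuclideanSpace.single i 1)
        ∂negComp (ν s) i := fun i => (P i).1.sub (N i).1
  rw [← integral_finsetSum _ fun i _ => S i, ← integral_add A.1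
    (integrable_finsetSum _ fun i _ => S i), ← neg_eq_zero, ← integral_neg]
  refine Eq.trans (integral_congr_ae (Eventually.of_forall fun s => ?_)) hce
  simp only [fderiv_spaceTimeKernel hk, hdξ, hdχ, vecIntegral, mul_one, mul_zero, zero_mul,
    map_zero, add_zero, zero_add, integral_const_mul, integral_neg]
  rw [neg_add, neg_mul, ← mul_neg, ← Finset.sum_neg_distrib, Finset.mul_sum]
  congr 1
  refine Finset.sum_congr rfl fun i _ => ?_
  ring

end IsGlobalCE

end CurveMollification

/-! ### Smooth solutions as weak solutions -/

section SmoothCurves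

variable {d : ℕ}

lemma hasDerivAt_slice {F : ℝ × Rd d → ℝ} (hF : Differentiable ℝ F) (s : ℝ) (x : Rd d) :
    HasDerivAt (fun t => F (t, x)) (fderiv ℝ F (s, x) (1, 0)) s :=
  (hF (s, x)).hasFDerivAt.comp_hasDerivAt s ((hasDerivAt_id s).prodMk (hasDerivAt_const s x))

lemma hasCompactSupport_slice {φ : ℝ × Rd d → ℝ} (hφc : HasCompactSupport φ) (s : ℝ) :
    HasCompactSupport fun x => φ (s, x) :=
  HasCompactSupport.intro (hφc.isCompact.image continuous_snd) fun x hx =>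
    image_eq_zero_of_notMem_tsupport fun h => hx ⟨(s, x), h, rfl⟩

/-- Integration by parts against a smooth vector field. -/
lemma integral_inner_gradient {φ : Rd d → ℝ} (hφ : ContDiff ℝ ∞ φ) (hφc : HasCompactSupport φ)
    {w : Rd d → Rd d} (hw : ContDiff ℝ ∞ w) :
    ∫ x, inner ℝ (gradient φ x) (w x) = - ∫ x, φ x * divergenceAt w x := by
  have hwd := hw.differentiable (by simp)
  have hwi : ∀ i, ContDiff ℝ ∞ fun x => w x i := contDiff_euclidean.1 hw
  have hdw : ∀ i x v, fderiv ℝ (fun x => w x i) x v = (fderiv ℝ w x v) i := fun i x v =>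
    congrArg (fun L : Rd d →L[ℝ] ℝ => L v)
      (((EuclideanSpace.proj i : Rd d →L[ℝ] ℝ).hasFDerivAt).comp x (hwd x).hasFDerivAt).fderiv
  have hφd : ∀ v, Continuous fun x => fderiv ℝ φ x v := fun v =>
    (hφ.continuous_fderiv (by simp)).clm_apply continuous_const
  have hwid : ∀ i v, Continuous fun x => fderiv ℝ (fun x => w x i) x v := fun i v =>
    ((hwi i).continuous_fderiv (by simp)).clm_apply continuous_const
  have i1 : ∀ i : Fin d, Integrable fun x => fderiv ℝ φ x (EuclideanSpace.single i 1) * w x i :=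
    fun i => ((hφd _).mul (hwi i).continuous).integrable_of_hasCompactSupport
      (hφc.fderiv_apply ℝ _).mul_right
  have i2 : ∀ i : Fin d, Integrable fun x =>
      φ x * fderiv ℝ (fun x => w x i) x (EuclideanSpace.single i 1) := fun i =>
    (hφ.continuous.mul (hwid i _)).integrable_of_hasCompactSupport hφc.mul_right
  have i3 : ∀ i : Fin d, Integrable fun x => φ x * w x i := fun i =>
    (hφ.continuous.mul (hwi i).continuous).integrable_of_hasCompactSupport hφc.mul_right
  have e1 : ∀ x, inner ℝ (gradient φ x) (w x) =
      ∑ i, fderiv ℝ φ x (EuclideanSpace.single i 1) * w x i := fun x => by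
    simp_rw [PiLp.inner_apply, gradient_apply]
    exact Finset.sum_congr rfl fun i _ => by simp [mul_comm]
  have e2 : ∀ x, φ x * divergenceAt w x =
      ∑ i, φ x * fderiv ℝ (fun x => w x i) x (EuclideanSpace.single i 1) := fun x => by
    simp_rw [divergenceAt, Finset.mul_sum, hdw]
  simp_rw [e1, e2]
  rw [integral_finsetSum _ fun i _ => i1 i, integral_finsetSum _ fun i _ => i2 i,
    ← Finset.sum_neg_distrib]
  refine Finset.sum_congr rfl fun i _ => ?_
  rw [integral_mul_fderiv_eq_neg_fderiv_mul_of_integrable (i1 i) (i2 i) (i3 i)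
    (fun x _ => hφ.differentiable (by simp) x) (fun x _ => (hwi i).differentiable (by simp) x),
    neg_neg]

lemma integral_deriv_time_eq_zero {F : ℝ × Rd d → ℝ} (hF : ContDiff ℝ ∞ F)
    (hFc : HasCompactSupport F) (hFs : ∀ x, F (0, x) = 0 ∧ F (1, x) = 0) (U : Set (Rd d)) :
    ∫ s in Ioo (0 : ℝ) 1, ∫ x in U, fderiv ℝ F (s, x) (1, 0) = 0 := by
  have hD : Continuous fun z => fderiv ℝ F z (1, 0) :=
    (hF.continuous_fderiv (by simp)).clm_apply continuous_const
  have hi : Integrable (fun z => fderiv ℝ F z (1, 0)) ((volume : Measure ℝ).prod volume) :=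
    hD.integrable_of_hasCompactSupport (hFc.fderiv_apply ℝ _)
  have hi' : Integrable (Function.uncurry fun s x => fderiv ℝ F (s, x) (1, 0))
      ((volume.restrict (Ioo (0 : ℝ) 1)).prod (volume.restrict U)) := by
    rw [Measure.prod_restrict]
    exact hi.restrict
  rw [integral_integral_swap hi']
  refine integral_eq_zero_of_ae (Eventually.of_forall fun x => ?_)
  have h := intervalIntegral.integral_eq_sub_of_hasDerivAt (a := 0) (b := 1)
    (f := fun t => F (t, x)) (f' := fun s => fderiv ℝ F (s, x) (1, 0))
    (fun s _ => hasDerivAt_slice (hF.differentiable (by simp)) s x)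
    (Continuous.intervalIntegrable (hD.comp (by fun_prop)) _ _)
  rw [intervalIntegral.integral_of_le zero_le_one, integral_Ioc_eq_integral_Ioo, (hFs x).1,
    (hFs x).2, sub_zero] at h
  exact h

/-- Smooth solutions of the continuity equation are weak solutions. -/
lemma isCE_of_contDiff {U : Set (Rd d)} (hU : IsOpen U) (hUb : Bornology.IsBounded U)
    (hfr : volume (frontier U) = 0) {ρ : ℝ × Rd d → ℝ} {w : ℝ × Rd d → Rd d}
    (hρ : ContDiff ℝ ∞ ρ) (hw : ContDiff ℝ ∞ w) (hρ0 : ∀ z, 0 ≤ ρ z)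
    (hwU : ∀ s, ∀ x ∉ U, w (s, x) = 0) (hρU : ∀ s, ∀ x ∉ U, deriv (fun t => ρ (t, x)) s = 0)
    (hpde : ∀ s x, deriv (fun t => ρ (t, x)) s + divergenceAt (fun y => w (s, y)) x = 0) :
    IsCE U ((volume.restrict U).withDensity fun x => ENNReal.ofReal (ρ (0, x)))
      ((volume.restrict U).withDensity fun x => ENNReal.ofReal (ρ (1, x)))
      (fun s => (volume.restrict U).withDensity fun x => ENNReal.ofReal (ρ (s, x)))
      (fun s => (volume.restrict U).withDensityᵥ fun x => w (s, x)) := by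
  have hρs : ∀ s, ContDiff ℝ ∞ fun x => ρ (s, x) := fun s => hρ.comp (contDiff_prodMk_right s)
  have hws : ∀ s, ContDiff ℝ ∞ fun x => w (s, x) := fun s => hw.comp (contDiff_prodMk_right s)
  have hK : IsCompact (closure U) := hUb.isCompact_closure
  have hon : ∀ {E : Type} [NormedAddCommGroup E] {f : Rd d → E}, Continuous f → IntegrableOn f U :=
    fun hf => (hf.continuousOn.integrableOn_compact hK).mono_set subset_closure
  have hiw : ∀ s, IntegrableOn (fun x => w (s, x)) U := fun s => hon (hws s).continuous
  have hint : ∀ s (f : Rd d → ℝ),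
      ∫ x, f x ∂((volume.restrict U).withDensity fun x => ENNReal.ofReal (ρ (s, x))) =
        ∫ x in U, ρ (s, x) * f x := fun s f => by
    rw [integral_withDensity_eq_integral_toReal_smul
      (hρs s).continuous.measurable.ennreal_ofReal (by simp)]
    refine integral_congr_ae (Eventually.of_forall fun x => ?_)
    simp only [smul_eq_mul, ENNReal.toReal_ofReal (hρ0 (s, x))]
  -- Passing to the compact closure changes no integral and gives continuity in time of integrals of
  -- continuous functions.
  have hres : ∀ {E : Type} [NormedAddCommGroup E] [NormedSpace ℝ E] (f : Rd d → E),
      ∫ x in U, f x = ∫ x in closure U, f x := fun f =>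
    (setIntegral_congr_set (closure_ae_eq_of_null_frontier hfr)).symm
  have hUc : (volume.restrict U) (closure U)ᶜ = 0 := by
    rw [Measure.restrict_apply isClosed_closure.isOpen_compl.measurableSet]
    refine measure_mono_null (fun x hx => hx.1 (subset_closure hx.2)) measure_empty
  have hvar : ∀ s, ((volume.restrict U).withDensityᵥ fun x => w (s, x)).variation =
      (volume.restrict U).withDensity fun x => ‖w (s, x)‖ₑ := fun s =>
    Measure.variation_withDensityᵥ (hiw s)
  refine ⟨fun s _ => ?_, fun s _ => ?_, fun s _ => ?_, fun f hf hfc => ?_, rfl, rfl, fun B hB => ?_,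
    ?_, fun φ hφ hφc hφs => ?_⟩
  · exact isFiniteMeasure_withDensity_ofReal (hon (hρs s).continuous).2
  · exact withDensity_absolutelyContinuous _ _ hUc
  · rw [hvar]
    exact withDensity_absolutelyContinuous _ _ hUc
  · simp_rw [hint, hres]
    refine (continuous_parametric_integral_of_continuous ?_ hK).continuousOn
    exact hρ.continuous.mul (hf.comp continuous_snd)
  · have h : StronglyMeasurable fun s => ∫ x in B, w (s, x) ∂(volume.restrict U) :=
      hw.continuous.stronglyMeasurable.integral_prod_right'
    have h' : (fun s : Ioo (0 : ℝ) 1 => (volume.restrict U).withDensityᵥ (fun x => w (s, x)) B) =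
        (fun s => ∫ x in B, w (s, x) ∂(volume.restrict U)) ∘ Subtype.val :=
      funext fun s => withDensityᵥ_apply (hiw s) hB
    rw [h']
    exact h.measurable.comp measurable_subtype_coe
  · obtain ⟨C, hC⟩ := ((isCompact_Icc (a := (0 : ℝ)) (b := 1)).prod hK).exists_bound_of_continuousOn
      hw.continuous.continuousOn
    have hb : ∀ s ∈ Ioo (0 : ℝ) 1, ((volume.restrict U).withDensityᵥ fun x => w (s, x)).variation
        (closure U) ≤ ENNReal.ofReal C * volume U := by
      intro s hs
      rw [hvar, withDensity_apply _ isClosed_closure.measurableSet]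
      refine (lintegral_mono' Measure.restrict_le_self le_rfl).trans ?_
      rw [← setLIntegral_const]
      refine setLIntegral_mono' hU.measurableSet fun x hx => ?_
      rw [← ofReal_norm]
      exact ENNReal.ofReal_le_ofReal (hC _ ⟨Ioo_subset_Icc_self hs, subset_closure hx⟩)
    refine (setLIntegral_mono' measurableSet_Ioo hb).trans_lt ?_
    rw [setLIntegral_const, Real.volume_Ioo]
    exact ENNReal.mul_lt_top (ENNReal.mul_lt_top ENNReal.ofReal_lt_top hUb.measure_lt_top)
      ENNReal.ofReal_lt_top
  · have hF : ContDiff ℝ ∞ fun z => φ z * ρ z := hφ.mul hρ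
    have h0 : ∀ s x, s ∉ Ioo (0 : ℝ) 1 → φ (s, x) = 0 := fun s x hs =>
      image_eq_zero_of_notMem_tsupport fun h => hs (hφs h).1
    refine Eq.trans ?_ (integral_deriv_time_eq_zero hF hφc.mul_right
      (fun x => by rw [h0 0 x (by simp), h0 1 x (by simp)]; simp) U)
    refine setIntegral_congr_fun measurableSet_Ioo fun s _ => ?_
    have hφd := hφ.differentiable (by simp)
    have hρd := hρ.differentiable (by simp)
    have hφ1 : ContDiff ℝ ∞ fun x => φ (s, x) := hφ.comp (contDiff_prodMk_right s)
    have hφ2 := hasCompactSupport_slice hφc s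
    have hdt : ∀ {G : ℝ × Rd d → ℝ}, ContDiff ℝ ∞ G → Continuous fun x =>
        deriv (fun t => G (t, x)) s := fun {G} hG => by
      simp_rw [(hasDerivAt_slice (hG.differentiable (by simp)) s _).deriv]
      exact ((hG.continuous_fderiv (by simp)).clm_apply continuous_const).comp
        (Continuous.prodMk_right s)
    obtain ⟨C, hC⟩ := (continuous_gradient hφ1).bounded_above_of_compact_support
      (hasCompactSupport_gradient hφ2)
    have e : ∀ x, -(φ (s, x) * divergenceAt (fun y => w (s, y)) x) =
        φ (s, x) * deriv (fun t => ρ (t, x)) s := fun x => by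
      rw [eq_neg_of_add_eq_zero_left (hpde s x)]; ring
    -- The test function need not vanish on the boundary of `U`. Since the momentum and the time
    -- derivative of the density vanish off `U`, both integrals are over the whole space and
    -- integration by parts leaves no boundary term.
    have e3 : ∫ x in U, inner ℝ (gradient (fun x => φ (s, x)) x) (w (s, x)) =
        ∫ x in U, φ (s, x) * deriv (fun t => ρ (t, x)) s := by
      rw [setIntegral_eq_integral_of_forall_compl_eq_zero (s := U)
          (fun x hx => by rw [hwU s x hx, inner_zero_right]),
        integral_inner_gradient hφ1 hφ2 (hws s), ← integral_neg]
      simp_rw [e]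
      rw [setIntegral_eq_integral_of_forall_compl_eq_zero (s := U)
        (fun x hx => by rw [hρU s x hx, mul_zero])]
    have j1 : IntegrableOn (fun x => ρ (s, x) * deriv (fun t => φ (t, x)) s) U :=
      hon ((hρs s).continuous.mul (hdt hφ))
    have j2 : IntegrableOn (fun x => φ (s, x) * deriv (fun t => ρ (t, x)) s) U :=
      hon (hφ1.continuous.mul (hdt hρ))
    rw [hint, integral_innerSL_withDensityᵥ (hiw s) ((integrable_const C).mono'
      (continuous_gradient hφ1).aestronglyMeasurable (Eventually.of_forall hC)), e3,
      ← integral_add j1 j2]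
    refine integral_congr_ae (Eventually.of_forall fun x => ?_)
    simp only
    rw [← (hasDerivAt_slice (hF.differentiable (by simp)) s x).deriv,
      (hasDerivAt_slice hφd s x).deriv, (hasDerivAt_slice hρd s x).deriv]
    have := ((hasDerivAt_slice hφd s x).mul (hasDerivAt_slice hρd s x)).deriv
    rw [show (fun t => φ (t, x) * ρ (t, x)) = (fun t => φ (t, x)) * fun t => ρ (t, x) from rfl, this]
    ring

end SmoothCurves

/-! ### The approximating curves -/

section Approximation

variable {d : ℕ} {k : Rd d → ℝ}

/-- The density of the approximating curve. -/
noncomputable def approxDensity (k : Rd d → ℝ) (U : Set (Rd d)) (𝔪 : NNReal)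
    (μ : ℝ → Measure (Rd d)) (ε δ : ℝ) (z : ℝ × Rd d) : ℝ :=
  -- The time change maps `[0,1]` onto `[-ε, 1 + ε]`. At either end the time kernel, of radius `ε`,
  -- sees only the frozen part of the curve, so the endpoints are exact space mollifications.
  (1 - δ) * curveMoll k ε μ ((1 + 2 * ε) * z.1 - ε, z.2) + δ * (𝔪 / (volume U).toReal)

/-- The momentum density of the approximating curve. -/
noncomputable def approxMomentum (k : Rd d → ℝ) (ν : ℝ → VectorMeasure (Rd d) (Rd d)) (ε δ : ℝ)
    (z : ℝ × Rd d) : Rd d :=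
  ((1 - δ) * (1 + 2 * ε)) • momentumMoll k ε ν ((1 + 2 * ε) * z.1 - ε, z.2)

lemma IsMeasureCurve.curveMoll_eq_mollDensity {κ : ℝ → Measure (Rd d)} (hκ : IsMeasureCurve κ)
    (hk : IsKernel k) {ε : ℝ} (hε : 0 < ε) {t : ℝ} {τ : Measure (Rd d)}
    (h : ∀ s, |t - s| < ε → κ s = τ) (x : Rd d) :
    curveMoll k ε κ (t, x) = mollDensity k ε τ x := by
  rw [hκ.curveMoll_eq_integral hk hε]
  have h1 : ∀ s, timeKernel ε (t - s) * mollDensity k ε (κ s) x =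
      timeKernel ε (t - s) * mollDensity k ε τ x := fun s => by
    rcases lt_or_ge |t - s| ε with hs | hs
    · rw [h s hs]
    · rw [timeKernel_eq_zero hε hs, zero_mul, zero_mul]
  simp_rw [h1]
  rw [integral_mul_const, integral_timeKernel_sub, one_mul]

lemma smoothedEndpoint_eq_withDensity (hk : IsKernel k) {U : Set (Rd d)} (hU : MeasurableSet U)
    (hU0 : volume U ≠ 0) (hUt : volume U ≠ ⊤) (𝔪 : NNReal) {ε δ : ℝ} (hε : 0 < ε)
    (hδ : δ ∈ Icc (0 : ℝ) 1) (μ : Measure (Rd d)) [IsFiniteMeasure μ]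
    (hout : ∀ x ∉ U, mollDensity k ε μ x = 0) :
    smoothedEndpoint U 𝔪 k ε δ μ = (volume.restrict U).withDensity fun x =>
      ENNReal.ofReal ((1 - δ) * mollDensity k ε μ x + δ * (𝔪 / (volume U).toReal)) := by
  have hm : Measurable fun x => ENNReal.ofReal (mollDensity k ε μ x) :=
    (hk.continuous_mollDensity hε μ).measurable.ennreal_ofReal
  have h1 : mollify μ k ε =
      (volume.restrict U).withDensity fun x => ENNReal.ofReal (mollDensity k ε μ x) := by
    rw [← withDensity_indicator hU]
    refine congrArg volume.withDensity (funext fun x => ?_)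
    by_cases hx : x ∈ U
    · rw [indicator_of_mem hx]; rfl
    · rw [indicator_of_notMem hx]
      exact (congrArg ENNReal.ofReal (hout x hx)).trans ENNReal.ofReal_zero
  have h2 : (fun x => ENNReal.ofReal ((1 - δ) * mollDensity k ε μ x + δ * (𝔪 / (volume U).toReal)))
      = (ENNReal.ofReal (1 - δ) • fun x => ENNReal.ofReal (mollDensity k ε μ x)) +
        fun _ => ENNReal.ofReal δ * ((𝔪 : ENNReal) / volume U) := by
    ext x
    rw [ENNReal.ofReal_add (mul_nonneg (sub_nonneg.2 hδ.2) (mollDensity_nonneg hk hε _ _))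
      (mul_nonneg hδ.1 (by positivity)), ENNReal.ofReal_mul (sub_nonneg.2 hδ.2),
      ENNReal.ofReal_mul hδ.1, ENNReal.ofReal_div_of_pos (ENNReal.toReal_pos hU0 hUt),
      ENNReal.ofReal_toReal hUt, ENNReal.ofReal_coe_nnreal]
    rfl
  rw [h2, withDensity_add_left (hm.const_smul _), withDensity_smul _ hm, withDensity_const, ← h1,
    smoothedEndpoint, uniformMeasure, smul_smul]

namespace IsGlobalCE

variable {K U : Set (Rd d)} {𝔪 : NNReal} {μ : ℝ → Measure (Rd d)}
  {ν : ℝ → VectorMeasure (Rd d) (Rd d)} (h : IsGlobalCE K 𝔪 μ ν) (hk : IsKernel k)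
  {ε δ : ℝ} (hε : 0 < ε)
include h hk hε

lemma contDiff_approxDensity (U : Set (Rd d)) (δ : ℝ) :
    ContDiff ℝ ∞ (approxDensity k U 𝔪 μ ε δ) := by
  have h1 : ContDiff ℝ ∞ fun z : ℝ × Rd d => ((1 + 2 * ε) * z.1 - ε, z.2) := by fun_prop
  exact (contDiff_const.mul ((h.curve_μ.contDiff_curveMoll hk hε).comp h1)).add contDiff_const

lemma contDiff_approxMomentum (δ : ℝ) : ContDiff ℝ ∞ (approxMomentum k ν ε δ) := by
  have h1 : ContDiff ℝ ∞ fun z : ℝ × Rd d => ((1 + 2 * ε) * z.1 - ε, z.2) := by fun_prop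
  exact ((h.contDiff_momentumMoll hk hε).comp h1).const_smul ((1 - δ) * (1 + 2 * ε))

omit h in
lemma _root_.le_approxDensity (hδ : δ ∈ Icc (0 : ℝ) 1) (z : ℝ × Rd d) :
    δ * (𝔪 / (volume U).toReal) ≤ approxDensity k U 𝔪 μ ε δ z :=
  le_add_of_nonneg_left (mul_nonneg (sub_nonneg.2 hδ.2) (curveMoll_nonneg hk hε _))

lemma deriv_approxDensity_add_divergenceAt (U : Set (Rd d)) (δ s : ℝ) (x : Rd d) :
    deriv (fun t => approxDensity k U 𝔪 μ ε δ (t, x)) s +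
      divergenceAt (fun y => approxMomentum k ν ε δ (s, y)) x = 0 := by
  have h1 := h.deriv_curveMoll_add_divergenceAt hk hε ((1 + 2 * ε) * s - ε) x
  have hd : DifferentiableAt ℝ (fun t => curveMoll k ε μ (t, x)) ((1 + 2 * ε) * s - ε) :=
    (hasDerivAt_slice ((h.curve_μ.contDiff_curveMoll hk hε).differentiable (by simp))
      _ x).differentiableAt
  have e1 : HasDerivAt (fun t => approxDensity k U 𝔪 μ ε δ (t, x))
      ((1 - δ) * (deriv (fun t => curveMoll k ε μ (t, x)) ((1 + 2 * ε) * s - ε) *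
        ((1 + 2 * ε) * 1))) s :=
    ((HasDerivAt.comp (h₂ := fun t => curveMoll k ε μ (t, x)) s hd.hasDerivAt
      (((hasDerivAt_id s).const_mul (1 + 2 * ε)).sub_const ε)).const_mul (1 - δ)).add_const _
  have hw : DifferentiableAt ℝ (fun y => momentumMoll k ε ν ((1 + 2 * ε) * s - ε, y)) x :=
    ((h.contDiff_momentumMoll hk hε).comp (contDiff_prodMk_right _)).differentiable (by simp) x
  have e2 : divergenceAt (fun y => approxMomentum k ν ε δ (s, y)) x = (1 - δ) * (1 + 2 * ε) *
      divergenceAt (fun y => momentumMoll k ε ν ((1 + 2 * ε) * s - ε, y)) x := by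
    have : fderiv ℝ (fun y => approxMomentum k ν ε δ (s, y)) x = ((1 - δ) * (1 + 2 * ε)) •
        fderiv ℝ (fun y => momentumMoll k ε ν ((1 + 2 * ε) * s - ε, y)) x :=
      fderiv_const_smul hw ((1 - δ) * (1 + 2 * ε))
    simp_rw [divergenceAt, this, Finset.mul_sum]
    rfl
  rw [e1.deriv, e2, eq_neg_of_add_eq_zero_left h1]
  ring

variable (hKU : ∀ x ∉ U, ε < Metric.infDist x K)
include hKU

lemma approxDensity_of_notMem (δ s : ℝ) {x : Rd d} (hx : x ∉ U) :
    approxDensity k U 𝔪 μ ε δ (s, x) = δ * (𝔪 / (volume U).toReal) := by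
  rw [approxDensity, h.curveMoll_eq_zero hk hε (hKU x hx), mul_zero, zero_add]

lemma approxMomentum_of_notMem (δ s : ℝ) {x : Rd d} (hx : x ∉ U) :
    approxMomentum k ν ε δ (s, x) = 0 := by
  rw [approxMomentum, h.momentumMoll_eq_zero hk hε (hKU x hx), smul_zero]

lemma integrable_curveMoll (hUb : Bornology.IsBounded U) (t : ℝ) :
    Integrable fun x => curveMoll k ε μ (t, x) := by
  refine (((h.curve_μ.contDiff_curveMoll hk hε).continuous).comp
    (Continuous.prodMk_right t)).integrable_of_hasCompactSupport
    (HasCompactSupport.intro hUb.isCompact_closure fun x hx => ?_)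
  exact h.curveMoll_eq_zero hk hε (hKU x fun hx' => hx (subset_closure hx'))

lemma withDensity_approxDensity_apply (hU : IsOpen U) (hUb : Bornology.IsBounded U)
    (hU0 : volume U ≠ 0) (hδ : δ ∈ Icc (0 : ℝ) 1) (s : ℝ) :
    (volume.restrict U).withDensity
      (fun x => ENNReal.ofReal (approxDensity k U 𝔪 μ ε δ (s, x))) U = 𝔪 := by
  have hUt := hUb.measure_lt_top (μ := volume)
  have hi := h.integrable_curveMoll hk hε hKU hUb ((1 + 2 * ε) * s - ε)
  have hc : IntegrableOn (fun _ => δ * (𝔪 / (volume U).toReal)) U := integrableOn_const hUt.ne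
  rw [withDensity_apply _ hU.measurableSet, Measure.restrict_restrict hU.measurableSet, inter_self,
    ← ofReal_integral_eq_lintegral_ofReal]
  · have h1 : ∫ x in U, approxDensity k U 𝔪 μ ε δ (s, x) = 𝔪 := by
      simp only [approxDensity]
      rw [integral_add (hi.integrableOn.const_mul _) hc, integral_const_mul,
        setIntegral_eq_integral_of_forall_compl_eq_zero (fun x hx =>
          h.curveMoll_eq_zero hk hε (hKU x hx)), h.integral_curveMoll hk hε, setIntegral_const,
        smul_eq_mul, Measure.real]
      have := ENNReal.toReal_pos hU0 hUt.ne
      field_simp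
      ring
    rw [h1, ENNReal.ofReal_coe_nnreal]
  · exact (hi.integrableOn.const_mul _).add hc
  · exact Eventually.of_forall fun x =>
      (mul_nonneg hδ.1 (by positivity)).trans (le_approxDensity hk hε hδ (s, x))

lemma isCE_approx (hU : IsOpen U) (hUb : Bornology.IsBounded U) (hfr : volume (frontier U) = 0)
    (hU0 : volume U ≠ 0) (hδ : δ ∈ Icc (0 : ℝ) 1) (h0 : ∀ s ≤ 0, μ s = μ 0)
    (h1 : ∀ s, 1 ≤ s → μ s = μ 1) :
    IsCE U (smoothedEndpoint U 𝔪 k ε δ (μ 0)) (smoothedEndpoint U 𝔪 k ε δ (μ 1))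
      (fun s => (volume.restrict U).withDensity fun x =>
        ENNReal.ofReal (approxDensity k U 𝔪 μ ε δ (s, x)))
      (fun s => (volume.restrict U).withDensityᵥ fun x => approxMomentum k ν ε δ (s, x)) := by
  have hUt := hUb.measure_lt_top (μ := volume)
  have hf0 := h.isFiniteMeasure 0
  have hf1 := h.isFiniteMeasure 1
  have e0 : ∀ x, curveMoll k ε μ ((1 + 2 * ε) * 0 - ε, x) = mollDensity k ε (μ 0) x :=
    h.curve_μ.curveMoll_eq_mollDensity hk hε fun s hs => h0 s (by
      rw [abs_lt] at hs; linarith)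
  have e1 : ∀ x, curveMoll k ε μ ((1 + 2 * ε) * 1 - ε, x) = mollDensity k ε (μ 1) x :=
    h.curve_μ.curveMoll_eq_mollDensity hk hε fun s hs => h1 s (by
      rw [abs_lt] at hs; linarith)
  have o0 : ∀ x ∉ U, mollDensity k ε (μ 0) x = 0 := fun x hx => by
    rw [← e0, h.curveMoll_eq_zero hk hε (hKU x hx)]
  have o1 : ∀ x ∉ U, mollDensity k ε (μ 1) x = 0 := fun x hx => by
    rw [← e1, h.curveMoll_eq_zero hk hε (hKU x hx)]
  rw [smoothedEndpoint_eq_withDensity hk hU.measurableSet hU0 hUt.ne 𝔪 hε hδ (μ 0) o0,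
    smoothedEndpoint_eq_withDensity hk hU.measurableSet hU0 hUt.ne 𝔪 hε hδ (μ 1) o1]
  have E0 : (fun x => ENNReal.ofReal ((1 - δ) * mollDensity k ε (μ 0) x +
      δ * (𝔪 / (volume U).toReal))) =
      fun x => ENNReal.ofReal (approxDensity k U 𝔪 μ ε δ (0, x)) := funext fun x => by
    rw [← e0]; rfl
  have E1 : (fun x => ENNReal.ofReal ((1 - δ) * mollDensity k ε (μ 1) x +
      δ * (𝔪 / (volume U).toReal))) =
      fun x => ENNReal.ofReal (approxDensity k U 𝔪 μ ε δ (1, x)) := funext fun x => by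
    rw [← e1]; rfl
  rw [E0, E1]
  refine isCE_of_contDiff hU hUb hfr (h.contDiff_approxDensity hk hε U δ)
    (h.contDiff_approxMomentum hk hε δ)
    (fun z => (mul_nonneg hδ.1 (by positivity)).trans (le_approxDensity hk hε hδ z))
    (fun s x hx => h.approxMomentum_of_notMem hk hε hKU δ s hx) (fun s x hx => ?_)
    (h.deriv_approxDensity_add_divergenceAt hk hε U δ)
  rw [funext fun t => h.approxDensity_of_notMem hk hε hKU δ t hx]
  exact deriv_const _ _

end IsGlobalCE

end Approximation

/-! ### Upper bound for the action of the approximating curves -/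

section UpperBound

variable {d : ℕ} {M : ENNReal} {m : ℝ → ℝ}

/-- Mixing a state with a state of zero momentum decreases the action density. -/
lemma IsMobility.actionDensity_mix_le (hm : IsMobility M m) {r c δ : ℝ}
    (hr : r ∈ mobilityDomain M) (hc : c ∈ mobilityDomain M) (hδ : δ ∈ Icc (0 : ℝ) 1) (v : Rd d) :
    actionDensity M m ((1 - δ) * r + δ * c) ((1 - δ) • v) ≤ actionDensity M m r v := by
  have h0 : 0 ≤ 1 - δ := sub_nonneg.2 hδ.2
  have hmem : (1 - δ) * r + δ * c ∈ mobilityDomain M :=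
    convex_mobilityDomain M hr hc h0 hδ.1 (by ring)
  -- For `δ = 1` the momentum vanishes and the action density is zero; otherwise `1 - δ` may be
  -- cancelled.
  rcases h0.eq_or_lt with h1 | h1
  · rw [← h1, zero_smul, zero_mul, zero_add, ← eq_of_sub_eq_zero h1.symm, one_mul,
      actionDensity_zero_right hc]
    exact zero_le
  · have hcv := hm.concaveOn_mobilityExt.2 hr hc h0 hδ.1 (by ring)
    simp only [smul_eq_mul] at hcv
    have hle : (1 - δ) * mobilityExt M m r ≤ mobilityExt M m ((1 - δ) * r + δ * c) :=
      (le_add_of_nonneg_right (mul_nonneg hδ.1 (hm.mobilityExt_nonneg hc))).trans hcv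
    rw [actionDensity_of_mem hmem, actionDensity_of_mem hr, clippedMobility_of_mem hmem,
      clippedMobility_of_mem hr, enorm_smul, Real.enorm_of_nonneg h0]
    set a := ENNReal.ofReal (1 - δ) with ha
    have ha0 : a ≠ 0 := (ENNReal.ofReal_pos.2 h1).ne'
    have ha1 : a ≤ 1 := ENNReal.ofReal_le_one.2 (by linarith [hδ.1])
    -- Of the two factors `1 - δ` in the numerator, one compensates the loss of mobility allowed by
    -- concavity and the other is bounded by one.
    calc (a * ‖v‖ₑ) ^ 2 / ENNReal.ofReal (mobilityExt M m ((1 - δ) * r + δ * c))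
        ≤ (a * ‖v‖ₑ) ^ 2 / ENNReal.ofReal ((1 - δ) * mobilityExt M m r) :=
          ENNReal.div_le_div_left (ENNReal.ofReal_le_ofReal hle) _
      _ = a * (a * ‖v‖ₑ ^ 2) / (a * ENNReal.ofReal (mobilityExt M m r)) := by
          rw [ENNReal.ofReal_mul h0, ← ha]; ring_nf
      _ = a * ‖v‖ₑ ^ 2 / ENNReal.ofReal (mobilityExt M m r) :=
          ENNReal.mul_div_mul_left _ _ ha0 ENNReal.ofReal_ne_top
      _ ≤ ‖v‖ₑ ^ 2 / ENNReal.ofReal (mobilityExt M m r) :=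
          ENNReal.div_le_div_right (mul_le_of_le_one_left' ha1) _

lemma measurable_timeKernel_sub (ε t : ℝ) :
    Measurable fun s => ENNReal.ofReal (timeKernel ε (t - s)) :=
  ((timeKernel_continuous ε).comp
    (continuous_const.sub continuous_id)).measurable.ennreal_ofReal

lemma isProbabilityMeasure_withDensity_timeKernel (ε t : ℝ) :
    IsProbabilityMeasure (volume.withDensity fun s => ENNReal.ofReal (timeKernel ε (t - s))) :=
  ⟨by rw [withDensity_apply _ MeasurableSet.univ, setLIntegral_univ,
    ← ofReal_integral_eq_lintegral_ofReal (integrable_timeKernel_sub ε t)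
      (Eventually.of_forall fun _ => timeKernel_nonneg _ _), integral_timeKernel_sub,
    ENNReal.ofReal_one]⟩

lemma integral_withDensity_timeKernel {E : Type*} [NormedAddCommGroup E] [NormedSpace ℝ E]
    (ε t : ℝ) (f : ℝ → E) :
    ∫ s, f s ∂(volume.withDensity fun s => ENNReal.ofReal (timeKernel ε (t - s))) =
      ∫ s, timeKernel ε (t - s) • f s := by
  rw [integral_withDensity_eq_integral_toReal_smul (measurable_timeKernel_sub ε t)
    (Eventually.of_forall fun _ => ENNReal.ofReal_lt_top)]
  simp_rw [ENNReal.toReal_ofReal (timeKernel_nonneg _ _)]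

lemma integrable_withDensity_timeKernel {E : Type*} [NormedAddCommGroup E] [NormedSpace ℝ E]
    {ε t : ℝ} {f : ℝ → E} (hf : Integrable fun s => timeKernel ε (t - s) • f s) :
    Integrable f (volume.withDensity fun s => ENNReal.ofReal (timeKernel ε (t - s))) := by
  rw [integrable_withDensity_iff_integrable_smul' (measurable_timeKernel_sub ε t)
    (Eventually.of_forall fun _ => ENNReal.ofReal_lt_top)]
  simp_rw [ENNReal.toReal_ofReal (timeKernel_nonneg _ _)]
  exact hf

/-- The integral equals `1 / (1 + 2ε)`. Bounding it by one is enough because the constant in the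
final estimate is `(1 + 2ε)²`, the square of the speed-up of the momentum. -/
lemma lintegral_timeKernel_dilate_le {ε : ℝ} (hε : 0 < ε) (r : ℝ) :
    ∫⁻ s, ENNReal.ofReal (timeKernel ε ((1 + 2 * ε) * s - ε - r)) ≤ 1 := by
  have hc : 1 + 2 * ε ≠ 0 := by positivity
  have hi : Integrable fun u => timeKernel ε (u - ε - r) := by
    simp_rw [sub_sub]
    exact (integrable_timeKernel ε).comp_sub_right _
  have h1 := Measure.integral_comp_mul_left (fun u => timeKernel ε (u - ε - r)) (1 + 2 * ε)
  have h2 : ∫ u, timeKernel ε (u - ε - r) = 1 := by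
    simp_rw [sub_sub]
    exact integral_timeKernel_sub_right ε _
  rw [h2, smul_eq_mul, mul_one] at h1
  rw [← ofReal_integral_eq_lintegral_ofReal
    (hi.comp_mul_left' hc) (Eventually.of_forall fun _ => timeKernel_nonneg _ _), h1,
    abs_of_pos (by positivity)]
  exact ENNReal.ofReal_le_one.2 (inv_le_one_of_one_le₀ (by linarith))

namespace IsGlobalCE

variable {k : Rd d → ℝ} {K U : Set (Rd d)} {𝔪 : NNReal} {μ : ℝ → Measure (Rd d)}
  {ν : ℝ → VectorMeasure (Rd d) (Rd d)} (h : IsGlobalCE K 𝔪 μ ν) (hk : IsKernel k)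
include h hk

lemma measurable_mollMomentum (η : ℝ) :
    Measurable fun p : ℝ × Rd d => mollMomentum k η (ν p.1) p.2 :=
  (WithLp.measurable_toLp 2 _).comp (measurable_pi_lambda _ fun i =>
    ((h.curve_pos i).stronglyMeasurable_mollDensity hk η).measurable.sub
      ((h.curve_neg i).stronglyMeasurable_mollDensity hk η).measurable)

lemma measurable_actionDensity_moll (hm : IsMobility M m) (η : ℝ) :
    Measurable fun p : ℝ × Rd d =>
      actionDensity M m (mollDensity k η (μ p.1) p.2) (mollMomentum k η (ν p.1) p.2) :=
  hm.measurable_actionDensity.comp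
    ((h.curve_μ.stronglyMeasurable_mollDensity hk η).measurable.prodMk
      (h.measurable_mollMomentum hk η))

variable {ε : ℝ} (hε : 0 < ε) (hadm : ∀ s, IsAdmissible M (μ s))
include hε hadm

/-- At a fixed point `x`, the time kernel is a probability density, so Jensen's inequality applies
to the time average of the space mollifications. -/
lemma curveMoll_mem (hm : IsMobility M m) (t : ℝ) (x : Rd d) :
    curveMoll k ε μ (t, x) ∈ mobilityDomain M ∧
    actionDensity M m (curveMoll k ε μ (t, x)) (momentumMoll k ε ν (t, x)) ≤
      ∫⁻ s, ENNReal.ofReal (timeKernel ε (t - s)) *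
        actionDensity M m (mollDensity k ε (μ s) x) (mollMomentum k ε (ν s) x) := by
  have hprob := isProbabilityMeasure_withDensity_timeKernel ε t
  have hR := integrable_withDensity_timeKernel
    (h.curve_μ.integrable_timeKernel_mul_mollDensity hk hε t x)
  have hW := integrable_withDensity_timeKernel (h.momentumMoll_eq_integral hk hε t x).1
  have hS : ∀ s, mollDensity k ε (μ s) x ∈ mobilityDomain M := fun s => by
    have := h.isFiniteMeasure s
    exact mollDensity_mem hk hε (hadm s) x
  have e1 := integral_withDensity_timeKernel ε t fun s => mollDensity k ε (μ s) x
  have e2 := integral_withDensity_timeKernel ε t fun s => mollMomentum k ε (ν s) x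
  simp_rw [smul_eq_mul] at e1
  rw [← h.curve_μ.curveMoll_eq_integral hk hε] at e1
  rw [← (h.momentumMoll_eq_integral hk hε t x).2] at e2
  have h1 := (hm.integral_clippedMobility_le hR (Eventually.of_forall hS)).1
  have h2 := hm.actionDensity_integral_le hR hW (Eventually.of_forall hS)
  rw [e1] at h1 h2
  have hgm : Measurable fun s =>
      actionDensity M m (mollDensity k ε (μ s) x) (mollMomentum k ε (ν s) x) :=
    (h.measurable_actionDensity_moll hk hm ε).comp measurable_prodMk_right
  rw [e2, lintegral_withDensity_eq_lintegral_mul _ (measurable_timeKernel_sub ε t) hgm] at h2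
  exact ⟨h1, h2⟩

omit hk in
-- The uniform state must respect the threshold: `μ` is carried by `K ⊆ U` and bounded by `M` times
-- the volume, so its mass is at most `M` times the volume of `U`.
lemma mass_div_mem (hKU : ∀ x ∉ U, ε < Metric.infDist x K)
    (hUb : Bornology.IsBounded U) (hU0 : volume U ≠ 0) :
    (𝔪 : ℝ) / (volume U).toReal ∈ mobilityDomain M := by
  refine ⟨by positivity, ?_⟩
  have hUt := (hUb.measure_lt_top (μ := volume)).ne
  rw [ENNReal.ofReal_div_of_pos (ENNReal.toReal_pos hU0 hUt), ENNReal.ofReal_toReal hUt,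
    ENNReal.ofReal_coe_nnreal]
  rcases eq_or_ne M ⊤ with hM | hM
  · rw [hM]; exact le_top
  have hsub : Uᶜ ⊆ Kᶜ := fun x hx hxK => by
    have := hKU x hx
    rw [Metric.infDist_zero_of_mem hxK] at this
    linarith
  have h1 : μ 0 univ ≤ μ 0 U := by
    rw [← union_compl_self U]
    refine (measure_union_le _ _).trans ?_
    rw [measure_mono_null hsub (h.concentrated_μ 0), add_zero]
  rw [h.mass] at h1
  refine ENNReal.div_le_of_le_mul (h1.trans ((hadm 0 hM.lt_top) U) |>.trans ?_)
  simp

/-- The action of the approximating curve is controlled by the action of the space mollification. -/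
lemma curveAction_approx_le (hm : IsMobility M m) (hKU : ∀ x ∉ U, ε < Metric.infDist x K)
    (hU : IsOpen U) (hUb : Bornology.IsBounded U) (hU0 : volume U ≠ 0) {δ : ℝ}
    (hδ : δ ∈ Icc (0 : ℝ) 1) :
    curveAction M m U
      (fun s => (volume.restrict U).withDensity fun x =>
        ENNReal.ofReal (approxDensity k U 𝔪 μ ε δ (s, x)))
      (fun s => (volume.restrict U).withDensityᵥ fun x => approxMomentum k ν ε δ (s, x)) ≤
    ENNReal.ofReal ((1 + 2 * ε) ^ 2) * ∫⁻ s, ∫⁻ x,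
      actionDensity M m (mollDensity k ε (μ s) x) (mollMomentum k ε (ν s) x) := by
  set g : ℝ → Rd d → ENNReal := fun s x =>
    actionDensity M m (mollDensity k ε (μ s) x) (mollMomentum k ε (ν s) x) with hg
  have hgm : Measurable fun p : ℝ × Rd d => g p.1 p.2 := h.measurable_actionDensity_moll hk hm ε
  have hpt : ∀ s x, actionDensity M m (approxDensity k U 𝔪 μ ε δ (s, x))
      (approxMomentum k ν ε δ (s, x)) ≤ ENNReal.ofReal ((1 + 2 * ε) ^ 2) *
        ∫⁻ r, ENNReal.ofReal (timeKernel ε ((1 + 2 * ε) * s - ε - r)) * g r x := by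
    intro s x
    obtain ⟨h1, h2⟩ := h.curveMoll_mem hk hε hadm hm ((1 + 2 * ε) * s - ε) x
    refine le_trans ?_ (mul_le_mul_right h2 _)
    -- The time change scales the momentum by `1 + 2ε`, and the action density is homogeneous of
    -- degree two in it. The mixture with the state at rest only lowers the density of action.
    rw [← actionDensity_smul h1 (by positivity), approxDensity, approxMomentum, mul_smul]
    exact hm.actionDensity_mix_le h1 (h.mass_div_mem hε hadm hKU hUb hU0) hδ _
  have hρm : ∀ s, Measurable fun x => approxDensity k U 𝔪 μ ε δ (s, x) := fun s =>
    ((h.contDiff_approxDensity hk hε U δ).continuous.comp (Continuous.prodMk_right s)).measurable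
  have hwi : ∀ s, IntegrableOn (fun x => approxMomentum k ν ε δ (s, x)) U := fun s =>
    (((h.contDiff_approxMomentum hk hε δ).continuous.comp
      (Continuous.prodMk_right s)).continuousOn.integrableOn_compact
      hUb.isCompact_closure).mono_set subset_closure
  have hkm : Measurable fun p : (ℝ × Rd d) × ℝ =>
      ENNReal.ofReal (timeKernel ε ((1 + 2 * ε) * p.1.1 - ε - p.2)) :=
    ((timeKernel_continuous ε).comp (by fun_prop)).measurable.ennreal_ofReal
  have hkm2 : Measurable fun p : ℝ × ℝ =>
      ENNReal.ofReal (timeKernel ε ((1 + 2 * ε) * p.1 - ε - p.2)) :=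
    ((timeKernel_continuous ε).comp (by fun_prop)).measurable.ennreal_ofReal
  rw [curveAction]
  simp_rw [actionFunctional_withDensity hU.measurableSet (hρm _) (fun x =>
    (mul_nonneg hδ.1 (by positivity)).trans (le_approxDensity hk hε hδ (_, x))) (hwi _)]
  calc _ ≤ ∫⁻ s, ∫⁻ x, ENNReal.ofReal ((1 + 2 * ε) ^ 2) *
        ∫⁻ r, ENNReal.ofReal (timeKernel ε ((1 + 2 * ε) * s - ε - r)) * g r x := by
        refine (lintegral_mono' Measure.restrict_le_self fun s => ?_)
        exact lintegral_mono' Measure.restrict_le_self (hpt s)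
    _ = ENNReal.ofReal ((1 + 2 * ε) ^ 2) * ∫⁻ s, ∫⁻ x,
        ∫⁻ r, ENNReal.ofReal (timeKernel ε ((1 + 2 * ε) * s - ε - r)) * g r x := by
        simp_rw [lintegral_const_mul' _ _ ENNReal.ofReal_ne_top]
    _ = ENNReal.ofReal ((1 + 2 * ε) ^ 2) * ∫⁻ r,
        (∫⁻ s, ENNReal.ofReal (timeKernel ε ((1 + 2 * ε) * s - ε - r))) * ∫⁻ x, g r x := by
        congr 1
        have e1 : ∀ s, ∫⁻ x, ∫⁻ r, ENNReal.ofReal (timeKernel ε ((1 + 2 * ε) * s - ε - r)) * g r x =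
            ∫⁻ r, ENNReal.ofReal (timeKernel ε ((1 + 2 * ε) * s - ε - r)) * ∫⁻ x, g r x := by
          intro s
          rw [lintegral_lintegral_swap]
          · simp_rw [lintegral_const_mul' _ _ ENNReal.ofReal_ne_top]
          · exact ((hkm.comp (f := fun p : Rd d × ℝ => ((s, p.1), p.2)) (by fun_prop)).mul
              (hgm.comp measurable_swap)).aemeasurable
        simp_rw [e1]
        have hG : Measurable fun r => ∫⁻ x, g r x := hgm.lintegral_prod_right'
        rw [lintegral_lintegral_swap]
        · refine lintegral_congr fun r => ?_
          have hkr : Measurable fun s => ENNReal.ofReal (timeKernel ε ((1 + 2 * ε) * s - ε - r)) :=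
            ((timeKernel_continuous ε).comp (by fun_prop)).measurable.ennreal_ofReal
          exact lintegral_mul_const _ hkr
        · exact (hkm2.mul (hG.comp measurable_snd)).aemeasurable
    _ ≤ ENNReal.ofReal ((1 + 2 * ε) ^ 2) * ∫⁻ r, ∫⁻ x, g r x :=
        mul_le_mul_right (lintegral_mono fun r =>
          mul_le_of_le_one_left' (lintegral_timeKernel_dilate_le hε r)) _

end IsGlobalCE

end UpperBound

/-! ### Lower semicontinuity of the action along the approximation -/

section LowerBound

variable {d : ℕ} {M : ENNReal} {m : ℝ → ℝ} {k : Rd d → ℝ}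

/-- The approximating curve of measures. -/
noncomputable def approxCurve (k : Rd d → ℝ) (U : Set (Rd d)) (𝔪 : NNReal)
    (μ : ℝ → Measure (Rd d)) (ε δ s : ℝ) : Measure (Rd d) :=
  (volume.restrict U).withDensity fun x => ENNReal.ofReal (approxDensity k U 𝔪 μ ε δ (s, x))

/-- The approximating curve of momenta. -/
noncomputable def approxFlux (k : Rd d → ℝ) (U : Set (Rd d))
    (ν : ℝ → VectorMeasure (Rd d) (Rd d)) (ε δ s : ℝ) : VectorMeasure (Rd d) (Rd d) :=
  (volume.restrict U).withDensityᵥ fun x => approxMomentum k ν ε δ (s, x)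

/-- Fatou's lemma for an iterated integral, with convergence in the outer variable. -/
lemma lintegral_lintegral_le_liminf {α β : Type*} [MeasurableSpace α] [MeasurableSpace β]
    {τ : Measure α} {σ : Measure β} [SFinite τ] [SFinite σ] {g₀ : α → β → ENNReal}
    {g : ℕ → α → β → ENNReal} (h0 : Measurable fun p : α × β => g₀ p.1 p.2)
    (hg : ∀ n, Measurable fun p : α × β => g n p.1 p.2)
    (hle : ∀ x, ∀ᵐ s ∂τ, g₀ s x ≤ liminf (fun n => g n s x) atTop) :
    ∫⁻ s, ∫⁻ x, g₀ s x ∂σ ∂τ ≤ liminf (fun n => ∫⁻ s, ∫⁻ x, g n s x ∂σ ∂τ) atTop := by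
  have hg' : ∀ n, Measurable fun p : β × α => g n p.2 p.1 := fun n => (hg n).comp measurable_swap
  -- The exceptional set of times may depend on `x`; exchanging the integrals makes this harmless.
  calc ∫⁻ s, ∫⁻ x, g₀ s x ∂σ ∂τ = ∫⁻ x, ∫⁻ s, g₀ s x ∂τ ∂σ :=
        lintegral_lintegral_swap h0.aemeasurable
    _ ≤ ∫⁻ x, ∫⁻ s, liminf (fun n => g n s x) atTop ∂τ ∂σ :=
        lintegral_mono fun x => lintegral_mono_ae (hle x)
    _ ≤ ∫⁻ x, liminf (fun n => ∫⁻ s, g n s x ∂τ) atTop ∂σ :=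
        lintegral_mono fun x => lintegral_liminf_le fun n =>
          (hg n).comp (measurable_prodMk_right (y := x))
    _ ≤ liminf (fun n => ∫⁻ x, ∫⁻ s, g n s x ∂τ ∂σ) atTop :=
        lintegral_liminf_le fun n => (hg' n).lintegral_prod_right'
    _ = _ := by
        congr 1
        exact funext fun n => lintegral_lintegral_swap (hg' n).aemeasurable

namespace IsGlobalCE

variable {K U : Set (Rd d)} {𝔪 : NNReal} {μ : ℝ → Measure (Rd d)}
  {ν : ℝ → VectorMeasure (Rd d) (Rd d)} (h : IsGlobalCE K 𝔪 μ ν) (hk : IsKernel k)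
include h hk

section Single

variable {ε δ : ℝ} (hε : 0 < ε) (hδ : δ ∈ Icc (0 : ℝ) 1)
include hε

lemma integrableOn_approxDensity (hUb : Bornology.IsBounded U) (δ s : ℝ) :
    IntegrableOn (fun x => approxDensity k U 𝔪 μ ε δ (s, x)) U :=
  (((h.contDiff_approxDensity hk hε U δ).continuous.comp
    (Continuous.prodMk_right s)).continuousOn.integrableOn_compact
      hUb.isCompact_closure).mono_set subset_closure

lemma integrableOn_approxMomentum (hUb : Bornology.IsBounded U) (δ s : ℝ) :
    IntegrableOn (fun x => approxMomentum k ν ε δ (s, x)) U :=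
  (((h.contDiff_approxMomentum hk hε δ).continuous.comp
    (Continuous.prodMk_right s)).continuousOn.integrableOn_compact
      hUb.isCompact_closure).mono_set subset_closure

lemma isFiniteMeasure_approxCurve (hUb : Bornology.IsBounded U) (δ s : ℝ) :
    IsFiniteMeasure (approxCurve k U 𝔪 μ ε δ s) :=
  isFiniteMeasure_withDensity_ofReal (h.integrableOn_approxDensity hk hε hUb δ s).2

include hδ

lemma integral_approxCurve (s : ℝ) (f : Rd d → ℝ) :
    ∫ x, f x ∂approxCurve k U 𝔪 μ ε δ s =
      ∫ x in U, f x * approxDensity k U 𝔪 μ ε δ (s, x) := by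
  have hρm : Measurable fun x => ENNReal.ofReal (approxDensity k U 𝔪 μ ε δ (s, x)) :=
    ((h.contDiff_approxDensity hk hε U δ).continuous.comp
      (Continuous.prodMk_right s)).measurable.ennreal_ofReal
  rw [approxCurve, integral_withDensity_eq_integral_toReal_smul hρm (by simp)]
  refine integral_congr_ae (Eventually.of_forall fun x => ?_)
  simp only [smul_eq_mul]
  rw [ENNReal.toReal_ofReal ((mul_nonneg hδ.1 (by positivity)).trans
    (le_approxDensity hk hε hδ (s, x))), mul_comm]

lemma isAdmissible_approxCurve (hadm : ∀ s, IsAdmissible M (μ s)) (hm : IsMobility M m)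
    (hKU : ∀ x ∉ U, ε < Metric.infDist x K) (hUb : Bornology.IsBounded U) (hU0 : volume U ≠ 0)
    (s : ℝ) : IsAdmissible M (approxCurve k U 𝔪 μ ε δ s) := by
  intro _
  have hmem : ∀ x, approxDensity k U 𝔪 μ ε δ (s, x) ∈ mobilityDomain M := fun x =>
    convex_mobilityDomain M (h.curveMoll_mem hk hε hadm hm _ x).1
      (h.mass_div_mem hε hadm hKU hUb hU0) (sub_nonneg.2 hδ.2) hδ.1 (by ring)
  calc approxCurve k U 𝔪 μ ε δ s ≤ (volume.restrict U).withDensity fun _ => M :=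
        withDensity_mono (Eventually.of_forall fun x => (hmem x).2)
    _ = M • volume.restrict U := withDensity_const _
    _ ≤ M • volume := by
        refine Measure.le_iff.2 fun B _ => ?_
        simp only [Measure.smul_apply, smul_eq_mul]
        exact mul_le_mul_right (Measure.restrict_le_self B) _

lemma mollDensity_approxCurve (η s : ℝ) (x : Rd d) :
    mollDensity k η (approxCurve k U 𝔪 μ ε δ s) x =
      ∫ y in U, rescaledKernel k η (x - y) * approxDensity k U 𝔪 μ ε δ (s, y) :=
  h.integral_approxCurve hk hε hδ s _

omit hδ in
lemma mollMomentum_approxFlux (hUb : Bornology.IsBounded U) {η : ℝ} (hη : 0 < η) (δ s : ℝ)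
    (x : Rd d) :
    mollMomentum k η (approxFlux k U ν ε δ s) x =
      ∫ y in U, rescaledKernel k η (x - y) • approxMomentum k ν ε δ (s, y) := by
  obtain ⟨C, _, hC⟩ := hk.rescaledKernel_exists_le hη
  refine vecIntegral_withDensityᵥ (h.integrableOn_approxMomentum hk hε hUb δ s)
    ((hk.rescaledKernel_continuous η).comp (continuous_const.sub continuous_id)).measurable
    (C := C) fun y => ?_
  rw [abs_of_nonneg (hk.rescaledKernel_nonneg hη _)]
  exact hC _

lemma measurable_actionDensity_approx (hm : IsMobility M m) (hUb : Bornology.IsBounded U) {η : ℝ}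
    (hη : 0 < η) : Measurable fun p : ℝ × Rd d =>
      actionDensity M m (mollDensity k η (approxCurve k U 𝔪 μ ε δ p.1) p.2)
        (mollMomentum k η (approxFlux k U ν ε δ p.1) p.2) := by
  simp_rw [h.mollDensity_approxCurve hk hε hδ, h.mollMomentum_approxFlux hk hε hUb hη]
  have c1 : Continuous fun q : (ℝ × Rd d) × Rd d => rescaledKernel k η (q.1.2 - q.2) :=
    (hk.rescaledKernel_continuous η).comp (by fun_prop)
  have c2 : Continuous fun q : (ℝ × Rd d) × Rd d => approxDensity k U 𝔪 μ ε δ (q.1.1, q.2) :=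
    (h.contDiff_approxDensity hk hε U δ).continuous.comp (by fun_prop)
  have c3 : Continuous fun q : (ℝ × Rd d) × Rd d => approxMomentum k ν ε δ (q.1.1, q.2) :=
    (h.contDiff_approxMomentum hk hε δ).continuous.comp (by fun_prop)
  have m1 : StronglyMeasurable fun p : ℝ × Rd d =>
      ∫ y in U, rescaledKernel k η (p.2 - y) * approxDensity k U 𝔪 μ ε δ (p.1, y) :=
    (c1.mul c2).stronglyMeasurable.integral_prod_right'
  have m2 : StronglyMeasurable fun p : ℝ × Rd d =>
      ∫ y in U, rescaledKernel k η (p.2 - y) • approxMomentum k ν ε δ (p.1, y) :=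
    (c1.smul c3).stronglyMeasurable.integral_prod_right'
  exact hm.measurable_actionDensity.comp (m1.measurable.prodMk m2.measurable)

end Single

section Sequence

variable {ε δ : ℕ → ℝ} {U : ℕ → Set (Rd d)} (hε0 : ∀ n, 0 < ε n) (hε : Tendsto ε atTop (𝓝 0))
  (hδ : ∀ n, δ n ∈ Icc (0 : ℝ) 1) (hδ0 : Tendsto δ atTop (𝓝 0))
  (hUb : ∀ n, Bornology.IsBounded (U n)) (hU0 : ∀ n, volume (U n) ≠ 0)
  (hKU : ∀ n, ∀ x ∉ U n, ε n < Metric.infDist x K)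
include hε0 hε hδ hδ0 hKU

omit hk h hε0 hε hδ hδ0 hKU in
-- The displacement of the time change is `ε (2s - 1)`. It lies within the radius of the time
-- kernel, as the differentiation theorem requires.
lemma _root_.abs_dilate_sub_le {ε s : ℝ} (hε : 0 < ε) (hs : s ∈ Ioo (0 : ℝ) 1) :
    |(1 + 2 * ε) * s - ε - s| ≤ ε := by
  rw [abs_le]
  constructor <;> nlinarith [hs.1, hs.2]

-- For fixed `η` and `x` this is the integral of the fixed test function `k_η(x - ·)`, so
-- convergence at almost every time applies. The uniform part contributes at most `δ_n 𝔪 C`, where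
-- `C` bounds the kernel, whatever the volume of `U n`.
include hUb hU0 in
lemma ae_tendsto_mollDensity_approxCurve {η : ℝ} (hη : 0 < η) (x : Rd d) :
    ∀ᵐ s, s ∈ Ioo (0 : ℝ) 1 →
      Tendsto (fun n => mollDensity k η (approxCurve k (U n) 𝔪 μ (ε n) (δ n) s) x) atTop
        (𝓝 (mollDensity k η (μ s) x)) := by
  obtain ⟨C, hC0, hC⟩ := hk.rescaledKernel_exists_le hη
  have hcont : Continuous fun y => rescaledKernel k η (x - y) :=
    (hk.rescaledKernel_continuous η).comp (continuous_const.sub continuous_id)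
  have hcs : HasCompactSupport fun y => rescaledKernel k η (x - y) :=
    (hk.rescaledKernel_hasCompactSupport hη).comp_homeomorph (Homeomorph.subLeft x)
  have hbd : ∀ y, |rescaledKernel k η (x - y)| ≤ C := fun y => by
    rw [abs_of_nonneg (hk.rescaledKernel_nonneg hη _)]; exact hC _
  filter_upwards [h.curve_μ.ae_tendsto_integral_mul_curveMoll hk
    (hcs.uniformContinuous_of_continuous hcont) hbd] with s hs hs01
  have h1 := hs ε (fun n => (1 + 2 * ε n) * s - ε n) hε0 hε fun n => abs_dilate_sub_le (hε0 n) hs01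
  have hUt := fun n => ((hUb n).measure_lt_top (μ := volume)).ne
  have hfi : Integrable fun y => rescaledKernel k η (x - y) :=
    hcont.integrable_of_hasCompactSupport hcs
  have e1 : ∀ n, mollDensity k η (approxCurve k (U n) 𝔪 μ (ε n) (δ n) s) x =
      (1 - δ n) * (∫ y, rescaledKernel k η (x - y) *
        curveMoll k (ε n) μ ((1 + 2 * ε n) * s - ε n, y)) +
      δ n * ((𝔪 / (volume (U n)).toReal) * ∫ y in U n, rescaledKernel k η (x - y)) := by
    intro n
    have hRi := (h.integrable_curveMoll hk (hε0 n) (hKU n) (hUb n)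
      ((1 + 2 * ε n) * s - ε n)).bdd_mul (c := C) hcont.aestronglyMeasurable
      (Eventually.of_forall hbd)
    have hout : ∫ y in U n, rescaledKernel k η (x - y) *
        curveMoll k (ε n) μ ((1 + 2 * ε n) * s - ε n, y) = ∫ y, rescaledKernel k η (x - y) *
        curveMoll k (ε n) μ ((1 + 2 * ε n) * s - ε n, y) :=
      setIntegral_eq_integral_of_forall_compl_eq_zero fun y hy => by
        rw [h.curveMoll_eq_zero hk (hε0 n) (hKU n y hy), mul_zero]
    rw [h.mollDensity_approxCurve hk (hε0 n) (hδ n), ← hout, ← mul_assoc,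
      ← integral_const_mul, ← integral_const_mul, ← integral_add (hRi.integrableOn.const_mul _)
        (hfi.integrableOn.const_mul _)]
    refine integral_congr_ae (Eventually.of_forall fun y => ?_)
    simp only [approxDensity]
    ring
  have h2 : Tendsto (fun n => δ n * ((𝔪 / (volume (U n)).toReal) *
      ∫ y in U n, rescaledKernel k η (x - y))) atTop (𝓝 0) := by
    refine squeeze_zero (fun n => mul_nonneg (hδ n).1 (mul_nonneg (by positivity)
      (integral_nonneg fun y => hk.rescaledKernel_nonneg hη _))) (fun n => ?_)
      (by simpa using hδ0.mul_const ((𝔪 : ℝ) * C))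
    refine mul_le_mul_of_nonneg_left ?_ (hδ n).1
    have hpos := ENNReal.toReal_pos (hU0 n) (hUt n)
    have h3 : ∫ y in U n, rescaledKernel k η (x - y) ≤ C * (volume (U n)).toReal := by
      refine (setIntegral_mono hfi.integrableOn (integrableOn_const (hUt n)) fun y =>
        hC (x - y)).trans ?_
      rw [setIntegral_const, smul_eq_mul, Measure.real, mul_comm]
    calc (𝔪 : ℝ) / (volume (U n)).toReal * ∫ y in U n, rescaledKernel k η (x - y)
        ≤ (𝔪 : ℝ) / (volume (U n)).toReal * (C * (volume (U n)).toReal) :=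
          mul_le_mul_of_nonneg_left h3 (by positivity)
      _ = 𝔪 * C := by field_simp
  have h3 := ((hδ0.const_sub 1).mul h1).add h2
  rw [sub_zero, one_mul, add_zero] at h3
  exact h3.congr fun n => (e1 n).symm

omit hδ in
include hUb in
lemma ae_tendsto_mollMomentum_approxFlux {η : ℝ} (hη : 0 < η) (x : Rd d) :
    ∀ᵐ s, s ∈ Ioo (0 : ℝ) 1 →
      Tendsto (fun n => mollMomentum k η (approxFlux k (U n) ν (ε n) (δ n) s) x) atTop
        (𝓝 (mollMomentum k η (ν s) x)) := by
  obtain ⟨C, hC0, hC⟩ := hk.rescaledKernel_exists_le hη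
  have hcont : Continuous fun y => rescaledKernel k η (x - y) :=
    (hk.rescaledKernel_continuous η).comp (continuous_const.sub continuous_id)
  have hcs : HasCompactSupport fun y => rescaledKernel k η (x - y) :=
    (hk.rescaledKernel_hasCompactSupport hη).comp_homeomorph (Homeomorph.subLeft x)
  have hbd : ∀ y, |rescaledKernel k η (x - y)| ≤ C := fun y => by
    rw [abs_of_nonneg (hk.rescaledKernel_nonneg hη _)]; exact hC _
  have huc := hcs.uniformContinuous_of_continuous hcont
  have hP := ae_all_iff.2 fun i => (h.curve_pos i).ae_tendsto_integral_mul_curveMoll hk huc hbd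
  have hN := ae_all_iff.2 fun i => (h.curve_neg i).ae_tendsto_integral_mul_curveMoll hk huc hbd
  filter_upwards [hP, hN] with s hsP hsN hs01
  have habs := fun n => abs_dilate_sub_le (hε0 n) hs01
  set P : ℕ → Fin d → ℝ := fun n i => ∫ y, rescaledKernel k η (x - y) *
    curveMoll k (ε n) (fun s => posComp (ν s) i) ((1 + 2 * ε n) * s - ε n, y) with hPd
  set N : ℕ → Fin d → ℝ := fun n i => ∫ y, rescaledKernel k η (x - y) *
    curveMoll k (ε n) (fun s => negComp (ν s) i) ((1 + 2 * ε n) * s - ε n, y) with hNd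
  have hci : ∀ {κ : ℝ → Measure (Rd d)}, IsMeasureCurve κ → ∀ n, Integrable fun y =>
      rescaledKernel k η (x - y) * curveMoll k (ε n) κ ((1 + 2 * ε n) * s - ε n, y) :=
    fun hκ n => (hcont.mul ((hκ.contDiff_curveMoll hk (hε0 n)).continuous.comp
      (Continuous.prodMk_right _))).integrable_of_hasCompactSupport hcs.mul_right
  have e1 : ∀ n, mollMomentum k η (approxFlux k (U n) ν (ε n) (δ n) s) x =
      WithLp.toLp 2 fun i => ((1 - δ n) * (1 + 2 * ε n)) * (P n i - N n i) := by
    intro n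
    have hcomp : ∀ i y, (rescaledKernel k η (x - y) • approxMomentum k ν (ε n) (δ n) (s, y)) i =
        ((1 - δ n) * (1 + 2 * ε n)) * (rescaledKernel k η (x - y) *
          curveMoll k (ε n) (fun s => posComp (ν s) i) ((1 + 2 * ε n) * s - ε n, y) -
          rescaledKernel k η (x - y) *
          curveMoll k (ε n) (fun s => negComp (ν s) i) ((1 + 2 * ε n) * s - ε n, y)) :=
      fun i y => by
        simp only [approxMomentum, momentumMoll, PiLp.smul_apply, smul_eq_mul]
        ring
    rw [h.mollMomentum_approxFlux hk (hε0 n) (hUb n) hη,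
      setIntegral_eq_integral_of_forall_compl_eq_zero fun y hy => by
        rw [h.approxMomentum_of_notMem hk (hε0 n) (hKU n) _ _ hy, smul_zero]]
    ext i
    have hd : ∀ i, Integrable fun y => rescaledKernel k η (x - y) *
          curveMoll k (ε n) (fun s => posComp (ν s) i) ((1 + 2 * ε n) * s - ε n, y) -
          rescaledKernel k η (x - y) *
          curveMoll k (ε n) (fun s => negComp (ν s) i) ((1 + 2 * ε n) * s - ε n, y) := fun i =>
      (hci (h.curve_pos i) n).sub (hci (h.curve_neg i) n)
    rw [eval_integral_piLp (fun i => by simp_rw [hcomp]; exact (hd i).const_mul _)]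
    simp_rw [hcomp]
    rw [integral_const_mul, integral_sub (hci (h.curve_pos i) n) (hci (h.curve_neg i) n)]
  have hc : Tendsto (fun n => (1 - δ n) * (1 + 2 * ε n)) atTop (𝓝 1) := by
    simpa using (hδ0.const_sub 1).mul ((hε.const_mul 2).const_add 1)
  simp_rw [e1]
  refine ((PiLp.continuous_toLp 2 _).tendsto _).comp (tendsto_pi_nhds.2 fun i => ?_)
  have hlim := hc.mul ((hsP i ε (fun n => (1 + 2 * ε n) * s - ε n) hε0 hε habs).sub
    (hsN i ε (fun n => (1 + 2 * ε n) * s - ε n) hε0 hε habs))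
  rw [one_mul] at hlim
  exact hlim

include hUb hU0 in
/-- Lower semicontinuity of the action along the approximation, at a fixed mollification scale. -/
lemma lintegral_moll_le_liminf (hm : IsMobility M m) (hadm : ∀ s, IsAdmissible M (μ s))
    (hU : ∀ n, IsOpen (U n)) (hfr : ∀ n, volume (frontier (U n)) = 0) {η : ℝ} (hη : 0 < η) :
    ∫⁻ s in Ioo (0 : ℝ) 1, ∫⁻ x,
      actionDensity M m (mollDensity k η (μ s) x) (mollMomentum k η (ν s) x) ≤
    liminf (fun n => curveAction M m (U n) (approxCurve k (U n) 𝔪 μ (ε n) (δ n))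
      (approxFlux k (U n) ν (ε n) (δ n))) atTop := by
  -- The second scale `η` turns weak convergence into pointwise convergence of densities, to which
  -- lower semicontinuity of the integrand and Fatou apply. This mollification of the approximations
  -- is then dropped because it does not increase the action.
  refine (lintegral_lintegral_le_liminf
    (g₀ := fun s x => actionDensity M m (mollDensity k η (μ s) x) (mollMomentum k η (ν s) x))
    (g := fun n s x => actionDensity M m
      (mollDensity k η (approxCurve k (U n) 𝔪 μ (ε n) (δ n) s) x)
      (mollMomentum k η (approxFlux k (U n) ν (ε n) (δ n) s) x))
    (h.measurable_actionDensity_moll hk hm η)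
    (fun n => h.measurable_actionDensity_approx (𝔪 := 𝔪) hk (hε0 n) (hδ n) hm (hUb n) hη)
    fun x => ?_).trans (liminf_le_liminf (Eventually.of_forall fun n => lintegral_mono fun s => ?_))
  · rw [ae_restrict_iff' measurableSet_Ioo]
    filter_upwards [h.ae_tendsto_mollDensity_approxCurve hk hε0 hε hδ hδ0 hUb hU0 hKU hη x,
      h.ae_tendsto_mollMomentum_approxFlux hk hε0 hε hδ0 hUb hKU hη x] with s h1 h2 hs
    refine hm.actionDensity_le_liminf (h1 hs) (h2 hs) fun n => ?_
    have := h.isFiniteMeasure_approxCurve hk (hε0 n) (hUb n) (δ n) s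
    exact mollDensity_mem hk hη
      (h.isAdmissible_approxCurve hk (hε0 n) (hδ n) hadm hm (hKU n) (hUb n) (hU0 n) s) x
  · have := h.isFiniteMeasure_approxCurve hk (hε0 n) (hUb n) (δ n) s
    exact hm.lintegral_actionDensity_moll_le hk hη (hfr n) (hU n)

include hUb hU0 in
/-- Lower semicontinuity of the action along the approximation. -/
lemma curveAction_le_liminf (hm : IsMobility M m) (hadm : ∀ s, IsAdmissible M (μ s))
    (hU : ∀ n, IsOpen (U n)) (hfr : ∀ n, volume (frontier (U n)) = 0)
    {Ω : Set (Rd d)} (hΩ : IsOpen Ω) (hΩb : Bornology.IsBounded Ω)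
    (hΩfr : volume (frontier Ω) = 0) (hKΩ : K = closure Ω) :
    curveAction M m Ω μ ν ≤
    liminf (fun n => curveAction M m (U n) (approxCurve k (U n) 𝔪 μ (ε n) (δ n))
      (approxFlux k (U n) ν (ε n) (δ n))) atTop := by
  set η : ℕ → ℝ := fun n => 1 / ((n : ℝ) + 1) with hηd
  have hη0 : ∀ n, 0 < η n := fun n => by positivity
  have hη : Tendsto η atTop (𝓝 0) := tendsto_one_div_add_atTop_nhds_zero_nat
  calc curveAction M m Ω μ ν
      ≤ ∫⁻ s in Ioo (0 : ℝ) 1, liminf (fun n => ∫⁻ x, actionDensity M m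
          (mollDensity k (η n) (μ s) x) (mollMomentum k (η n) (ν s) x)) atTop := by
        refine lintegral_mono fun s => ?_
        have := h.isFiniteMeasure s
        exact hm.actionFunctional_le_liminf hk hΩfr hΩ hΩb (hKΩ ▸ h.concentrated_μ s)
          (hKΩ ▸ h.concentrated_ν s) (hadm s) hη0 hη
    _ ≤ liminf (fun n => ∫⁻ s in Ioo (0 : ℝ) 1, ∫⁻ x, actionDensity M m
          (mollDensity k (η n) (μ s) x) (mollMomentum k (η n) (ν s) x)) atTop :=
        lintegral_liminf_le fun n =>
          (h.measurable_actionDensity_moll hk hm (η n)).lintegral_prod_right'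
    -- The bound at each scale `η` does not depend on the scale, hence one index is enough.
    _ ≤ _ := liminf_le_of_le (by isBoundedDefault) fun b hb => by
        obtain ⟨n, hn⟩ := hb.exists
        exact hn.trans (h.lintegral_moll_le_liminf hk hε0 hε hδ hδ0 hUb hU0 hKU hm hadm hU hfr
          (hη0 n))

end Sequence

end IsGlobalCE

end LowerBound

/-! ### Return from the extended curve to the original one, and conclusion -/

section Assembly

variable {d : ℕ} {M : ENNReal} {m : ℝ → ℝ} {k : Rd d → ℝ} {Ω : Set (Rd d)}
  {μ₀ μ₁ : Measure (Rd d)} {μ : ℝ → Measure (Rd d)} {ν : ℝ → VectorMeasure (Rd d) (Rd d)}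

lemma lt_infDist_closure_of_notMem_smoothNhd (hk : IsKernel k) {ε : ℝ} (hε : 0 < ε) {x : Rd d}
    (hx : x ∉ smoothNhd k Ω ε) : ε < Metric.infDist x (closure Ω) := by
  rw [Metric.infDist_closure]
  exact not_le.1 fun h => hx (mem_smoothNhd hk hε h)

lemma curveAction_extension :
    curveAction M m Ω (fun s => μ (clampTime s)) (extMomentum ν) = curveAction M m Ω μ ν :=
  setLIntegral_congr_fun measurableSet_Ioo fun s hs => by
    simp only [clampTime_of_mem (Ioo_subset_Icc_self hs), extMomentum, indicator_of_mem hs]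

lemma mollMomentum_zero (k : Rd d → ℝ) (η : ℝ) (x : Rd d) :
    mollMomentum k η (0 : VectorMeasure (Rd d) (Rd d)) x = 0 := by
  ext i
  rw [mollMomentum_apply, posComp_zero, negComp_zero]
  simp

/-- The extension costs nothing: outside `(0,1)` the momentum is zero and the mollified density
stays in the mobility domain, so the action density vanishes. -/
lemma IsCE.lintegral_moll_le_curveAction (hCE : IsCE Ω μ₀ μ₁ μ ν) (hm : IsMobility M m)
    (hk : IsKernel k) (hΩ : IsOpen Ω) (hfr : volume (frontier Ω) = 0)
    (hadm : ∀ s, IsAdmissible M (μ (clampTime s))) {ε : ℝ} (hε : 0 < ε) :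
    ∫⁻ s, ∫⁻ x, actionDensity M m (mollDensity k ε (μ (clampTime s)) x)
      (mollMomentum k ε (extMomentum ν s) x) ≤ curveAction M m Ω μ ν := by
  rw [curveAction, ← lintegral_indicator measurableSet_Ioo]
  refine lintegral_mono fun s => ?_
  have := hCE.finite _ (clampTime_mem s)
  by_cases hs : s ∈ Ioo (0 : ℝ) 1
  · rw [indicator_of_mem hs, extMomentum, indicator_of_mem hs]
    simp only [clampTime_of_mem (Ioo_subset_Icc_self hs)] at this ⊢
    exact hm.lintegral_actionDensity_moll_le hk hε hfr hΩ
  · rw [indicator_of_notMem hs, extMomentum, indicator_of_notMem hs]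
    simp_rw [mollMomentum_zero, actionDensity_zero_right (mollDensity_mem hk hε (hadm s) _)]
    simp

end Assembly

theorem mainTheorem9 {d : ℕ} (M : ENNReal) (m : ℝ → ℝ) (hm : IsMobility M m)
    (k : Rd d → ℝ) (hk : IsKernel k)
    (Ω : Set (Rd d)) (hΩo : IsOpen Ω) (hΩb : Bornology.IsBounded Ω) (hΩc : Convex ℝ Ω)
    (hΩn : Ω.Nonempty)
    (𝔪 : NNReal) (μ₀ μ₁ : Measure (Rd d))
    (μ : ℝ → Measure (Rd d)) (ν : ℝ → VectorMeasure (Rd d) (Rd d))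
    (hCE : IsCE Ω μ₀ μ₁ μ ν) (hmass : μ₀ univ = 𝔪)
    (hfin : curveAction M m Ω μ ν < ⊤) :
    ∃ (Ωs : ℝ → Set (Rd d))
      (μs : ℝ → ℝ → ℝ → Measure (Rd d)) (νs : ℝ → ℝ → ℝ → VectorMeasure (Rd d) (Rd d))
      (ρ : ℝ → ℝ → ℝ × Rd d → ℝ) (w : ℝ → ℝ → ℝ × Rd d → Rd d),
      -- a decreasing family of smooth bounded convex open sets shrinking to `Ω`
      (∀ ε > 0, IsOpen (Ωs ε) ∧ Bornology.IsBounded (Ωs ε) ∧ Convex ℝ (Ωs ε) ∧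
        HasSmoothBoundary (Ωs ε)) ∧
      (∀ ε > 0, ∀ ε' ≥ ε, Ωs ε ⊆ Ωs ε') ∧
      (⋂ ε ∈ Ioi (0 : ℝ), Ωs ε) = closure Ω ∧
      -- the approximating curves
      (∀ ε > 0, ∀ δ ∈ Icc (0 : ℝ) 1,
        IsCE (Ωs ε) (smoothedEndpoint (Ωs ε) 𝔪 k ε δ μ₀) (smoothedEndpoint (Ωs ε) 𝔪 k ε δ μ₁)
          (μs ε δ) (νs ε δ) ∧
        (∀ s ∈ Icc (0 : ℝ) 1,
          μs ε δ s (Ωs ε) = 𝔪 ∧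
          μs ε δ s =
            (volume.restrict (Ωs ε)).withDensity (fun x => ENNReal.ofReal (ρ ε δ (s, x))) ∧
          νs ε δ s = (volume.restrict (Ωs ε)).withDensityᵥ (fun x => w ε δ (s, x))) ∧
        ContDiffOn ℝ ∞ (ρ ε δ) (Icc 0 1 ×ˢ closure (Ωs ε)) ∧
        ContDiffOn ℝ ∞ (w ε δ) (Icc 0 1 ×ˢ closure (Ωs ε)) ∧
        (∀ s ∈ Ioo (0 : ℝ) 1, ∀ x ∈ Ωs ε,
          deriv (fun t => ρ ε δ (t, x)) s + divergenceAt (fun y => w ε δ (s, y)) x = 0) ∧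
        (∀ s ∈ Icc (0 : ℝ) 1, ∀ x ∈ closure (Ωs ε),
          δ * (𝔪 : ℝ) / (volume (Ωs ε)).toReal ≤ ρ ε δ (s, x)) ∧
        (0 < δ → 0 < 𝔪 → 0 < δ * (𝔪 : ℝ) / (volume (Ωs ε)).toReal) ∧
        curveAction M m (Ωs ε) (μs ε δ) (νs ε δ) ≤
          ENNReal.ofReal ((1 + 2 * ε) ^ 2) * curveAction M m Ω μ ν) ∧
      -- convergence of the action
      Tendsto (fun p : ℝ × ℝ => curveAction M m (Ωs p.1) (μs p.1 p.2) (νs p.1 p.2))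
        (𝓝[>] 0 ×ˢ 𝓝[≥] 0) (𝓝 (curveAction M m Ω μ ν)) := by
  have hfrΩ : volume (frontier Ω) = 0 := hΩc.addHaar_frontier volume
  set μ' : ℝ → Measure (Rd d) := fun s => μ (clampTime s) with hμ'
  set ν' := extMomentum ν with hν'
  have h : IsGlobalCE (closure Ω) 𝔪 μ' ν' := hCE.isGlobalCE hΩb hmass
  have hadm : ∀ s, IsAdmissible M (μ' s) := fun s =>
    hCE.isAdmissible hk hm hfrΩ hfin (clampTime_mem s)
  have e0 : μ' 0 = μ₀ := by rw [hμ', ← hCE.initial]; simp only [clampTime_of_le le_rfl]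
  have e1 : μ' 1 = μ₁ := by rw [hμ', ← hCE.final]; simp only [clampTime_of_ge le_rfl]
  set U : ℝ → Set (Rd d) := smoothNhd k Ω with hUd
  have hU : ∀ ε > 0, IsOpen (U ε) := fun ε hε => isOpen_smoothNhd hk hε
  have hUb : ∀ ε > 0, Bornology.IsBounded (U ε) := fun ε hε => isBounded_smoothNhd hk hΩb hΩn hε
  have hUc : ∀ ε, Convex ℝ (U ε) := fun ε => convex_smoothNhd hk hΩc hΩn ε
  have hUfr : ∀ ε, volume (frontier (U ε)) = 0 := fun ε => (hUc ε).addHaar_frontier volume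
  have hU0 : ∀ ε > 0, volume (U ε) ≠ 0 := fun ε hε =>
    ((hU ε hε).measure_pos volume (hΩn.mono
      (subset_closure.trans (closure_subset_smoothNhd hk hε)))).ne'
  have hUt : ∀ ε > 0, volume (U ε) ≠ ⊤ := fun ε hε => (hUb ε hε).measure_lt_top.ne
  have hKU : ∀ ε > 0, ∀ x ∉ U ε, ε < Metric.infDist x (closure Ω) := fun ε hε x hx =>
    lt_infDist_closure_of_notMem_smoothNhd hk hε hx
  have hle : ∀ ε > 0, ∀ δ ∈ Icc (0 : ℝ) 1,
      curveAction M m (U ε) (approxCurve k (U ε) 𝔪 μ' ε δ) (approxFlux k (U ε) ν' ε δ) ≤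
        ENNReal.ofReal ((1 + 2 * ε) ^ 2) * curveAction M m Ω μ ν := fun ε hε δ hδ =>
    (h.curveAction_approx_le hk hε hadm hm (hKU ε hε) (hU ε hε) (hUb ε hε) (hU0 ε hε) hδ).trans
      (mul_le_mul_right (hCE.lintegral_moll_le_curveAction hm hk hΩo hfrΩ hadm hε) _)
  refine ⟨U, fun ε δ => approxCurve k (U ε) 𝔪 μ' ε δ, fun ε δ => approxFlux k (U ε) ν' ε δ,
    fun ε δ => approxDensity k (U ε) 𝔪 μ' ε δ, fun ε δ => approxMomentum k ν' ε δ,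
    fun ε hε => ⟨hU ε hε, hUb ε hε, hUc ε, hasSmoothBoundary_smoothNhd hk hΩc hΩn hε⟩,
    fun ε _ ε' hεε' => smoothNhd_mono hk hεε', iInter_smoothNhd hk hΩn,
    fun ε hε δ hδ => ⟨?_, fun s _ => ⟨?_, rfl, rfl⟩,
      (h.contDiff_approxDensity hk hε _ δ).contDiffOn,
      (h.contDiff_approxMomentum hk hε δ).contDiffOn,
      fun s _ x _ => h.deriv_approxDensity_add_divergenceAt hk hε _ δ s x,
      fun s _ x _ => ?_, fun hδ0 h𝔪 => ?_, hle ε hε δ hδ⟩, ?_⟩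
  · rw [← e0, ← e1]
    exact h.isCE_approx hk hε (hKU ε hε) (hU ε hε) (hUb ε hε) (hUfr ε) (hU0 ε hε) hδ
      (fun s hs => by simp only [hμ', clampTime_of_le hs, clampTime_of_le le_rfl])
      (fun s hs => by simp only [hμ', clampTime_of_ge hs, clampTime_of_ge le_rfl])
  · exact h.withDensity_approxDensity_apply hk hε (hKU ε hε) (hU ε hε) (hUb ε hε) (hU0 ε hε) hδ s
  · rw [mul_div_assoc]
    exact le_approxDensity hk hε hδ _
  · exact div_pos (mul_pos hδ0 h𝔪) (ENNReal.toReal_pos (hU0 ε hε) (hUt ε hε))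
  · have hev : ∀ᶠ p : ℝ × ℝ in 𝓝[>] 0 ×ˢ 𝓝[≥] 0, 0 < p.1 ∧ p.2 ∈ Icc (0 : ℝ) 1 :=
      prod_mem_prod self_mem_nhdsWithin (Icc_mem_nhdsGE (zero_lt_one' ℝ))
    refine tendsto_order.2 ⟨fun a ha => ?_, fun b hb => ?_⟩
    -- Failure of the lower bound would give a sequence of parameters tending to `(0,0)` whose
    -- actions stay at most `a`, against lower semicontinuity along sequences.
    · by_contra hcon
      obtain ⟨p, hp, hpa⟩ := exists_seq_forall_of_frequently
        ((not_eventually.1 hcon).and_eventually hev)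
      have hp1 : Tendsto (fun n => (p n).1) atTop (𝓝 0) :=
        (tendsto_fst.comp hp).mono_right nhdsWithin_le_nhds
      have hp2 : Tendsto (fun n => (p n).2) atTop (𝓝 0) :=
        (tendsto_snd.comp hp).mono_right nhdsWithin_le_nhds
      have hlow := h.curveAction_le_liminf (U := fun n => U (p n).1) hk (fun n => (hpa n).2.1) hp1
        (fun n => (hpa n).2.2) hp2 (fun n => hUb _ (hpa n).2.1) (fun n => hU0 _ (hpa n).2.1)
        (fun n => hKU _ (hpa n).2.1) hm hadm (fun n => hU _ (hpa n).2.1) (fun n => hUfr _)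
        hΩo hΩb hfrΩ rfl
      rw [curveAction_extension] at hlow
      refine (hlow.trans (liminf_le_of_le (by isBoundedDefault) fun b hb => ?_)).not_gt ha
      obtain ⟨n, hn⟩ := hb.exists
      exact hn.trans (not_lt.1 (hpa n).1)
    -- The upper half follows from the explicit bound, whose constant `(1 + 2ε)²` tends to one and
    -- does not involve `δ`.
    · have hlim : Tendsto (fun p : ℝ × ℝ => ENNReal.ofReal ((1 + 2 * p.1) ^ 2) *
          curveAction M m Ω μ ν) (𝓝[>] 0 ×ˢ 𝓝[≥] 0) (𝓝 (curveAction M m Ω μ ν)) := by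
        have hc : Tendsto (fun p : ℝ × ℝ => ENNReal.ofReal ((1 + 2 * p.1) ^ 2))
            (𝓝[>] 0 ×ˢ 𝓝[≥] 0) (𝓝 1) := by
          have h1 : Continuous fun r : ℝ => ENNReal.ofReal ((1 + 2 * r) ^ 2) :=
            ENNReal.continuous_ofReal.comp (by fun_prop)
          have h2 := (h1.tendsto 0).comp
            ((tendsto_fst (f := 𝓝[>] (0 : ℝ)) (g := 𝓝[≥] (0 : ℝ))).mono_right nhdsWithin_le_nhds)
          simpa [Function.comp_def] using h2
        simpa using ENNReal.Tendsto.mul_const hc (Or.inl one_ne_zero)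
      filter_upwards [hlim.eventually_lt_const hb, hev] with p hp hpp
      exact (hle p.1 hpp.1 p.2 hpp.2).trans_lt hp
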